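/- **Definitions.** A *non-commutative probability space* $(\mathcal M,\varphi)$ is a unital complex $*$-algebra $\mathcal M$ with a linear form $\varphi$ such that $\varphi(1)=1$, $\varphi(xy)=\varphi(yx)$, $\varphi(x^*)=\overline{\varphi(x)}$ and $\varphi(xx^*)\ge 0$ for all $x,y\in\mathcal M$. Subalgebras are unital and stable under $*$; $x$ is *centered* if $\varphi(x)=0$. A family of subalgebras is *independent* if distinct members commute and every product of centered elements taken from pairwise distinct members is centered; it is *free* if every product of centered elements, any two consecutive ones being taken from distinct members, is centered. For $t\in[0,+\infty)$ let $\nu_t$ be the law of the free unitary Brownian motion at time $t$, i.e. the probability measure on the unit circle, invariant under complex conjugation, whose moment of order $k\ge1$ is $e^{-kt/2}\sum_{j=0}^{k-1}\frac{(-t)^j}{j!}\binom{k}{j+1}k^{j-1}$, and let $\nu_{+\infty}$ be the uniform law on the circle. Let $t\in[0,+\infty]$. Two subalgebras $\mathcal A,\mathcal B$ of $(\mathcal M,\varphi)$ are *$t$-free* if, for all $r\ge 0$, $a_1,\dots,a_r\in\mathcal A$ and $b_1,\dots,b_r\in\mathcal B$, the number $\varphi(a_1b_1\cdots a_rb_r)$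 is equal to the expectation of $a_1(u_tb_1u_t^*)\cdots a_r(u_tb_ru_t^*)$ in the free product $[(\mathcal A,\varphi_{|\mathcal A})\otimes(\mathcal B,\varphi_{|\mathcal B})]*(\mathcal U^{(t)},\varphi_{\mathcal U^{(t)}})$, in which (the copies of) $\mathcal A$ and $\mathcal B$ are independent, and the algebra that they generate is free with a unitary $u_t$ of law $\nu_t$. For $\sigma\in\mathfrak S_n$ put $\varphi_\sigma(m_1,\dots,m_n)=\prod_{(i_1\dots i_r)}\varphi(m_{i_1}\cdots m_{i_r})$, the product being over all cycles $(i_1\dots i_r)$ of $\sigma$, fixed points included. For $n\ge2$, a *$t$-free cumulant of order $n$* is a family $(c(\sigma))_{\sigma\in\mathfrak S_n}$ of complex numbers such that $\sum_{\sigma\ n\text{-cycle}}c(\sigma)\ne0$ and such that, for every non-commutative probability space $(\mathcal M,\varphi)$, every pair $(\mathcal A,\mathcal B)$ of $t$-free subalgebras of $\mathcal M$ and all $m_1,\dots,m_n\in\mathcal A\cup\mathcal B$ which do not all belong to $\mathcal A$ and do not all belong to $\mathcal B$, $$\sum_{\sigma\in\mathfrak S_n}c(\sigma)\,\varphi_\sigma(m_1,\dots,m_n)=0.$$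 It is *conjugation-invariant* if $c(\rho\sigma\rho^{-1})=c(\sigma)$ for all $\sigma,\rho\in\mathfrak S_n$; then $c_\lambda$ denotes the value of $c$ on the permutations whose cycle lengths form the partition $\lambda$ of $n$. **Theorem.** For every $t\in[0,+\infty]$ and every $n\in\{2,3,4,5,6\}$ there exists, up to scaling, a unique conjugation-invariant $t$-free cumulant of order $n$: there is one, and the conjugation-invariant $t$-free cumulants of order $n$ are exactly its multiples by non-zero complex numbers. Normalized by $c_n=1$, its coefficients are given as follows, with $x=e^{-t}$ (and $x=0$ if $t=+\infty$). * $n=2$: $c_2=1$, $c_{11}=-1$. * $n=3$: $c_3=1$, $c_{21}=-2$, $c_{111}=4$. * $n=4$: $c_4=1$, $c_{31}=-3$, $c_{22}=-2(2+x^2)$, $c_{211}=2(5+x^2)$, $c_{1111}=-6(5+x^2)$. * $n=5$: $c_5=1$, $c_{41}=-4$, $c_{32}=-6(1+x^2)$, $c_{311}=6(3+x^2)$, $c_{221}=24(1+x^2)$, $c_{2111}=-12(7+5x^2)$, $c_{11111}=48(7+5x^2)$. * $n=6$: $c_6=1$, $c_{51}=-5$, $c_{42}=-4(2+3x^2)$,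 $c_{411}=4(7+3x^2)$, $c_{33}=-3(3+6x^2+x^3)$, $c_{321}=6(7+12x^2+x^3)$, $c_{3111}=-12(14+15x^2+x^3)$, $c_{222}=8(7+17x^2+6x^4)$, $c_{2211}=-8(28+53x^2+3x^3+6x^4)$, $c_{21111}=48(21+34x^2+2x^3+3x^4)$, $c_{111111}=-240(21+34x^2+2x^3+3x^4)$. -/

import Mathlib

open scoped ENNReal ComplexOrder

universe u

/-- A non-commutative probability space: a unital complex `*`-algebra with a unital, tracial,
hermitian, positive linear form `φ` (the expectation). -/
structure NCProbSpace where
  carrier : Type u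
  [ring : Ring carrier]
  [starRing : StarRing carrier]
  [algebra : Algebra ℂ carrier]
  [starModule : StarModule ℂ carrier]
  φ : carrier →ₗ[ℂ] ℂ
  φ_one : φ 1 = 1
  φ_mul_comm : ∀ x y, φ (x * y) = φ (y * x)
  φ_star : ∀ x, φ (star x) = star (φ x)
  φ_nonneg : ∀ x, 0 ≤ φ (x * star x)

namespace NCProbSpace

instance : CoeSort NCProbSpace.{u} (Type u) := ⟨carrier⟩

attribute [instance] ring starRing algebra starModule

/-- Independence of a family of unital `*`-subalgebras. -/
def Independent (M : NCProbSpace.{u}) {ι : Type*} (A : ι → StarSubalgebra ℂ M) : Prop :=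
  (∀ i j, i ≠ j → ∀ x ∈ A i, ∀ y ∈ A j, x * y = y * x) ∧
  ∀ (n : ℕ), 1 ≤ n → ∀ i : Fin n → ι, Function.Injective i →
    ∀ a : Fin n → M, (∀ k, a k ∈ A (i k)) → (∀ k, M.φ (a k) = 0) →
      M.φ (List.ofFn a).prod = 0

/-- Freeness of a family of unital `*`-subalgebras. -/
def Free (M : NCProbSpace.{u}) {ι : Type*} (A : ι → StarSubalgebra ℂ M) : Prop :=
  ∀ (n : ℕ), 1 ≤ n → ∀ i : Fin n → ι,
    (∀ k l : Fin n, (l : ℕ) = k + 1 → i k ≠ i l) →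
    ∀ a : Fin n → M, (∀ k, a k ∈ A (i k)) → (∀ k, M.φ (a k) = 0) →
      M.φ (List.ofFn a).prod = 0

end NCProbSpace

noncomputable section

/-- The `k`-th moment of the law of a free unitary Brownian motion at time `t ∈ [0, +∞]`:
for `k ≥ 1` it is `e^{-kt/2} ∑_{j<k} (-t)^j / j! * binom(k, j+1) * k^{j-1}` if `t < +∞`, and the
law at `t = +∞` is the uniform law on the unit circle. -/
def fubmMoment (t : ℝ≥0∞) (k : ℕ) : ℝ :=
  if k = 0 then 1
  else if t = ⊤ then 0
  else Real.exp (-(k * t.toReal / 2)) *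
    ∑ j ∈ Finset.range k,
      (-t.toReal) ^ j / (Nat.factorial j : ℝ) * (Nat.choose k (j + 1) : ℝ) *
        (k : ℝ) ^ ((j : ℤ) - 1)

namespace NCProbSpace

/-- `v` is a unitary element distributed as a free unitary Brownian motion at time `t`
(the moments of negative order are the conjugates of those of positive order). -/
def IsFreeUnitaryBM (X : NCProbSpace.{u}) (t : ℝ≥0∞) (v : X) : Prop :=
  v ∈ unitary (X : Type u) ∧ ∀ k : ℕ, X.φ (v ^ k) = (fubmMoment t k : ℂ)

/-- `X`, together with `i`, `j` and `v`, realizes `((A, φ) ⊗ (B, φ)) * (𝒰⁽ᵗ⁾, φ)`: the copies of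
`A` and `B` in `X` have the right expectation and are independent, and the algebra that they
generate is free with the unitary `v`, a free unitary Brownian motion at time `t`. -/
structure IsTFreeRealization (M : NCProbSpace.{u}) (t : ℝ≥0∞) (A B : StarSubalgebra ℂ M)
    (X : NCProbSpace.{u}) (i : A →⋆ₐ[ℂ] X) (j : B →⋆ₐ[ℂ] X) (v : X) : Prop where
  φ_left : ∀ a : A, X.φ (i a) = M.φ (a : M)
  φ_right : ∀ b : B, X.φ (j b) = M.φ (b : M)
  indep : X.Independent ![i.range, j.range]
  bm : X.IsFreeUnitaryBM t v
  free : X.Free ![i.range ⊔ j.range, StarAlgebra.adjoin ℂ {v}]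

/-- `A` and `B` are `t`-free: the morphism sending `A` to `A` and `v B v*` to `B`, from the
`t`-free product of `A` and `B` to `M`, preserves the expectation. The words below span the
algebra generated by `A` and `v B v*`. -/
def TFree (M : NCProbSpace.{u}) (t : ℝ≥0∞) (A B : StarSubalgebra ℂ M) : Prop :=
  ∃ (X : NCProbSpace.{u}) (i : A →⋆ₐ[ℂ] X) (j : B →⋆ₐ[ℂ] X) (v : X),
    M.IsTFreeRealization t A B X i j v ∧
    ∀ (n : ℕ) (a : Fin n → A) (b : Fin n → B),
      M.φ (List.ofFn fun k => (a k : M) * (b k : M)).prod =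
        X.φ (List.ofFn fun k => i (a k) * (v * j (b k) * star v)).prod

end NCProbSpace

end

/-- The cycle `[i, σ i, σ² i, …]` of `σ` through `i`, equal to `[i]` if `i` is a fixed point. -/
def cycleList {n : ℕ} (σ : Equiv.Perm (Fin n)) (i : Fin n) : List (Fin n) :=
  if σ i = i then [i] else σ.toList i

/-- `φ_σ(m₁, …, mₙ)`, the product over the cycles `(i₁ … i_r)` of `σ`, fixed points included, of
`φ(m_{i₁} ⋯ m_{i_r})`. Each cycle is read from its least element, which is immaterial since `φ`
is tracial. -/
def NCProbSpace.permForm (M : NCProbSpace.{u}) {n : ℕ} (σ : Equiv.Perm (Fin n))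
    (m : Fin n → M) : ℂ :=
  ∏ i with ∀ j, σ.SameCycle i j → i ≤ j, M.φ ((cycleList σ i).map m).prod

/-- A collection `(c(σ))_{σ ∈ 𝔖ₙ}` is a `t`-free cumulant of order `n ≥ 2`; the first sum is over
the `n`-cycles. -/
def IsTFreeCumulant (t : ℝ≥0∞) (n : ℕ) (c : Equiv.Perm (Fin n) → ℂ) : Prop :=
  (∑ σ with σ.cycleType = {n}, c σ) ≠ 0 ∧
  ∀ (M : NCProbSpace.{u}) (A B : StarSubalgebra ℂ M), M.TFree t A B →
    ∀ m : Fin n → M, (∀ i, m i ∈ A ∨ m i ∈ B) → (¬ ∀ i, m i ∈ A) → (¬ ∀ i, m i ∈ B) →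
      ∑ σ, c σ * M.permForm σ m = 0

def IsConjInvariant {n : ℕ} (c : Equiv.Perm (Fin n) → ℂ) : Prop :=
  ∀ σ ρ, c (ρ * σ * ρ⁻¹) = c σ

noncomputable section

/-- `e^{-t}` for `t ∈ [0, +∞]`. -/
def expNeg (t : ℝ≥0∞) : ℝ := if t = ⊤ then 0 else Real.exp (-t.toReal)

/-- The coefficient `c_λ`, as a polynomial in `x = e^{-t}`, for a partition `λ` of an integer
between `2` and `6`, given by the list of its parts in non-increasing order. -/
def tFreeCoeff (x : ℝ) : List ℕ → ℝ
  | [2] => 1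
  | [1, 1] => -1
  | [3] => 1
  | [2, 1] => -2
  | [1, 1, 1] => 4
  | [4] => 1
  | [3, 1] => -3
  | [2, 2] => -2 * (2 + x ^ 2)
  | [2, 1, 1] => 2 * (5 + x ^ 2)
  | [1, 1, 1, 1] => -6 * (5 + x ^ 2)
  | [5] => 1
  | [4, 1] => -4
  | [3, 2] => -6 * (1 + x ^ 2)
  | [3, 1, 1] => 6 * (3 + x ^ 2)
  | [2, 2, 1] => 24 * (1 + x ^ 2)
  | [2, 1, 1, 1] => -12 * (7 + 5 * x ^ 2)
  | [1, 1, 1, 1, 1] => 48 * (7 + 5 * x ^ 2)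
  | [6] => 1
  | [5, 1] => -5
  | [4, 2] => -4 * (2 + 3 * x ^ 2)
  | [4, 1, 1] => 4 * (7 + 3 * x ^ 2)
  | [3, 3] => -3 * (3 + 6 * x ^ 2 + x ^ 3)
  | [3, 2, 1] => 6 * (7 + 12 * x ^ 2 + x ^ 3)
  | [3, 1, 1, 1] => -12 * (14 + 15 * x ^ 2 + x ^ 3)
  | [2, 2, 2] => 8 * (7 + 17 * x ^ 2 + 6 * x ^ 4)
  | [2, 2, 1, 1] => -8 * (28 + 53 * x ^ 2 + 3 * x ^ 3 + 6 * x ^ 4)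
  | [2, 1, 1, 1, 1] => 48 * (21 + 34 * x ^ 2 + 2 * x ^ 3 + 3 * x ^ 4)
  | [1, 1, 1, 1, 1, 1] => -240 * (21 + 34 * x ^ 2 + 2 * x ^ 3 + 3 * x ^ 4)
  | _ => 0

/-- The cycle lengths of `σ`, fixed points included, in non-increasing order. -/
def cycleShape {n : ℕ} (σ : Equiv.Perm (Fin n)) : List ℕ :=
  σ.partition.parts.sort (· ≥ ·)

end

/-! For a class function $c$, put $\kappa(m_1,\dots,m_n)=\sum_\sigma
c(\sigma)\varphi_\sigma(m_1,\dots,m_n)$. This form is multilinear, and it is symmetric because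
conjugating $\sigma$ permutes the arguments of $\varphi_\sigma$ (`NCProbSpace.permForm_conj`). By
polarization, $\kappa$ vanishes on mixed arguments as soon as
$\kappa(a+b,\dots,a+b)=\kappa(a,\dots,a)+\kappa(b,\dots,b)$ for $a\in\mathcal A$, $b\in\mathcal B$
(`MultilinearMap.eq_zero_of_map_const_add`). On the diagonal, $\varphi_\sigma(y,\dots,y)$ is the
product of the moments $\varphi(y^k)$ over the cycle lengths $k$, so only the moments of $a$, $b$
and $a+b$ up to order $6$ matter.

Existence. Up to rotation, a word of length at most $6$ in $a,b$ has two blocks, four blocks, or is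
$ababab$. For centered letters, freeness allows each $u_t^{\pm1}$ to be replaced by its expectation
$e^{-t/2}$: the error terms are alternating products with at most one non-centered factor outside
the algebra of $u_t$, and these vanish. Hence the moments of $a+b$ are polynomials in $x=e^{-t}$ and
in the moments of $a$ and $b$ (`mixMoment`), and no moment of $\nu_t$ beyond the first enters. What
remains is two polynomial identities on the coefficients: invariance under translation by scalars
(`momentSum_shiftMoment`), which reduces to centered elements, and additivity on these
(`momentSum_mixMoment`).

Uniqueness. Subtracting from $c$ the multiple $c_n$ of the known cumulant leaves a class function
which still kills mixed arguments and vanishes on $n$-cycles. Testing it on $a+s$ and $b+s'$, with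
$a,b$ unitary elements of finite order in $t$-free subalgebras, gives a triangular linear system
which forces it to be zero.

These tests need an actual $t$-free pair, hence a positive tracial state on a free product. It is
built on the group algebra of $(C\times C)*\mathbb Z$, with $C$ cyclic of order $60$. Positivity of
a free product of states follows from Schur's product theorem applied to Gram matrices
(`IsFreeState.posSemidef_gram`). Positivity of $\nu_t$ itself, given only by its moments, follows
from the functional equation of the moment series $\psi$, obtained by Lagrange inversion:
$\psi/(1+\psi)=Xe^{-t(1/2+\psi)}$. If $1/2+\psi$ has nonnegative real part on the first $N$
coefficients, the right-hand side acts as a contraction on the first $N+1$, and by the Cayley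
transform $1/2+\psi$ has nonnegative real part there (`truncInner_nonneg`). -/

/-! ### Cycles of a permutation as lists -/

section CycleList

variable {n : ℕ}

theorem mem_cycleList {σ : Equiv.Perm (Fin n)} {i j : Fin n} :
    j ∈ cycleList σ i ↔ σ.SameCycle i j := by
  unfold cycleList
  split_ifs with h
  · rw [List.mem_singleton]
    constructor
    · rintro rfl; exact Equiv.Perm.SameCycle.refl _ _
    · intro hs
      exact (hs.eq_of_left h).symm
  · rw [Equiv.Perm.mem_toList_iff]
    exact ⟨fun h' => h'.1, fun h' => ⟨h', Equiv.Perm.mem_support.2 h⟩⟩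

theorem nodup_cycleList (σ : Equiv.Perm (Fin n)) (i : Fin n) : (cycleList σ i).Nodup := by
  unfold cycleList
  split_ifs with h
  · exact List.nodup_singleton i
  · exact Equiv.Perm.nodup_toList σ i

theorem cycleList_isRotated {σ : Equiv.Perm (Fin n)} {i j : Fin n} (h : σ.SameCycle i j) :
    cycleList σ i ~r cycleList σ j := by
  by_cases hi : σ i = i
  · rw [h.eq_of_left hi]
  · have hj : σ j ≠ j := fun hj => hi ((h.apply_eq_self_iff).2 hj)
    rw [cycleList, cycleList, if_neg hi, if_neg hj]
    exact h.toList_isRotated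

theorem cycleList_conj (σ ρ : Equiv.Perm (Fin n)) (i : Fin n) :
    cycleList (ρ * σ * ρ⁻¹) (ρ i) = (cycleList σ i).map ρ := by
  unfold cycleList
  have h : (ρ * σ * ρ⁻¹) (ρ i) = ρ i ↔ σ i = i := by simp
  by_cases hi : σ i = i
  · rw [if_pos (h.2 hi), if_pos hi, List.map_singleton]
  · rw [if_neg (mt h.1 hi), if_neg hi]
    have hl : ((ρ * σ * ρ⁻¹).toList (ρ i)).length = (σ.toList i).length := by
      rw [← List.length_map (as := σ.toList i) ρ, ← List.toFinset_card_of_nodup (Equiv.Perm.nodup_toList _ _),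
        ← List.toFinset_card_of_nodup ((Equiv.Perm.nodup_toList σ i).map ρ.injective)]
      congr 1
      ext j
      obtain ⟨j, rfl⟩ := ρ.surjective j
      simp [Equiv.Perm.mem_toList_iff, Equiv.Perm.sameCycle_conj]
    refine List.ext_getElem (by rw [hl, List.length_map]) fun k h1 h2 => ?_
    rw [Equiv.Perm.getElem_toList, List.getElem_map, Equiv.Perm.getElem_toList, conj_pow]
    simp

end CycleList

/-! ### The multilinear forms $\varphi_\sigma$ -/

section PermForm

variable {n : ℕ} (M : NCProbSpace.{u})

theorem NCProbSpace.φ_prod_eq_of_isRotated {l l' : List M} (h : l ~r l') :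
    M.φ l.prod = M.φ l'.prod := by
  obtain ⟨k, rfl⟩ := h
  rw [List.rotate_eq_drop_append_take_mod, List.prod_append, M.φ_mul_comm, ← List.prod_append,
    List.take_append_drop]

theorem NCProbSpace.φ_cycleList_congr {σ : Equiv.Perm (Fin n)} {i j : Fin n}
    (h : σ.SameCycle i j) (m : Fin n → M) :
    M.φ ((cycleList σ i).map m).prod = M.φ ((cycleList σ j).map m).prod :=
  M.φ_prod_eq_of_isRotated ((cycleList_isRotated h).map m)

/-- A set of indices which meets each cycle of `σ`, fixed points included, exactly once. -/
def IsCycleTransversal (σ : Equiv.Perm (Fin n)) (T : Finset (Fin n)) : Prop :=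
  ∀ j, ∃! i, i ∈ T ∧ σ.SameCycle i j

theorem isCycleTransversal_min (σ : Equiv.Perm (Fin n)) :
    IsCycleTransversal σ (Finset.univ.filter fun i => ∀ j, σ.SameCycle i j → i ≤ j) := by
  intro j
  let S : Finset (Fin n) := Finset.univ.filter fun i => σ.SameCycle i j
  have hS : S.Nonempty := ⟨j, by simp [S, Equiv.Perm.SameCycle.refl]⟩
  have hm : σ.SameCycle (S.min' hS) j := by
    have := S.min'_mem hS
    simpa [S] using this
  refine ⟨S.min' hS, ⟨?_, hm⟩, ?_⟩
  · rw [Finset.mem_filter]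
    refine ⟨Finset.mem_univ _, fun k hk => S.min'_le k ?_⟩
    simpa [S] using hk.symm.trans hm
  · rintro i ⟨hi, hij⟩
    rw [Finset.mem_filter] at hi
    exact le_antisymm (hi.2 _ (hij.trans hm.symm)) (S.min'_le i (by simpa [S] using hij))

/-- Traciality makes the factor of a cycle independent of its starting point. This freedom is needed
because conjugation by a permutation does not preserve the least elements of cycles. -/
theorem NCProbSpace.permForm_eq_of_transversal {σ : Equiv.Perm (Fin n)} {T : Finset (Fin n)}
    (hT : IsCycleTransversal σ T) (m : Fin n → M) :
    M.permForm σ m = ∏ i ∈ T, M.φ ((cycleList σ i).map m).prod := by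
  have h0 := isCycleTransversal_min σ
  choose f hf hf' using fun j => hT j
  unfold NCProbSpace.permForm
  refine Finset.prod_bij (fun i _ => f i) (fun i _ => (hf i).1) ?_ ?_
    (fun i _ => (M.φ_cycleList_congr (hf i).2 m).symm)
  · intro i hi j hj hij
    refine (h0 j).unique ⟨hi, ?_⟩ ⟨hj, Equiv.Perm.SameCycle.refl _ _⟩
    have := (hf i).2.symm
    rw [hij] at this
    exact this.trans (hf j).2
  · intro k hk
    obtain ⟨i, ⟨hi, hik⟩, -⟩ := h0 k
    exact ⟨i, hi, ((hf' i) k ⟨hk, hik.symm⟩).symm⟩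

theorem NCProbSpace.permForm_conj (σ ρ : Equiv.Perm (Fin n)) (m : Fin n → M) :
    M.permForm (ρ * σ * ρ⁻¹) m = M.permForm σ (m ∘ ρ) := by
  have h0 := isCycleTransversal_min σ
  set T := Finset.univ.filter fun i => ∀ j, σ.SameCycle i j → i ≤ j
  have hT : IsCycleTransversal (ρ * σ * ρ⁻¹) (T.map ρ.toEmbedding) := by
    intro j
    obtain ⟨i, ⟨hi, hij⟩, hu⟩ := h0 (ρ⁻¹ j)
    refine ⟨ρ i, ⟨by simpa using hi, by simpa [Equiv.Perm.sameCycle_conj] using hij⟩, ?_⟩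
    rintro k ⟨hk, hkj⟩
    obtain ⟨k, hk', rfl⟩ := Finset.mem_map.1 hk
    simp only [Equiv.coe_toEmbedding, Equiv.Perm.sameCycle_conj, Equiv.Perm.coe_inv,
      Equiv.symm_apply_apply] at hkj ⊢
    rw [hu k ⟨hk', hkj⟩]
  rw [M.permForm_eq_of_transversal hT, M.permForm_eq_of_transversal h0, Finset.prod_map]
  refine Finset.prod_congr rfl fun i _ => ?_
  rw [Equiv.coe_toEmbedding, cycleList_conj, List.map_map]

/-- A product over a list in which `k` occurs exactly once is additive in the factor at `k`. -/
theorem List.prod_map_update_add {R ι : Type*} [Semiring R] [DecidableEq ι] {l : List ι}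
    (hl : l.Nodup) {k : ι} (hk : k ∈ l) (m : ι → R) (x y : R) :
    (l.map (Function.update m k (x + y))).prod =
      (l.map (Function.update m k x)).prod + (l.map (Function.update m k y)).prod := by
  obtain ⟨l₁, l₂, rfl⟩ := List.append_of_mem hk
  have h1 : k ∉ l₁ := fun h => by
    have := List.nodup_append.1 hl
    exact this.2.2 k h k (by simp) rfl
  have h2 : k ∉ l₂ := (List.nodup_cons.1 (List.nodup_append.1 hl).2.1).1
  have e : ∀ (l : List ι), k ∉ l → ∀ z, l.map (Function.update m k z) = l.map m := fun l h z =>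
    List.map_congr_left fun i hi => Function.update_of_ne (by rintro rfl; exact h hi) _ _
  simp only [List.map_append, List.map_cons, e _ h1, e _ h2, List.prod_append, List.prod_cons,
    Function.update_self]
  rw [add_mul, mul_add]

theorem List.prod_map_update_smul {R ι : Type*} [Ring R] [Algebra ℂ R] [DecidableEq ι] {l : List ι}
    (hl : l.Nodup) {k : ι} (hk : k ∈ l) (m : ι → R) (c : ℂ) (x : R) :
    (l.map (Function.update m k (c • x))).prod =
      c • (l.map (Function.update m k x)).prod := by
  obtain ⟨l₁, l₂, rfl⟩ := List.append_of_mem hk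
  have h1 : k ∉ l₁ := fun h => by
    have := List.nodup_append.1 hl
    exact this.2.2 k h k (by simp) rfl
  have h2 : k ∉ l₂ := (List.nodup_cons.1 (List.nodup_append.1 hl).2.1).1
  have e : ∀ (l : List ι), k ∉ l → ∀ z, l.map (Function.update m k z) = l.map m := fun l h z =>
    List.map_congr_left fun i hi => Function.update_of_ne (by rintro rfl; exact h hi) _ _
  simp only [List.map_append, List.map_cons, e _ h1, e _ h2, List.prod_append, List.prod_cons,
    Function.update_self]
  simp

/-- Only the cycle through `k` involves the argument of index `k`; `C` collects the factors of the
other cycles. Multilinearity of $\varphi_\sigma$ thus reduces to that of a single product. -/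
theorem NCProbSpace.permForm_update (σ : Equiv.Perm (Fin n)) (m : Fin n → M) (k : Fin n) :
    ∃ (i : Fin n) (C : ℂ), k ∈ cycleList σ i ∧ ∀ z, M.permForm σ (Function.update m k z) =
      M.φ ((cycleList σ i).map (Function.update m k z)).prod * C := by
  have h0 := isCycleTransversal_min σ
  set T := Finset.univ.filter fun i => ∀ j, σ.SameCycle i j → i ≤ j
  obtain ⟨i, ⟨hi, hik⟩, hu⟩ := h0 k
  refine ⟨i, ∏ j ∈ T.erase i, M.φ ((cycleList σ j).map m).prod, mem_cycleList.2 hik, fun z => ?_⟩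
  rw [M.permForm_eq_of_transversal h0, ← Finset.mul_prod_erase T _ hi]
  congr 1
  refine Finset.prod_congr rfl fun j hj => ?_
  congr 2
  refine List.map_congr_left fun l hl => Function.update_of_ne ?_ _ _
  rintro rfl
  exact (Finset.mem_erase.1 hj).1 (hu j ⟨(Finset.mem_erase.1 hj).2, mem_cycleList.1 hl⟩)

/-- `φ_σ` as a multilinear form. -/
def NCProbSpace.permFormMultilinear (σ : Equiv.Perm (Fin n)) :
    MultilinearMap ℂ (fun _ : Fin n => (M : Type u)) ℂ where
  toFun := M.permForm σ
  map_update_add' := by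
    intro inst m k x y
    obtain rfl := Subsingleton.elim inst (instDecidableEqFin n)
    obtain ⟨i, C, hk, h⟩ := M.permForm_update σ m k
    rw [h, h, h, List.prod_map_update_add (nodup_cycleList σ i) hk, map_add, add_mul]
  map_update_smul' := by
    intro inst m k c x
    obtain rfl := Subsingleton.elim inst (instDecidableEqFin n)
    obtain ⟨i, C, hk, h⟩ := M.permForm_update σ m k
    rw [h, h, List.prod_map_update_smul (nodup_cycleList σ i) hk, map_smul, smul_eq_mul,
      smul_eq_mul, mul_assoc]

theorem length_cycleList (σ : Equiv.Perm (Fin n)) {i : Fin n} (hi : σ i ≠ i) :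
    (cycleList σ i).length = (σ.cycleOf i).support.card := by
  rw [cycleList, if_neg hi, Equiv.Perm.length_toList]

theorem NCProbSpace.permForm_const (σ : Equiv.Perm (Fin n)) (y : M) :
    M.permForm σ (fun _ => y) = (σ.partition.parts.map fun k => M.φ (y ^ k)).prod := by
  have h0 := isCycleTransversal_min σ
  set T := Finset.univ.filter fun i => ∀ j, σ.SameCycle i j → i ≤ j
  rw [M.permForm_eq_of_transversal h0, Equiv.Perm.parts_partition, Multiset.map_add,
    Multiset.prod_add, Multiset.map_replicate, Multiset.prod_replicate,
    -- `cycleType` omits the fixed points, so they are separated. The other representatives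
    -- correspond bijectively to the cycle factors by `cycleOf`.
    ← Finset.prod_filter_mul_prod_filter_not T (fun i => σ i ≠ i)]
  simp only [List.map_const', List.prod_replicate]
  congr 1
  · rw [Equiv.Perm.cycleType_def, Multiset.map_map]
    change _ = ∏ τ ∈ σ.cycleFactorsFinset, M.φ (y ^ τ.support.card)
    refine Finset.prod_bij (fun i _ => σ.cycleOf i) ?_ ?_ ?_ ?_
    · intro i hi
      rw [Equiv.Perm.cycleOf_mem_cycleFactorsFinset_iff, Equiv.Perm.mem_support]
      exact (Finset.mem_filter.1 hi).2
    · intro i hi j hj hij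
      refine (h0 j).unique ⟨(Finset.mem_filter.1 hi).1, ?_⟩
        ⟨(Finset.mem_filter.1 hj).1, Equiv.Perm.SameCycle.refl _ _⟩
      have hj' : j ∈ (σ.cycleOf i).support := by
        rw [hij, Equiv.Perm.mem_support, Equiv.Perm.cycleOf_apply_self]
        exact (Finset.mem_filter.1 hj).2
      exact (Equiv.Perm.mem_support_cycleOf_iff.1 hj').1
    · intro τ hτ
      obtain ⟨hc, h⟩ := Equiv.Perm.mem_cycleFactorsFinset_iff.1 hτ
      obtain ⟨j, hj⟩ := hc.nonempty_support
      obtain ⟨i, ⟨hi, hij⟩, -⟩ := h0 j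
      have hσj : σ j ≠ j := by
        rw [← h j hj]; exact Equiv.Perm.mem_support.1 hj
      refine ⟨i, Finset.mem_filter.2 ⟨hi, fun h' => hσj (hij.apply_eq_self_iff.1 h')⟩, ?_⟩
      rw [hij.cycleOf_eq]
      exact (Equiv.Perm.cycle_is_cycleOf hj hτ).symm
    · intro i hi
      rw [length_cycleList σ (Finset.mem_filter.1 hi).2]
  · have : ∀ i ∈ T.filter (fun i => ¬ σ i ≠ i), M.φ (y ^ (cycleList σ i).length) = M.φ (y ^ 1) := by
      intro i hi
      rw [cycleList, if_pos (not_not.1 (Finset.mem_filter.1 hi).2), List.length_singleton]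
    rw [Finset.prod_congr rfl this, Finset.prod_const]
    congr 1
    have hT : T.filter (fun i => ¬ σ i ≠ i) = σ.supportᶜ := by
      ext i
      simp only [Finset.mem_filter, Finset.mem_compl, Equiv.Perm.mem_support, not_not,
        Finset.mem_univ, true_and, T, and_iff_right_iff_imp]
      intro h j hj
      rw [hj.eq_of_left h]
    rw [hT, Finset.card_compl]

end PermForm

/-! ### Polarization of symmetric multilinear forms -/

section Polarization

/-- The subsets `S` and `insert k S` contribute with opposite signs. -/
theorem Finset.sum_neg_one_pow_card_mul_eq_zero {α R : Type*} [Fintype α] [DecidableEq α] [CommRing R]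
    (F : Finset α → R) (k : α) (h : ∀ S, k ∉ S → F (insert k S) = F S) :
    ∑ S : Finset α, (-1) ^ S.card * F S = 0 := by
  rw [← Finset.powerset_univ, ← Finset.insert_erase (Finset.mem_univ k),
    Finset.sum_powerset_insert (Finset.notMem_erase _ _), ← Finset.sum_add_distrib]
  refine Finset.sum_eq_zero fun S hS => ?_
  have hk : k ∉ S := fun hk => Finset.notMem_erase _ _ (Finset.mem_powerset.1 hS hk)
  rw [h S hk, Finset.card_insert_of_notMem hk, pow_succ]
  ring

/-- Expanding by multilinearity gives terms indexed by maps `f`, each present for the sets `S` that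
contain the range of `f`. The signed count of these sets vanishes unless `f` is onto, so only the
$n!$ permutations remain, and they all give the same value by symmetry. -/
theorem MultilinearMap.sum_neg_one_pow_card_mul_const {E : Type*} {n : ℕ} [AddCommGroup E] [Module ℂ E]
    (K : MultilinearMap ℂ (fun _ : Fin n => E) ℂ)
    (hK : ∀ (ρ : Equiv.Perm (Fin n)) m, K (m ∘ ρ) = K m) (m : Fin n → E) :
    ∑ S : Finset (Fin n), (-1) ^ S.card * K (fun _ => ∑ i ∈ S, m i) =
      (-1) ^ n * n.factorial * K m := by
  have h1 : ∀ S : Finset (Fin n), K (fun _ => ∑ i ∈ S, m i) =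
      ∑ f : Fin n → Fin n, if (∀ i, f i ∈ S) then K (m ∘ f) else 0 := by
    intro S
    rw [K.map_sum_finset (fun _ i => m i) (fun _ => S), ← Finset.sum_filter]
    refine Finset.sum_congr ?_ fun _ _ => rfl
    ext f; simp
  simp_rw [h1, Finset.mul_sum]
  rw [Finset.sum_comm]
  have h2 : ∀ f : Fin n → Fin n, (∑ S : Finset (Fin n), (-1 : ℂ) ^ S.card *
      if (∀ i, f i ∈ S) then K (m ∘ f) else 0) =
      if Function.Bijective f then (-1) ^ n * K m else 0 := by
    intro f
    split_ifs with hf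
    · rw [Finset.sum_eq_single Finset.univ]
      · simp only [Finset.mem_univ, implies_true, if_true, Finset.card_univ, Fintype.card_fin]
        rw [← hK (Equiv.ofBijective f hf) m]
        rfl
      · intro S _ hS
        rw [if_neg, mul_zero]
        intro h
        refine hS (Finset.eq_univ_of_forall fun i => ?_)
        obtain ⟨j, rfl⟩ := hf.2 i
        exact h j
      · simp
    · have hs : ¬ Function.Surjective f := fun hs => hf ⟨Finite.injective_iff_surjective.2 hs, hs⟩
      simp only [Function.Surjective, not_forall, not_exists] at hs
      obtain ⟨k, hk⟩ := hs
      refine Finset.sum_neg_one_pow_card_mul_eq_zero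
        (fun S => if (∀ i, f i ∈ S) then K (m ∘ f) else 0) k fun S _ => ?_
      simp only [Finset.mem_insert, hk, false_or]
  simp_rw [h2]
  rw [← Finset.sum_filter, Finset.sum_const, nsmul_eq_mul]
  have h3 : (Finset.univ.filter fun f : Fin n → Fin n => Function.Bijective f).card =
      n.factorial := by
    rw [← Fintype.card_subtype, ← Fintype.card_congr (Equiv.ofBijective
      (fun ρ : Equiv.Perm (Fin n) => (⟨ρ, ρ.bijective⟩ : {f : Fin n → Fin n // Function.Bijective f}))
      ⟨fun a b h => Equiv.coe_fn_injective (congrArg Subtype.val h),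
        fun f => ⟨Equiv.ofBijective f.1 f.2, rfl⟩⟩), Fintype.card_perm, Fintype.card_fin]
  rw [h3]
  ring

/-- A symmetric multilinear form which is additive on sums `a + b` with `a ∈ A` and `b ∈ B`
vanishes on mixed arguments. -/
theorem MultilinearMap.eq_zero_of_map_const_add {E : Type*} {n : ℕ} [AddCommGroup E] [Module ℂ E]
    (K : MultilinearMap ℂ (fun _ : Fin n => E) ℂ)
    (hK : ∀ (ρ : Equiv.Perm (Fin n)) m, K (m ∘ ρ) = K m) (A B : Submodule ℂ E)
    (hAB : ∀ a ∈ A, ∀ b ∈ B, K (fun _ => a + b) = K (fun _ => a) + K (fun _ => b))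
    (m : Fin n → E) (hm : ∀ i, m i ∈ A ∨ m i ∈ B) (hA : ¬ ∀ i, m i ∈ A) (hB : ¬ ∀ i, m i ∈ B) :
    K m = 0 := by
  classical
  push Not at hA hB
  obtain ⟨q, hq⟩ := hA
  obtain ⟨p, hp⟩ := hB
  have hpA : m p ∈ A := (hm p).resolve_right hp
  have h := K.sum_neg_one_pow_card_mul_const hK m
  -- Each partial sum splits as an element of `A` plus an element of `B`; the arguments that lie in
  -- both are put on the side of `A`.
  have hS : ∀ S : Finset (Fin n), K (fun _ => ∑ i ∈ S, m i) =
      K (fun _ => ∑ i ∈ S with m i ∈ A, m i) + K (fun _ => ∑ i ∈ S with m i ∉ A, m i) := by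
    intro S
    rw [← hAB _ (A.sum_mem fun i hi => (Finset.mem_filter.1 hi).2) _
      (B.sum_mem fun i hi => (hm i).resolve_left (Finset.mem_filter.1 hi).2),
      Finset.sum_filter_add_sum_filter_not]
  rw [Finset.sum_congr rfl fun S _ => by rw [hS S, mul_add], Finset.sum_add_distrib] at h
  -- The part in `A` does not see the index `q`, since `m q ∉ A`, and the other part does not see
  -- `p`, since `m p ∈ A`. Both alternating sums therefore cancel.
  rw [Finset.sum_neg_one_pow_card_mul_eq_zero
      (fun S => K (fun _ => ∑ i ∈ S with m i ∈ A, m i)) q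
      (fun S _ => by rw [Finset.filter_insert, if_neg hq]),
    Finset.sum_neg_one_pow_card_mul_eq_zero
      (fun S => K (fun _ => ∑ i ∈ S with m i ∉ A, m i)) p
      (fun S _ => by rw [Finset.filter_insert, if_neg (not_not.2 hpA)]), add_zero] at h
  have hn : ((-1 : ℂ) ^ n * n.factorial) ≠ 0 :=
    mul_ne_zero (pow_ne_zero _ (by norm_num)) (Nat.cast_ne_zero.2 n.factorial_ne_zero)
  exact (mul_eq_zero.1 h.symm).resolve_left hn

end Polarization

/-! ### Sums over permutations, grouped by cycle lengths -/

section CycleShape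

/-- The non-increasing lists of at most `f` positive integers at most `b` with sum `n`. -/
def sortedParts : ℕ → ℕ → ℕ → List (List ℕ)
  | 0, n, _ => if n = 0 then [[]] else []
  | f + 1, n, b => (if n = 0 then [[]] else []) ++ (List.range b).flatMap fun k =>
      if k + 1 ≤ n then (sortedParts f (n - (k + 1)) (k + 1)).map ((k + 1) :: ·) else []

theorem mem_sortedParts {f n b : ℕ} {l : List ℕ} (hf : l.length ≤ f) (hs : l.Pairwise (· ≥ ·))
    (hp : ∀ k ∈ l, 1 ≤ k ∧ k ≤ b) (hn : l.sum = n) : l ∈ sortedParts f n b := by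
  induction f generalizing n b l with
  | zero =>
    obtain rfl := List.length_eq_zero_iff.1 (Nat.le_zero.1 hf)
    simp only [List.sum_nil] at hn
    simp [sortedParts, ← hn]
  | succ f ih =>
    cases l with
    | nil =>
      simp only [List.sum_nil] at hn
      simp [sortedParts, ← hn]
    | cons k l =>
      rw [List.pairwise_cons] at hs
      obtain ⟨h1, h2⟩ := hp k (by simp)
      rw [List.sum_cons] at hn
      refine List.mem_append_right _ (List.mem_flatMap.2 ⟨k - 1, List.mem_range.2 (by omega), ?_⟩)
      rw [Nat.sub_add_cancel h1, if_pos (by omega)]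
      exact List.mem_map.2 ⟨l, ih (by simpa using hf) hs.2
        (fun j hj => ⟨(hp j (by simp [hj])).1, hs.1 j hj⟩) (by omega), rfl⟩

theorem sum_cycleShape_eq {n : ℕ} (σ : Equiv.Perm (Fin n)) : (cycleShape σ).sum = n := by
  have h : ((cycleShape σ : List ℕ) : Multiset ℕ) = σ.partition.parts := Multiset.sort_eq _ _
  rw [← Multiset.sum_coe, h, σ.partition.parts_sum, Fintype.card_fin]

theorem cycleShape_mem_sortedParts {n : ℕ} (σ : Equiv.Perm (Fin n)) :
    cycleShape σ ∈ sortedParts n n n := by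
  have h : ((cycleShape σ : List ℕ) : Multiset ℕ) = σ.partition.parts := Multiset.sort_eq _ _
  have hp : ∀ k ∈ cycleShape σ, 1 ≤ k := fun k hk =>
    σ.partition.parts_pos (by rw [← h]; exact hk)
  have hsum := sum_cycleShape_eq σ
  refine mem_sortedParts ?_ (Multiset.pairwise_sort _ _) (fun k hk => ⟨hp k hk, ?_⟩) hsum
  · have := List.length_le_sum_of_one_le _ hp
    omega
  · have := List.le_sum_of_mem hk
    omega

theorem sum_comp_cycleShape {n : ℕ} (F : List ℕ → ℂ) :
    ∑ σ : Equiv.Perm (Fin n), F (cycleShape σ) = ∑ l ∈ (sortedParts n n n).toFinset,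
      (Finset.univ.filter fun σ : Equiv.Perm (Fin n) => cycleShape σ = l).card * F l := by
  rw [← Finset.sum_fiberwise_of_maps_to (t := (sortedParts n n n).toFinset) (g := cycleShape)
    (fun σ _ => List.mem_toFinset.2 (cycleShape_mem_sortedParts σ))]
  refine Finset.sum_congr rfl fun l _ => ?_
  rw [Finset.sum_congr rfl fun σ hσ => by rw [(Finset.mem_filter.1 hσ).2], Finset.sum_const,
    nsmul_eq_mul]

/-- A partition of `n` is determined by its parts that are at least `2`: the missing ones are all
equal to `1`, and their number is fixed by the sum. -/
theorem cycleShape_eq_iff {n : ℕ} {l : List ℕ} (hs : l.Pairwise (· ≥ ·)) (hp : ∀ k ∈ l, 1 ≤ k)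
    (hn : l.sum = n) (σ : Equiv.Perm (Fin n)) :
    cycleShape σ = l ↔ σ.cycleType = (l.filter (2 ≤ ·) : List ℕ) := by
  have h : ((cycleShape σ : List ℕ) : Multiset ℕ) = σ.partition.parts := Multiset.sort_eq _ _
  have h' := σ.filter_parts_partition_eq_cycleType
  constructor
  · rintro rfl
    rw [← h', ← h, Multiset.filter_coe]
  · intro hc
    have key : (l : Multiset ℕ) = σ.partition.parts := by
      have e : ∀ s : Multiset ℕ, (∀ k ∈ s, 1 ≤ k) → s.sum = n →
          s = s.filter (2 ≤ ·) + Multiset.replicate (n - (s.filter (2 ≤ ·)).sum) 1 := by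
        intro s hs1 hs2
        have h3 := Multiset.filter_add_not (2 ≤ ·) s
        have h4 : s.filter (fun k => ¬ 2 ≤ k) =
            Multiset.replicate (Multiset.card (s.filter (fun k => ¬ 2 ≤ k))) 1 := by
          refine Multiset.eq_replicate_card.2 fun k hk => ?_
          have := hs1 k (Multiset.mem_of_mem_filter hk)
          have := Multiset.of_mem_filter hk
          omega
        have h5 := congrArg Multiset.sum h3
        rw [Multiset.sum_add, h4, Multiset.sum_replicate, hs2] at h5
        conv_lhs => rw [← h3, h4]
        congr 2
        rw [smul_eq_mul, mul_one] at h5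
        omega
      rw [e l (by simpa using hp) (by simpa using hn), e σ.partition.parts
        (fun k hk => σ.partition.parts_pos hk) (by rw [σ.partition.parts_sum, Fintype.card_fin]),
        h', hc, Multiset.filter_coe]
    have := Multiset.pairwise_sort σ.partition.parts (· ≥ ·)
    refine List.Perm.eq_of_pairwise (fun a b _ _ h1 h2 => le_antisymm h2 h1) this hs ?_
    exact Multiset.coe_eq_coe.1 (h.trans key.symm)

/-- The second factor is the order of the centralizer of a permutation of shape `l`. -/
theorem card_cycleShape {n : ℕ} {l : List ℕ} (hs : l.Pairwise (· ≥ ·)) (hp : ∀ k ∈ l, 1 ≤ k)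
    (hn : l.sum = n) :
    (Finset.univ.filter fun σ : Equiv.Perm (Fin n) => cycleShape σ = l).card *
      (((l.count 1).factorial * (l.filter (2 ≤ ·)).prod) *
        ∏ k ∈ (l.filter (2 ≤ ·)).toFinset, ((l.filter (2 ≤ ·)).count k).factorial) =
      n.factorial := by
  have h := Equiv.Perm.card_of_cycleType_mul_eq (Fin n) (l.filter (2 ≤ ·) : List ℕ)
  have hsum : (l.filter (2 ≤ ·)).sum + l.count 1 = n := by
    rw [← hn]
    clear hn h hs
    induction l with
    | nil => rfl
    | cons a l ih =>
      have ih := ih fun k hk => hp k (by simp [hk])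
      have ha := hp a (by simp)
      rw [List.filter_cons, List.count_cons, List.sum_cons]
      rcases ha.eq_or_lt with rfl | ha
      · simp; omega
      · have : ¬ a = 1 := by omega
        simp [Nat.succ_le_of_lt ha, this]; omega
  rw [if_pos] at h
  · simp only [Multiset.sum_coe, Multiset.prod_coe, Multiset.coe_count, Fintype.card_fin] at h
    rw [show n - (l.filter (2 ≤ ·)).sum = l.count 1 by omega] at h
    simp_rw [cycleShape_eq_iff hs hp hn]
    exact h
  · refine ⟨by simp only [Multiset.sum_coe, Fintype.card_fin]; omega, fun a ha => ?_⟩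
    simpa using (List.mem_filter.1 (Multiset.mem_coe.1 ha)).2

/-- Permutations with the same cycle lengths are conjugate. The value of `F` on lists which are not
shapes is immaterial. -/
theorem exists_eq_comp_cycleShape {n : ℕ} {c : Equiv.Perm (Fin n) → ℂ} (hc : IsConjInvariant c) :
    ∃ F : List ℕ → ℂ, ∀ σ, c σ = F (cycleShape σ) := by
  classical
  refine ⟨fun l => if h : ∃ σ : Equiv.Perm (Fin n), cycleShape σ = l then c h.choose else 0,
    fun σ => ?_⟩
  have h : ∃ τ : Equiv.Perm (Fin n), cycleShape τ = cycleShape σ := ⟨σ, rfl⟩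
  simp only [dif_pos h]
  have h1 : h.choose.partition.parts = σ.partition.parts := by
    rw [← Multiset.sort_eq h.choose.partition.parts (· ≥ ·),
      ← Multiset.sort_eq σ.partition.parts (· ≥ ·)]
    exact congrArg _ h.choose_spec
  obtain ⟨ρ, hρ⟩ := isConj_iff.1 (Equiv.Perm.partition_eq_of_isConj.2 (Nat.Partition.ext h1))
  exact (congrArg c hρ).symm.trans (hc _ _)

theorem isConjInvariant_comp_cycleShape {n : ℕ} (F : List ℕ → ℂ) :
    IsConjInvariant fun σ : Equiv.Perm (Fin n) => F (cycleShape σ) := by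
  intro σ ρ
  simp only [cycleShape]
  rw [Equiv.Perm.partition_eq_of_isConj.1 (isConj_iff.2 ⟨ρ, rfl⟩ : IsConj σ (ρ * σ * ρ⁻¹))]

/-- The number of permutations whose cycle lengths form the partition `l` of `l.sum`. -/
def shapeCount (l : List ℕ) : ℕ :=
  l.sum.factorial / (((l.count 1).factorial * (l.filter (2 ≤ ·)).prod) *
    ∏ k ∈ (l.filter (2 ≤ ·)).toFinset, ((l.filter (2 ≤ ·)).count k).factorial)

theorem card_cycleShape_eq_shapeCount {n : ℕ} {l : List ℕ} (hs : l.Pairwise (· ≥ ·))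
    (hp : ∀ k ∈ l, 1 ≤ k) (hn : l.sum = n) :
    (Finset.univ.filter fun σ : Equiv.Perm (Fin n) => cycleShape σ = l).card = shapeCount l := by
  have h := card_cycleShape hs hp hn
  rw [shapeCount, hn, ← h, Nat.mul_div_cancel]
  refine Nat.pos_of_ne_zero fun h0 => n.factorial_ne_zero ?_
  rw [← h, h0, mul_zero]

/-- The hypotheses concern explicit lists of integers only, so they can be checked by evaluation
without enumerating the permutations. -/
theorem sum_comp_cycleShape_eq_list_sum {n : ℕ} {L : List (ℕ × List ℕ)}
    (hL : (sortedParts n n n).map (fun l => (shapeCount l, l)) = L)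
    (hnd : (sortedParts n n n).Nodup)
    (hs : ∀ l ∈ sortedParts n n n, l.Pairwise (· ≥ ·) ∧ (∀ k ∈ l, 1 ≤ k) ∧ l.sum = n)
    (F : List ℕ → ℂ) :
    ∑ σ : Equiv.Perm (Fin n), F (cycleShape σ) = (L.map fun p => (p.1 : ℂ) * F p.2).sum := by
  rw [sum_comp_cycleShape, ← hL, List.map_map, List.sum_toFinset _ hnd]
  refine congrArg _ (List.map_congr_left fun l hl => ?_)
  obtain ⟨h1, h2, h3⟩ := hs l hl
  rw [card_cycleShape_eq_shapeCount h1 h2 h3]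
  rfl

theorem sum_comp_cycleShape_two (F : List ℕ → ℂ) :
    ∑ σ : Equiv.Perm (Fin 2), F (cycleShape σ) = F [2] + F [1, 1] := by
  rw [sum_comp_cycleShape_eq_list_sum (L := [(1, [1, 1]), (1, [2])])
    (by decide +kernel) (by decide +kernel) (by decide +kernel)]
  simp
  ring

theorem sum_comp_cycleShape_three (F : List ℕ → ℂ) :
    ∑ σ : Equiv.Perm (Fin 3), F (cycleShape σ) = 2 * F [3] + 3 * F [2, 1] + F [1, 1, 1] := by
  rw [sum_comp_cycleShape_eq_list_sum (L := [(1, [1, 1, 1]), (3, [2, 1]), (2, [3])])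
    (by decide +kernel) (by decide +kernel) (by decide +kernel)]
  simp
  ring

theorem sum_comp_cycleShape_four (F : List ℕ → ℂ) :
    ∑ σ : Equiv.Perm (Fin 4), F (cycleShape σ) = 6 * F [4] + 8 * F [3, 1] + 3 * F [2, 2] +
      6 * F [2, 1, 1] + F [1, 1, 1, 1] := by
  rw [sum_comp_cycleShape_eq_list_sum
    (L := [(1, [1, 1, 1, 1]), (6, [2, 1, 1]), (3, [2, 2]), (8, [3, 1]), (6, [4])])
    (by decide +kernel) (by decide +kernel) (by decide +kernel)]
  simp
  ring

theorem sum_comp_cycleShape_five (F : List ℕ → ℂ) :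
    ∑ σ : Equiv.Perm (Fin 5), F (cycleShape σ) = 24 * F [5] + 30 * F [4, 1] + 20 * F [3, 2] +
      20 * F [3, 1, 1] + 15 * F [2, 2, 1] + 10 * F [2, 1, 1, 1] + F [1, 1, 1, 1, 1] := by
  rw [sum_comp_cycleShape_eq_list_sum
    (L := [(1, [1, 1, 1, 1, 1]), (10, [2, 1, 1, 1]), (15, [2, 2, 1]), (20, [3, 1, 1]),
      (20, [3, 2]), (30, [4, 1]), (24, [5])])
    (by decide +kernel) (by decide +kernel) (by decide +kernel)]
  simp
  ring

theorem sum_comp_cycleShape_six (F : List ℕ → ℂ) :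
    ∑ σ : Equiv.Perm (Fin 6), F (cycleShape σ) =
      120 * F [6] + 144 * F [5, 1] + 90 * F [4, 2] + 90 * F [4, 1, 1] + 40 * F [3, 3] +
      120 * F [3, 2, 1] + 40 * F [3, 1, 1, 1] + 15 * F [2, 2, 2] + 45 * F [2, 2, 1, 1] +
      15 * F [2, 1, 1, 1, 1] + F [1, 1, 1, 1, 1, 1] := by
  rw [sum_comp_cycleShape_eq_list_sum
    (L := [(1, [1, 1, 1, 1, 1, 1]), (15, [2, 1, 1, 1, 1]), (45, [2, 2, 1, 1]), (15, [2, 2, 2]),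
      (40, [3, 1, 1, 1]), (120, [3, 2, 1]), (40, [3, 3]), (90, [4, 1, 1]), (90, [4, 2]),
      (144, [5, 1]), (120, [6])])
    (by decide +kernel) (by decide +kernel) (by decide +kernel)]
  simp
  ring

/-- The cumulant `∑ σ, c(σ) φ_σ` attached to a class function, as a symmetric multilinear form. -/
noncomputable def NCProbSpace.cumulantForm (M : NCProbSpace.{u}) {n : ℕ}
    (c : Equiv.Perm (Fin n) → ℂ) : MultilinearMap ℂ (fun _ : Fin n => (M : Type u)) ℂ :=
  ∑ σ, c σ • M.permFormMultilinear σ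

theorem NCProbSpace.cumulantForm_apply (M : NCProbSpace.{u}) {n : ℕ}
    (c : Equiv.Perm (Fin n) → ℂ) (m : Fin n → M) :
    M.cumulantForm c m = ∑ σ, c σ * M.permForm σ m := by
  simp only [cumulantForm, sum_apply, smul_apply, smul_eq_mul]
  rfl

theorem NCProbSpace.cumulantForm_comp_perm (M : NCProbSpace.{u}) {n : ℕ}
    {c : Equiv.Perm (Fin n) → ℂ} (hc : IsConjInvariant c) (ρ : Equiv.Perm (Fin n)) (m : Fin n → M) :
    M.cumulantForm c (m ∘ ρ) = M.cumulantForm c m := by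
  rw [M.cumulantForm_apply, M.cumulantForm_apply,
    ← Equiv.sum_comp (MulAut.conj ρ).toEquiv fun σ => c σ * M.permForm σ m]
  refine Finset.sum_congr rfl fun σ _ => ?_
  change _ = c (ρ * σ * ρ⁻¹) * M.permForm (ρ * σ * ρ⁻¹) m
  rw [hc, M.permForm_conj]

theorem NCProbSpace.cumulantForm_const (M : NCProbSpace.{u}) {n : ℕ} (F : List ℕ → ℂ) (y : M) :
    M.cumulantForm (fun σ : Equiv.Perm (Fin n) => F (cycleShape σ)) (fun _ => y) =
      ∑ σ : Equiv.Perm (Fin n), (fun l => F l * (l.map fun k => M.φ (y ^ k)).prod)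
        (cycleShape σ) := by
  rw [M.cumulantForm_apply]
  refine Finset.sum_congr rfl fun σ _ => ?_
  rw [M.permForm_const, ← Multiset.sort_eq σ.partition.parts (· ≥ ·), Multiset.map_coe,
    Multiset.prod_coe]
  rfl

end CycleShape

/-! ### Alternating products in a free pair of subalgebras -/

namespace NCProbSpace

section Freeness

variable {X : NCProbSpace.{u}}

theorem φ_one_smul (c : ℂ) : X.φ (c • (1 : X)) = c := by
  rw [map_smul, X.φ_one, smul_eq_mul, mul_one]

theorem φ_sub_smul_one (d : X) : X.φ (d - X.φ d • (1 : X)) = 0 := by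
  rw [map_sub, φ_one_smul, sub_self]

theorem sub_smul_one_mem {A : StarSubalgebra ℂ X} {a : X} (ha : a ∈ A) (c : ℂ) :
    a - c • (1 : X) ∈ A :=
  sub_mem ha (A.smul_mem (one_mem A) c)

theorem Free.φ_prod_list {ι : Type*} {A : ι → StarSubalgebra ℂ X} (hF : X.Free A)
    {l : List (ι × X)} (hl : l ≠ []) (hc : l.IsChain fun p q => p.1 ≠ q.1)
    (h : ∀ p ∈ l, p.2 ∈ A p.1 ∧ X.φ p.2 = 0) : X.φ (l.map Prod.snd).prod = 0 := by
  have h1 : l.map Prod.snd = List.ofFn fun k : Fin l.length => (l.get k).2 := by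
    conv_lhs => rw [← List.ofFn_get l, List.map_ofFn]
    rfl
  rw [h1]
  refine hF l.length (List.length_pos_iff.2 hl) (fun k => (l.get k).1) (fun k k' hk => ?_) _
    (fun k => (h _ (l.get_mem k)).1) (fun k => (h _ (l.get_mem k)).2)
  rw [List.isChain_iff_getElem] at hc
  have := hc k (by have := k'.2; omega)
  convert! this using 3
  simp only [List.get_eq_getElem, hk]

variable {D U : StarSubalgebra ℂ X}

theorem Free.φ_prod_pairs (hF : X.Free ![D, U]) {l : List (X × X)} (hl : l ≠ [])
    (h : ∀ p ∈ l, (p.1 ∈ D ∧ X.φ p.1 = 0) ∧ p.2 ∈ U ∧ X.φ p.2 = 0) :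
    X.φ (l.map fun p => p.1 * p.2).prod = 0 := by
  have e : ∀ l : List (X × X), (l.map fun p => p.1 * p.2).prod =
      ((l.flatMap fun p => [((0 : Fin 2), p.1), ((1 : Fin 2), p.2)]).map Prod.snd).prod := by
    intro l
    induction l with
    | nil => rfl
    | cons p l ih => simp [ih, mul_assoc]
  have hch : ∀ l : List (X × X),
      (l.flatMap fun p => [((0 : Fin 2), p.1), ((1 : Fin 2), p.2)]).IsChain
        (fun p q => p.1 ≠ q.1) := by
    intro l
    induction l with
    | nil => simp
    | cons p l ih =>
      cases l with
      | nil => simp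
      | cons q l => simpa using ih
  rw [e]
  refine hF.φ_prod_list ?_ (hch l) ?_
  · cases l with
    | nil => exact absurd rfl hl
    | cons p l => simp
  · intro q hq
    obtain ⟨p, hp, hq⟩ := List.mem_flatMap.1 hq
    obtain ⟨⟨h1, h2⟩, h3, h4⟩ := h p hp
    simp only [List.mem_cons, List.not_mem_nil, or_false] at hq
    rcases hq with rfl | rfl
    · exact ⟨h1, h2⟩
    · exact ⟨h3, h4⟩

/-- An alternating product in which all factors but possibly the first one are centered. -/
theorem Free.φ_mul_mul_prod_pairs (hF : X.Free ![D, U]) (l : List (X × X)) {d w : X} (hd : d ∈ D)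
    (hw : w ∈ U) (hw0 : X.φ w = 0)
    (h : ∀ p ∈ l, (p.1 ∈ D ∧ X.φ p.1 = 0) ∧ p.2 ∈ U ∧ X.φ p.2 = 0) :
    X.φ (d * w * (l.map fun p => p.1 * p.2).prod) = 0 := by
  induction hn : l.length using Nat.strong_induction_on generalizing l d w with
  | _ n ih =>
  have h1 : X.φ ((d - X.φ d • (1 : X)) * w * (l.map fun p => p.1 * p.2).prod) = 0 := by
    have := hF.φ_prod_pairs (l := (d - X.φ d • (1 : X), w) :: l) (by simp) (by
      intro p hp
      rcases List.mem_cons.1 hp with rfl | hp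
      · exact ⟨⟨sub_smul_one_mem hd _, φ_sub_smul_one d⟩, hw, hw0⟩
      · exact h p hp)
    simpa using this
  -- With `d` centered the product vanishes by freeness, so only the scalar part of `d` can
  -- contribute.
  suffices h2 : X.φ (w * (l.map fun p => p.1 * p.2).prod) = 0 by
    rw [sub_mul, sub_mul, map_sub, smul_mul_assoc, smul_mul_assoc, one_mul, map_smul, h2,
      smul_zero, sub_zero] at h1
    exact h1
  rcases List.eq_nil_or_concat l with rfl | ⟨l', p, rfl⟩
  · simpa using hw0
  obtain ⟨⟨hp1, hp2⟩, hp3, hp4⟩ := h p (by simp)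
  have h' : ∀ p ∈ l', (p.1 ∈ D ∧ X.φ p.1 = 0) ∧ p.2 ∈ U ∧ X.φ p.2 = 0 :=
    fun q hq => h q (by simp [hq])
  -- By traciality `w` meets the last factor `p.2`. The centered part of `p.2 * w` again gives an
  -- alternating centered product.
  rw [X.φ_mul_comm]
  simp only [List.concat_eq_append, List.map_append, List.map_cons, List.map_nil,
    List.prod_append, List.prod_cons, List.prod_nil, mul_one]
  have h3 : X.φ ((l'.map fun p => p.1 * p.2).prod *
      (p.1 * (p.2 * w - X.φ (p.2 * w) • (1 : X)))) = 0 := by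
    have := hF.φ_prod_pairs (l := l' ++ [(p.1, p.2 * w - X.φ (p.2 * w) • (1 : X))]) (by simp) (by
      intro q hq
      rcases List.mem_append.1 hq with hq | hq
      · exact h' q hq
      · obtain rfl := List.mem_singleton.1 hq
        exact ⟨⟨hp1, hp2⟩, sub_smul_one_mem (mul_mem hp3 hw) _, φ_sub_smul_one _⟩)
    simpa using this
  -- The scalar part of `p.2 * w` leaves `p.1` free to join, by traciality, the first factor of
  -- `l'`. The outcome has the original form, with a shorter list and a possibly non-centered first
  -- factor.
  have h4 : X.φ ((l'.map fun p => p.1 * p.2).prod * p.1) = 0 := by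
    cases l' with
    | nil => simpa using hp2
    | cons q l' =>
      obtain ⟨⟨hq1, -⟩, hq3, hq4⟩ := h' q (by simp)
      rw [X.φ_mul_comm, List.map_cons, List.prod_cons, ← mul_assoc, ← mul_assoc]
      exact ih l'.length (by rw [← hn]; simp) l' (mul_mem hp1 hq1) hq3 hq4
        (fun r hr => h' r (by simp [hr])) rfl
  rw [mul_sub, mul_sub, map_sub, mul_smul_comm, mul_one, mul_smul_comm, map_smul, h4, smul_zero,
    sub_zero] at h3
  simpa [mul_assoc] using h3

/-- At most one element of the list is not centered. -/
def AtMostOneNoncentered (X : NCProbSpace.{u}) : List X → Prop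
  | [] => True
  | d :: l => (X.φ d = 0 ∧ AtMostOneNoncentered X l) ∨ ∀ e ∈ l, X.φ e = 0

theorem AtMostOneNoncentered.exists_eq_append {l : List X} (h : AtMostOneNoncentered X l)
    (hl : l ≠ []) :
    ∃ l₁ d l₂, l = l₁ ++ d :: l₂ ∧ (∀ e ∈ l₁, X.φ e = 0) ∧ ∀ e ∈ l₂, X.φ e = 0 := by
  induction l with
  | nil => exact absurd rfl hl
  | cons d l ih =>
    rcases h with ⟨hd, h⟩ | h
    · cases l with
      | nil => exact ⟨[], d, [], rfl, by simp, by simp⟩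
      | cons d' l =>
        obtain ⟨l₁, e, l₂, he, h1, h2⟩ := ih h (by simp)
        refine ⟨d :: l₁, e, l₂, by rw [he]; rfl, ?_, h2⟩
        intro f hf
        rcases List.mem_cons.1 hf with rfl | hf
        · exact hd
        · exact h1 f hf
    · exact ⟨[], d, l, rfl, by simp, h⟩

/-- Traciality rotates the only possibly non-centered element of `D` to the front. -/
theorem Free.φ_prod_pairs_of_atMostOne (hF : X.Free ![D, U]) {l : List (X × X)} (hl : l ≠ [])
    (h : ∀ p ∈ l, p.1 ∈ D ∧ p.2 ∈ U ∧ X.φ p.2 = 0)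
    (h1 : AtMostOneNoncentered X (l.map Prod.fst)) :
    X.φ (l.map fun p => p.1 * p.2).prod = 0 := by
  obtain ⟨m₁, d, m₂, he, hm1, hm2⟩ := h1.exists_eq_append (by simpa using hl)
  obtain ⟨l₁, l', rfl, rfl, he'⟩ := List.map_eq_append_iff.1 he
  obtain ⟨p, l₂, rfl, rfl, rfl⟩ := List.map_eq_cons_iff.1 he'
  rw [List.map_append, List.prod_append, X.φ_mul_comm, List.map_cons, List.prod_cons, mul_assoc,
    ← List.prod_append, ← List.map_append]
  obtain ⟨hp1, hp2, hp3⟩ := h p (by simp)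
  refine hF.φ_mul_mul_prod_pairs _ hp1 hp2 hp3 fun q hq => ?_
  rcases List.mem_append.1 hq with hq | hq
  · obtain ⟨a, b⟩ := h q (by simp [hq])
    exact ⟨⟨a, hm2 _ (List.mem_map_of_mem hq)⟩, b⟩
  · obtain ⟨a, b⟩ := h q (by simp [hq])
    exact ⟨⟨a, hm1 _ (List.mem_map_of_mem hq)⟩, b⟩

/-- Each way of grouping the consecutive letters of the word `cur, rest`, put after the word
`done`, has at most one group with a non-centered product. -/
def AllGroupings (X : NCProbSpace.{u}) : List X → X → List X → Prop
  | done, cur, [] => AtMostOneNoncentered X (done ++ [cur])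
  | done, cur, d :: rest =>
    AllGroupings X (done ++ [cur]) d rest ∧ AllGroupings X done (cur * d) rest

/-- Each element of `U` between two letters is split into its centered part, which closes the
current group, and its scalar part, which merges the two letters. These are the two branches of
`AllGroupings`; at the end of each branch all the elements of `U` are centered. -/
theorem Free.φ_eq_zero_of_allGroupings (hF : X.Free ![D, U]) (rest done : List (X × X))
    {cur w : X} (hcur : cur ∈ D) (hw : w ∈ U) (hw0 : X.φ w = 0)
    (hd : ∀ p ∈ done, p.1 ∈ D ∧ p.2 ∈ U ∧ X.φ p.2 = 0) (hr : ∀ p ∈ rest, p.1 ∈ U ∧ p.2 ∈ D)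
    (h : AllGroupings X (done.map Prod.fst) cur (rest.map Prod.snd)) :
    X.φ ((done.map fun p => p.1 * p.2).prod * (cur * ((rest.map fun p => p.1 * p.2).prod * w))) =
      0 := by
  induction rest generalizing done cur with
  | nil =>
    have := hF.φ_prod_pairs_of_atMostOne (l := done ++ [(cur, w)]) (by simp) (by
      intro p hp
      rcases List.mem_append.1 hp with hp | hp
      · exact hd p hp
      · obtain rfl := List.mem_singleton.1 hp
        exact ⟨hcur, hw, hw0⟩) (by simpa [AllGroupings] using h)
    simpa using this
  | cons p rest ih =>
    obtain ⟨hp1, hp2⟩ := hr p (by simp)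
    have hr' : ∀ p ∈ rest, p.1 ∈ U ∧ p.2 ∈ D := fun q hq => hr q (by simp [hq])
    obtain ⟨h1, h2⟩ := h
    have e1 := ih (done ++ [(cur, p.1 - X.φ p.1 • (1 : X))]) (cur := p.2) hp2 (by
      intro q hq
      rcases List.mem_append.1 hq with hq | hq
      · exact hd q hq
      · obtain rfl := List.mem_singleton.1 hq
        exact ⟨hcur, sub_smul_one_mem hp1 _, φ_sub_smul_one _⟩) hr' (by simpa using h1)
    have e2 := ih done (cur := cur * p.2) (mul_mem hcur hp2) hd hr' h2
    simp only [List.map_append, List.map_cons, List.map_nil, List.prod_append, List.prod_cons,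
      List.prod_nil, mul_one, mul_sub, sub_mul, map_sub, mul_smul_comm, smul_mul_assoc, map_smul,
      mul_assoc] at e1 e2 ⊢
    rw [e2, smul_zero, sub_zero] at e1
    exact e1

/-- The previous vanishing, applied to `w - φ w`, replaces the last element of `U` by its
expectation. -/
theorem Free.φ_mul_of_allGroupings (hF : X.Free ![D, U]) (rest : List (X × X))
    {cur w : X} (hcur : cur ∈ D) (hw : w ∈ U) (hr : ∀ p ∈ rest, p.1 ∈ U ∧ p.2 ∈ D)
    (h : AllGroupings X [] cur (rest.map Prod.snd)) :
    X.φ (cur * ((rest.map fun p => p.1 * p.2).prod * w)) =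
      X.φ w * X.φ (cur * (rest.map fun p => p.1 * p.2).prod) := by
  have := hF.φ_eq_zero_of_allGroupings rest [] hcur (sub_smul_one_mem hw (X.φ w))
    (φ_sub_smul_one w) (by simp) hr h
  simp only [List.map_nil, List.prod_nil, one_mul, mul_sub, mul_smul_comm, mul_one, map_sub,
    map_smul, smul_eq_mul] at this
  exact sub_eq_zero.1 this

theorem Free.φ_mul_mul_of_allGroupings (hF : X.Free ![D, U]) (rest : List (X × X))
    {cur d w : X} (hcur : cur ∈ D) (hd : d ∈ D) (hw : w ∈ U) (hr : ∀ p ∈ rest, p.1 ∈ U ∧ p.2 ∈ D)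
    (h : AllGroupings X [] (d * cur) (rest.map Prod.snd)) :
    X.φ (cur * ((rest.map fun p => p.1 * p.2).prod * (w * d))) =
      X.φ w * X.φ (d * cur * (rest.map fun p => p.1 * p.2).prod) := by
  rw [← hF.φ_mul_of_allGroupings rest (mul_mem hd hcur) hw hr h, ← mul_assoc, ← mul_assoc,
    X.φ_mul_comm, mul_assoc d cur, mul_assoc cur]

/-- The elements of `U` are replaced by their expectations from the last to the first, the letters
thus released joining `cur` by traciality. Single letters are centered, and each of the two cyclic
groupings into pairs has a centered pair, so no grouping has two non-centered groups. -/
theorem Free.φ_mul_four (hF : X.Free ![D, U]) {d₁ d₂ d₃ d₄ : X} {w₁ w₂ w₃ w₄ : X}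
    (hd₁ : d₁ ∈ D) (hd₂ : d₂ ∈ D) (hd₃ : d₃ ∈ D) (hd₄ : d₄ ∈ D)
    (hw₁ : w₁ ∈ U) (hw₂ : w₂ ∈ U) (hw₃ : w₃ ∈ U) (hw₄ : w₄ ∈ U)
    (h₁ : X.φ d₁ = 0) (h₂ : X.φ d₂ = 0) (h₃ : X.φ d₃ = 0) (h₄ : X.φ d₄ = 0)
    (h₁₂ : X.φ (d₁ * d₂) = 0) (h₄₁ : X.φ (d₄ * d₁) = 0) :
    X.φ (d₁ * (w₁ * (d₂ * (w₂ * (d₃ * (w₃ * (d₄ * w₄))))))) =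
      X.φ w₁ * X.φ w₂ * X.φ w₃ * X.φ w₄ * X.φ (d₂ * (d₃ * (d₄ * d₁))) := by
  have e₄ := hF.φ_mul_of_allGroupings [(w₁, d₂), (w₂, d₃), (w₃, d₄)] hd₁ hw₄ (by simp [*])
    (by simp [AllGroupings, AtMostOneNoncentered, *])
  have e₃ := hF.φ_mul_mul_of_allGroupings [(w₁, d₂), (w₂, d₃)] hd₁ hd₄ hw₃ (by simp [*])
    (by simp [AllGroupings, AtMostOneNoncentered, *])
  have e₂ := hF.φ_mul_mul_of_allGroupings [(w₁, d₂)] (mul_mem hd₄ hd₁) hd₃ hw₂ (by simp [*])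
    (by simp [AllGroupings, AtMostOneNoncentered, *])
  have e₁ := hF.φ_mul_mul_of_allGroupings [] (mul_mem hd₃ (mul_mem hd₄ hd₁)) hd₂ hw₁ (by simp [*])
    (by simp [AllGroupings, AtMostOneNoncentered, *])
  simp only [List.map_cons, List.map_nil, List.prod_cons, List.prod_nil, mul_one, one_mul,
    mul_assoc] at e₁ e₂ e₃ e₄
  rw [e₄, e₃, e₂, e₁]
  ring

/-- The same elimination applies: any product of at most three cyclically consecutive letters is
centered, so a non-centered group has at least four of the six letters and there is at most one. -/
theorem Free.φ_mul_six (hF : X.Free ![D, U]) {d₁ d₂ d₃ d₄ d₅ d₆ : X} {w₁ w₂ w₃ w₄ w₅ w₆ : X}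
    (hd₁ : d₁ ∈ D) (hd₂ : d₂ ∈ D) (hd₃ : d₃ ∈ D) (hd₄ : d₄ ∈ D) (hd₅ : d₅ ∈ D) (hd₆ : d₆ ∈ D)
    (hw₁ : w₁ ∈ U) (hw₂ : w₂ ∈ U) (hw₃ : w₃ ∈ U) (hw₄ : w₄ ∈ U) (hw₅ : w₅ ∈ U) (hw₆ : w₆ ∈ U)
    (h₁ : X.φ d₁ = 0) (h₂ : X.φ d₂ = 0) (h₃ : X.φ d₃ = 0) (h₄ : X.φ d₄ = 0) (h₅ : X.φ d₅ = 0)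
    (h₆ : X.φ d₆ = 0) (h₁₂ : X.φ (d₁ * d₂) = 0) (h₂₃ : X.φ (d₂ * d₃) = 0)
    (h₃₄ : X.φ (d₃ * d₄) = 0) (h₄₅ : X.φ (d₄ * d₅) = 0) (h₅₆ : X.φ (d₅ * d₆) = 0)
    (h₆₁ : X.φ (d₆ * d₁) = 0) (h₁₃ : X.φ (d₁ * (d₂ * d₃)) = 0) (h₂₄ : X.φ (d₂ * (d₃ * d₄)) = 0)
    (h₃₅ : X.φ (d₃ * (d₄ * d₅)) = 0) (h₄₆ : X.φ (d₄ * (d₅ * d₆)) = 0)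
    (h₅₁ : X.φ (d₅ * (d₆ * d₁)) = 0) (h₆₂ : X.φ (d₆ * (d₁ * d₂)) = 0) :
    X.φ (d₁ * (w₁ * (d₂ * (w₂ * (d₃ * (w₃ * (d₄ * (w₄ * (d₅ * (w₅ * (d₆ * w₆))))))))))) =
      X.φ w₁ * X.φ w₂ * X.φ w₃ * X.φ w₄ * X.φ w₅ * X.φ w₆ *
        X.φ (d₂ * (d₃ * (d₄ * (d₅ * (d₆ * d₁))))) := by
  have e₆ := hF.φ_mul_of_allGroupings [(w₁, d₂), (w₂, d₃), (w₃, d₄), (w₄, d₅), (w₅, d₆)] hd₁ hw₆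
    (by simp [*]) (by simp [AllGroupings, AtMostOneNoncentered, mul_assoc, *])
  have e₅ := hF.φ_mul_mul_of_allGroupings [(w₁, d₂), (w₂, d₃), (w₃, d₄), (w₄, d₅)] hd₁ hd₆ hw₅
    (by simp [*]) (by simp [AllGroupings, AtMostOneNoncentered, mul_assoc, *])
  have e₄ := hF.φ_mul_mul_of_allGroupings [(w₁, d₂), (w₂, d₃), (w₃, d₄)] (mul_mem hd₆ hd₁) hd₅ hw₄
    (by simp [*]) (by simp [AllGroupings, AtMostOneNoncentered, mul_assoc, *])
  have e₃ := hF.φ_mul_mul_of_allGroupings [(w₁, d₂), (w₂, d₃)] (mul_mem hd₅ (mul_mem hd₆ hd₁)) hd₄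
    hw₃ (by simp [*]) (by simp [AllGroupings, AtMostOneNoncentered, mul_assoc, *])
  have e₂ := hF.φ_mul_mul_of_allGroupings [(w₁, d₂)] (mul_mem hd₄ (mul_mem hd₅ (mul_mem hd₆ hd₁)))
    hd₃ hw₂ (by simp [*]) (by simp [AllGroupings, AtMostOneNoncentered, mul_assoc, *])
  have e₁ := hF.φ_mul_mul_of_allGroupings []
    (mul_mem hd₃ (mul_mem hd₄ (mul_mem hd₅ (mul_mem hd₆ hd₁)))) hd₂ hw₁ (by simp [*])
    (by simp [AllGroupings, AtMostOneNoncentered, *])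
  simp only [List.map_cons, List.map_nil, List.prod_cons, List.prod_nil, mul_one, one_mul,
    mul_assoc] at e₁ e₂ e₃ e₄ e₅ e₆
  rw [e₆, e₅, e₄, e₃, e₂, e₁]
  ring

end Freeness

/-! ### Expectations of short words in $t$-free subalgebras -/

section TFree

variable {M : NCProbSpace.{u}} {t : ℝ≥0∞} {A B : StarSubalgebra ℂ M}

theorem fubmMoment_one_mul_self (t : ℝ≥0∞) : fubmMoment t 1 * fubmMoment t 1 = expNeg t := by
  unfold fubmMoment expNeg
  by_cases h : t = ⊤
  · simp [h]
  · rw [if_neg one_ne_zero, if_neg h, if_neg h, Finset.sum_range_one, mul_mul_mul_comm,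
      ← Real.exp_add]
    norm_num
    ring

namespace IsTFreeRealization

variable {X : NCProbSpace.{u}} {i : A →⋆ₐ[ℂ] X} {j : B →⋆ₐ[ℂ] X} {v : X}

theorem φ_mul (h : M.IsTFreeRealization t A B X i j v) (a : A) (b : B) :
    X.φ (i a * j b) = M.φ (a : M) * M.φ (b : M) := by
  have h1 := h.indep.2 2 (by norm_num) ![0, 1] (by decide)
    ![i (a - M.φ (a : M) • (1 : A)), j (b - M.φ (b : M) • (1 : B))]
    (by
      intro k
      fin_cases k
      · exact ⟨_, rfl⟩
      · exact ⟨_, rfl⟩)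
    (by
      intro k
      fin_cases k
      · simp [h.φ_left, X.φ_one]
      · simp [h.φ_right, X.φ_one])
  simp only [List.ofFn_succ, List.ofFn_zero, Matrix.cons_val_zero, List.prod_cons, List.prod_nil,
    Matrix.cons_val_succ, mul_one, map_sub, map_smul, map_one, sub_mul, mul_sub, smul_mul_assoc,
    mul_smul_comm, one_mul, h.φ_left, h.φ_right, X.φ_one, smul_eq_mul] at h1
  linear_combination h1

theorem commute (h : M.IsTFreeRealization t A B X i j v) (a : A) (b : B) :
    j b * i a = i a * j b :=
  (h.indep.1 0 1 (by decide) _ ⟨a, rfl⟩ _ ⟨b, rfl⟩).symm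

theorem commute_assoc (h : M.IsTFreeRealization t A B X i j v) (a : A) (b : B) (x : X) :
    j b * (i a * x) = i a * (j b * x) := by
  rw [← mul_assoc, h.commute, mul_assoc]

theorem φ_unitary (h : M.IsTFreeRealization t A B X i j v) : X.φ v = (fubmMoment t 1 : ℂ) := by
  have := h.bm.2 1
  rwa [pow_one] at this

theorem φ_star_unitary (h : M.IsTFreeRealization t A B X i j v) :
    X.φ (star v) = (fubmMoment t 1 : ℂ) := by
  rw [X.φ_star, h.φ_unitary]
  exact Complex.conj_ofReal _

theorem mem_left (_ : M.IsTFreeRealization t A B X i j v) (a : A) : i a ∈ i.range ⊔ j.range :=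
  (le_sup_left : i.range ≤ i.range ⊔ j.range) ⟨a, rfl⟩

theorem mem_right (_ : M.IsTFreeRealization t A B X i j v) (b : B) : j b ∈ i.range ⊔ j.range :=
  (le_sup_right : j.range ≤ i.range ⊔ j.range) ⟨b, rfl⟩

theorem φ_word_two (h : M.IsTFreeRealization t A B X i j v) (a : A) (b : B)
    (hb : M.φ (b : M) = 0) : X.φ (i a * (v * (j b * star v))) = 0 := by
  have hv : v ∈ StarAlgebra.adjoin ℂ {v} := StarAlgebra.self_mem_adjoin_singleton ℂ v
  have e := h.free.φ_mul_of_allGroupings [(v, j b)] (h.mem_left a) (star_mem hv)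
    (fun p hp => by rw [List.mem_singleton.1 hp]; exact ⟨hv, h.mem_right b⟩)
    (by simp [AllGroupings, AtMostOneNoncentered, h.φ_right, hb])
  have e' := h.free.φ_mul_mul_of_allGroupings [] (h.mem_left a) (h.mem_right b) hv (by simp)
    (by simp [AllGroupings, AtMostOneNoncentered])
  simp only [List.map_cons, List.map_nil, List.prod_cons, List.prod_nil, mul_one, one_mul,
    mul_assoc] at e e'
  rw [e, e', h.commute, h.φ_mul, hb]
  ring

/-- The four factors $\varphi(u_t^{\pm1})=e^{-t/2}$ contribute $x^2$; the remaining product of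
letters factorizes by independence. A product of neighbouring letters `i a * j b` is centered as
soon as one of them is. -/
theorem φ_word_four (h : M.IsTFreeRealization t A B X i j v) (a₁ a₂ : A) (b₁ b₂ : B)
    (ha₁ : M.φ (a₁ : M) = 0) (ha₂ : M.φ (a₂ : M) = 0) (hb₁ : M.φ (b₁ : M) = 0)
    (hb₂ : M.φ (b₂ : M) = 0) :
    X.φ (i a₁ * (v * (j b₁ * (star v * (i a₂ * (v * (j b₂ * star v))))))) =
      (expNeg t : ℂ) ^ 2 * (M.φ (a₁ * a₂ : M) * M.φ (b₁ * b₂ : M)) := by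
  have hv : v ∈ StarAlgebra.adjoin ℂ {v} := StarAlgebra.self_mem_adjoin_singleton ℂ v
  rw [h.free.φ_mul_four (h.mem_left a₁) (h.mem_right b₁) (h.mem_left a₂) (h.mem_right b₂)
    hv (star_mem hv) hv (star_mem hv) (by rw [h.φ_left, ha₁]) (by rw [h.φ_right, hb₁])
    (by rw [h.φ_left, ha₂]) (by rw [h.φ_right, hb₂]) (by rw [h.φ_mul, ha₁, zero_mul])
    (by rw [h.commute, h.φ_mul, ha₁, zero_mul]), h.φ_unitary, h.φ_star_unitary,
    ← fubmMoment_one_mul_self, h.commute, h.commute_assoc, h.commute_assoc, ← mul_assoc,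
    ← map_mul, ← map_mul, h.φ_mul]
  push_cast
  rw [M.φ_mul_comm (a₂ : M)]
  ring

theorem φ_word_six (h : M.IsTFreeRealization t A B X i j v) (a₁ a₂ a₃ : A) (b₁ b₂ b₃ : B)
    (ha₁ : M.φ (a₁ : M) = 0) (ha₂ : M.φ (a₂ : M) = 0) (ha₃ : M.φ (a₃ : M) = 0)
    (hb₁ : M.φ (b₁ : M) = 0) (hb₂ : M.φ (b₂ : M) = 0) (hb₃ : M.φ (b₃ : M) = 0) :
    X.φ (i a₁ * (v * (j b₁ * (star v * (i a₂ * (v * (j b₂ * (star v * (i a₃ * (v *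
      (j b₃ * star v))))))))))) =
      (expNeg t : ℂ) ^ 3 * (M.φ (a₁ * (a₂ * a₃) : M) * M.φ (b₁ * (b₂ * b₃) : M)) := by
  have hv : v ∈ StarAlgebra.adjoin ℂ {v} := StarAlgebra.self_mem_adjoin_singleton ℂ v
  have hab : ∀ (a : A) (b : B), M.φ (a : M) = 0 → X.φ (i a * j b) = 0 := fun a b ha => by
    rw [h.φ_mul, ha, zero_mul]
  have hba : ∀ (a : A) (b : B), M.φ (a : M) = 0 → X.φ (j b * i a) = 0 := fun a b ha => by
    rw [h.commute, hab a b ha]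
  have haba : ∀ (a a' : A) (b : B), M.φ (b : M) = 0 → X.φ (i a * (j b * i a')) = 0 :=
    fun a a' b hb => by rw [h.commute, ← mul_assoc, ← map_mul, h.φ_mul, hb, mul_zero]
  have hbab : ∀ (a : A) (b b' : B), M.φ (a : M) = 0 → X.φ (j b * (i a * j b')) = 0 :=
    fun a b b' ha => by rw [h.commute_assoc, ← map_mul, h.φ_mul, ha, zero_mul]
  rw [h.free.φ_mul_six (h.mem_left a₁) (h.mem_right b₁) (h.mem_left a₂) (h.mem_right b₂)
    (h.mem_left a₃) (h.mem_right b₃)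
    hv (star_mem hv) hv (star_mem hv) hv (star_mem hv) (by rw [h.φ_left, ha₁])
    (by rw [h.φ_right, hb₁]) (by rw [h.φ_left, ha₂]) (by rw [h.φ_right, hb₂])
    (by rw [h.φ_left, ha₃]) (by rw [h.φ_right, hb₃]) (hab _ _ ha₁) (hba _ _ ha₂) (hab _ _ ha₂)
    (hba _ _ ha₃) (hab _ _ ha₃) (hba _ _ ha₁) (haba _ _ _ hb₁) (hbab _ _ _ ha₂) (haba _ _ _ hb₂)
    (hbab _ _ _ ha₃) (haba _ _ _ hb₃) (hbab _ _ _ ha₁), h.φ_unitary, h.φ_star_unitary,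
    ← fubmMoment_one_mul_self]
  have e : j b₁ * (i a₂ * (j b₂ * (i a₃ * (j b₃ * i a₁)))) =
      i (a₂ * (a₃ * a₁)) * j (b₁ * (b₂ * b₃)) := by
    simp only [h.commute, h.commute_assoc, map_mul, mul_assoc]
  rw [e, h.φ_mul]
  push_cast
  rw [← mul_assoc (a₂ : M), M.φ_mul_comm (a₂ * a₃ : M)]
  ring

end IsTFreeRealization

namespace TFree

theorem φ_mul (h : M.TFree t A B) {a b : M} (ha : a ∈ A) (hb : b ∈ B) : M.φ (a * b) = M.φ a * M.φ b := by
  have key : ∀ b ∈ B, M.φ b = 0 → M.φ (a * b) = 0 := by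
    intro b hb hb0
    obtain ⟨X, i, j, v, hX, hw⟩ := h
    have h1 := hw 1 (fun _ => ⟨a, ha⟩) (fun _ => ⟨b, hb⟩)
    simp only [List.ofFn_succ, List.ofFn_zero, List.prod_cons, List.prod_nil, mul_one,
      mul_assoc] at h1
    rw [h1, hX.φ_word_two _ _ hb0]
  have h2 := key _ (sub_smul_one_mem hb (M.φ b)) (φ_sub_smul_one b)
  rw [mul_sub, map_sub, mul_smul_comm, mul_one, map_smul, smul_eq_mul] at h2
  linear_combination h2

theorem φ_mul_four_centered (h : M.TFree t A B) {a₁ a₂ b₁ b₂ : M} (ha₁ : a₁ ∈ A) (ha₂ : a₂ ∈ A) (hb₁ : b₁ ∈ B)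
    (hb₂ : b₂ ∈ B) (ha₁0 : M.φ a₁ = 0) (ha₂0 : M.φ a₂ = 0) (hb₁0 : M.φ b₁ = 0)
    (hb₂0 : M.φ b₂ = 0) :
    M.φ (a₁ * (b₁ * (a₂ * b₂))) = (expNeg t : ℂ) ^ 2 * (M.φ (a₁ * a₂) * M.φ (b₁ * b₂)) := by
  obtain ⟨X, i, j, v, hX, hw⟩ := h
  have h1 := hw 2 ![⟨a₁, ha₁⟩, ⟨a₂, ha₂⟩] ![⟨b₁, hb₁⟩, ⟨b₂, hb₂⟩]
  simp only [List.ofFn_succ, List.ofFn_zero, List.prod_cons, List.prod_nil, mul_one,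
    mul_assoc, Matrix.cons_val_zero, Matrix.cons_val_succ] at h1
  rw [h1]
  exact hX.φ_word_four ⟨a₁, ha₁⟩ ⟨a₂, ha₂⟩ ⟨b₁, hb₁⟩ ⟨b₂, hb₂⟩ ha₁0 ha₂0 hb₁0 hb₂0

theorem φ_mul_six_centered (h : M.TFree t A B) {a₁ a₂ a₃ b₁ b₂ b₃ : M} (ha₁ : a₁ ∈ A) (ha₂ : a₂ ∈ A) (ha₃ : a₃ ∈ A)
    (hb₁ : b₁ ∈ B) (hb₂ : b₂ ∈ B) (hb₃ : b₃ ∈ B) (ha₁0 : M.φ a₁ = 0) (ha₂0 : M.φ a₂ = 0)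
    (ha₃0 : M.φ a₃ = 0) (hb₁0 : M.φ b₁ = 0) (hb₂0 : M.φ b₂ = 0) (hb₃0 : M.φ b₃ = 0) :
    M.φ (a₁ * (b₁ * (a₂ * (b₂ * (a₃ * b₃))))) =
      (expNeg t : ℂ) ^ 3 * (M.φ (a₁ * (a₂ * a₃)) * M.φ (b₁ * (b₂ * b₃))) := by
  obtain ⟨X, i, j, v, hX, hw⟩ := h
  have h1 := hw 3 ![⟨a₁, ha₁⟩, ⟨a₂, ha₂⟩, ⟨a₃, ha₃⟩] ![⟨b₁, hb₁⟩, ⟨b₂, hb₂⟩, ⟨b₃, hb₃⟩]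
  simp only [List.ofFn_succ, List.ofFn_zero, List.prod_cons, List.prod_nil, mul_one,
    mul_assoc, Matrix.cons_val_zero, Matrix.cons_val_succ] at h1
  rw [h1]
  exact hX.φ_word_six ⟨a₁, ha₁⟩ ⟨a₂, ha₂⟩ ⟨a₃, ha₃⟩ ⟨b₁, hb₁⟩ ⟨b₂, hb₂⟩ ⟨b₃, hb₃⟩
    ha₁0 ha₂0 ha₃0 hb₁0 hb₂0 hb₃0

/-- This is the centered case applied to $a_i-\varphi(a_i)$ and $b_i-\varphi(b_i)$. In the
expansion, every word in which a letter is replaced by a scalar has at most two blocks up to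
rotation. -/
theorem φ_mul_four (h : M.TFree t A B) {a₁ a₂ b₁ b₂ : M} (ha₁ : a₁ ∈ A) (ha₂ : a₂ ∈ A) (hb₁ : b₁ ∈ B)
    (hb₂ : b₂ ∈ B) :
    M.φ (a₁ * (b₁ * (a₂ * b₂))) =
      (expNeg t : ℂ) ^ 2 * ((M.φ (a₁ * a₂) - M.φ a₁ * M.φ a₂) * (M.φ (b₁ * b₂) - M.φ b₁ * M.φ b₂)) +
      M.φ a₁ * M.φ a₂ * M.φ (b₁ * b₂) + M.φ b₁ * M.φ b₂ * M.φ (a₁ * a₂) -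
      M.φ a₁ * M.φ a₂ * M.φ b₁ * M.φ b₂ := by
  have e := h.φ_mul_four_centered (sub_smul_one_mem ha₁ (M.φ a₁)) (sub_smul_one_mem ha₂ (M.φ a₂))
    (sub_smul_one_mem hb₁ (M.φ b₁)) (sub_smul_one_mem hb₂ (M.φ b₂)) (φ_sub_smul_one _)
    (φ_sub_smul_one _) (φ_sub_smul_one _) (φ_sub_smul_one _)
  have e1 : M.φ (a₁ * (b₁ * b₂)) = M.φ a₁ * M.φ (b₁ * b₂) := h.φ_mul ha₁ (mul_mem hb₁ hb₂)
  have e2 : M.φ (a₁ * (a₂ * b₂)) = M.φ (a₁ * a₂) * M.φ b₂ := by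
    rw [← mul_assoc, h.φ_mul (mul_mem ha₁ ha₂) hb₂]
  have e3 : M.φ (b₁ * (a₂ * b₂)) = M.φ a₂ * M.φ (b₁ * b₂) := by
    rw [M.φ_mul_comm, mul_assoc, h.φ_mul ha₂ (mul_mem hb₂ hb₁), M.φ_mul_comm b₂]
  have e4 : M.φ (a₁ * (b₁ * a₂)) = M.φ (a₁ * a₂) * M.φ b₁ := by
    rw [← mul_assoc, M.φ_mul_comm, ← mul_assoc, h.φ_mul (mul_mem ha₂ ha₁) hb₁, M.φ_mul_comm a₂]
  have e5 : M.φ (b₁ * a₂) = M.φ a₂ * M.φ b₁ := by rw [M.φ_mul_comm, h.φ_mul ha₂ hb₁]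
  simp only [sub_mul, mul_sub, smul_mul_assoc, mul_smul_comm, one_mul, mul_one, map_sub, map_smul,
    smul_eq_mul, M.φ_one, e1, e2, e3, e4, e5, h.φ_mul ha₁ hb₁, h.φ_mul ha₁ hb₂, h.φ_mul ha₂ hb₂]
    at e
  linear_combination e

end TFree

/-- The product of a word in the letters `a` (for `false`) and `b` (for `true`). -/
def wordProd (a b : M) (l : List Bool) : M := (l.map fun c => cond c b a).prod

theorem φ_wordProd_append_comm (a b : M) (l l' : List Bool) :
    M.φ (wordProd a b (l ++ l')) = M.φ (wordProd a b (l' ++ l)) := by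
  simp only [wordProd, List.map_append, List.prod_append]
  exact M.φ_mul_comm _ _

theorem φ_wordProd_mul_add_pow_succ (a b : M) (l : List Bool) (k : ℕ) :
    M.φ (wordProd a b l * (a + b) ^ (k + 1)) =
      M.φ (wordProd a b (l ++ [false]) * (a + b) ^ k) +
        M.φ (wordProd a b (l ++ [true]) * (a + b) ^ k) := by
  simp only [wordProd, List.map_append, List.prod_append, List.map_cons, List.map_nil,
    List.prod_cons, List.prod_nil, mul_one, cond_true, cond_false, pow_succ', ← mul_assoc]
  rw [← map_add, ← add_mul, ← mul_add]

theorem φ_add_pow_eq_wordProd (a b : M) (k : ℕ) :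
    M.φ ((a + b) ^ k) = M.φ (wordProd a b [] * (a + b) ^ k) := by
  simp [wordProd]

end TFree

end NCProbSpace

/-! ### Moments of $a+b$ for centered $a$ and $b$ -/

namespace NCProbSpace

namespace TFree

variable {M : NCProbSpace.{u}} {t : ℝ≥0∞} {A B : StarSubalgebra ℂ M} {a b : M}

theorem φ_wordProd_two_blocks (h : M.TFree t A B) (ha : a ∈ A) (hb : b ∈ B) (i j : ℕ) :
    M.φ (wordProd a b (List.replicate i false ++ List.replicate j true)) =
      M.φ (a ^ i) * M.φ (b ^ j) := by
  rw [← h.φ_mul (pow_mem ha i) (pow_mem hb j)]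
  simp [wordProd]

theorem φ_wordProd_four_blocks (h : M.TFree t A B) (ha : a ∈ A) (hb : b ∈ B) (i j k l : ℕ) :
    M.φ (wordProd a b (List.replicate i false ++ (List.replicate j true ++
      (List.replicate k false ++ List.replicate l true)))) =
      (expNeg t : ℂ) ^ 2 * ((M.φ (a ^ (i + k)) - M.φ (a ^ i) * M.φ (a ^ k)) *
        (M.φ (b ^ (j + l)) - M.φ (b ^ j) * M.φ (b ^ l))) +
      M.φ (a ^ i) * M.φ (a ^ k) * M.φ (b ^ (j + l)) +
      M.φ (b ^ j) * M.φ (b ^ l) * M.φ (a ^ (i + k)) -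
      M.φ (a ^ i) * M.φ (a ^ k) * M.φ (b ^ j) * M.φ (b ^ l) := by
  rw [pow_add, pow_add, ← h.φ_mul_four (pow_mem ha i) (pow_mem ha k) (pow_mem hb j) (pow_mem hb l)]
  simp [wordProd]

theorem φ_wordProd_six_letters (h : M.TFree t A B) (ha : a ∈ A) (hb : b ∈ B) (ha0 : M.φ a = 0)
    (hb0 : M.φ b = 0) :
    M.φ (wordProd a b [false, true, false, true, false, true]) =
      (expNeg t : ℂ) ^ 3 * (M.φ (a ^ 3) * M.φ (b ^ 3)) := by
  have := h.φ_mul_six_centered ha ha ha hb hb hb ha0 ha0 ha0 hb0 hb0 hb0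
  simpa [wordProd, pow_succ, mul_assoc] using this

/-- In this and the next four lemmas the power is expanded into words. The rotations `r` and `s`
bring each word that contains both letters to one starting with $a$ and ending with $b$, whose
expectation is read off from its blocks. Blocks of length one have zero expectation. -/
theorem φ_add_pow_two (h : M.TFree t A B) (ha : a ∈ A) (hb : b ∈ B) (ha0 : M.φ a = 0)
    (hb0 : M.φ b = 0) :
    M.φ ((a + b) ^ 2) = M.φ (a ^ 2) + M.φ (b ^ 2) := by
  have ha1 : M.φ (a ^ 1) = 0 := by rw [pow_one, ha0]
  have hb1 : M.φ (b ^ 1) = 0 := by rw [pow_one, hb0]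
  have hr := φ_wordProd_append_comm a b
  have h2 := h.φ_wordProd_two_blocks ha hb
  have h4 := h.φ_wordProd_four_blocks ha hb
  have r1 : M.φ (wordProd a b [true, false]) =
      M.φ (wordProd a b [false, true]) := hr [true] [false]
  have p : M.φ (wordProd a b [false, false]) = M.φ (a ^ 2) := by
    simp [wordProd, pow_succ]
  have q : M.φ (wordProd a b [true, true]) = M.φ (b ^ 2) := by
    simp [wordProd, pow_succ]
  simp only [φ_add_pow_eq_wordProd a b, φ_wordProd_mul_add_pow_succ, pow_zero, mul_one, List.nil_append,
    List.cons_append, r1]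
  simp only [p, q,
    show M.φ (wordProd a b [false, true]) = _ from h2 1 1]
  simp only [ha1, hb1]
  ring

theorem φ_add_pow_three (h : M.TFree t A B) (ha : a ∈ A) (hb : b ∈ B) (ha0 : M.φ a = 0)
    (hb0 : M.φ b = 0) :
    M.φ ((a + b) ^ 3) = M.φ (a ^ 3) + M.φ (b ^ 3) := by
  have ha1 : M.φ (a ^ 1) = 0 := by rw [pow_one, ha0]
  have hb1 : M.φ (b ^ 1) = 0 := by rw [pow_one, hb0]
  have hr := φ_wordProd_append_comm a b
  have h2 := h.φ_wordProd_two_blocks ha hb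
  have h4 := h.φ_wordProd_four_blocks ha hb
  have r1 : ∀ c0, M.φ (wordProd a b [true, false, c0]) =
      M.φ (wordProd a b [false, c0, true]) := fun c0 => hr [true] [false, c0]
  have r2 : M.φ (wordProd a b [true, true, false]) =
      M.φ (wordProd a b [false, true, true]) := hr [true, true] [false]
  have s1 : M.φ (wordProd a b [false, true, false]) =
      M.φ (wordProd a b [false, false, true]) := hr [false, true] [false]
  have p : M.φ (wordProd a b [false, false, false]) = M.φ (a ^ 3) := by
    simp [wordProd, pow_succ, mul_assoc]
  have q : M.φ (wordProd a b [true, true, true]) = M.φ (b ^ 3) := by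
    simp [wordProd, pow_succ, mul_assoc]
  simp only [φ_add_pow_eq_wordProd a b, φ_wordProd_mul_add_pow_succ, pow_zero, mul_one, List.nil_append,
    List.cons_append, r1, r2, s1]
  simp only [p, q,
    show M.φ (wordProd a b [false, false, true]) = _ from h2 2 1,
    show M.φ (wordProd a b [false, true, true]) = _ from h2 1 2]
  simp only [ha1, hb1]
  ring

theorem φ_add_pow_four (h : M.TFree t A B) (ha : a ∈ A) (hb : b ∈ B) (ha0 : M.φ a = 0)
    (hb0 : M.φ b = 0) :
    M.φ ((a + b) ^ 4) = M.φ (a ^ 4) + M.φ (b ^ 4) +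
      (4 + 2 * (expNeg t : ℂ) ^ 2) * (M.φ (a ^ 2) * M.φ (b ^ 2)) := by
  have ha1 : M.φ (a ^ 1) = 0 := by rw [pow_one, ha0]
  have hb1 : M.φ (b ^ 1) = 0 := by rw [pow_one, hb0]
  have hr := φ_wordProd_append_comm a b
  have h2 := h.φ_wordProd_two_blocks ha hb
  have h4 := h.φ_wordProd_four_blocks ha hb
  have r1 : ∀ c0 c1, M.φ (wordProd a b [true, false, c0, c1]) =
      M.φ (wordProd a b [false, c0, c1, true]) := fun c0 c1 => hr [true] [false, c0, c1]
  have r2 : ∀ c0, M.φ (wordProd a b [true, true, false, c0]) =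
      M.φ (wordProd a b [false, c0, true, true]) := fun c0 => hr [true, true] [false, c0]
  have r3 : M.φ (wordProd a b [true, true, true, false]) =
      M.φ (wordProd a b [false, true, true, true]) := hr [true, true, true] [false]
  have s1 : ∀ c0, M.φ (wordProd a b [false, c0, true, false]) =
      M.φ (wordProd a b [false, false, c0, true]) := fun c0 => hr [false, c0, true] [false]
  have s2 : M.φ (wordProd a b [false, true, false, false]) =
      M.φ (wordProd a b [false, false, false, true]) := hr [false, true] [false, false]
  have p : M.φ (wordProd a b [false, false, false, false]) = M.φ (a ^ 4) := by
    simp [wordProd, pow_succ, mul_assoc]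
  have q : M.φ (wordProd a b [true, true, true, true]) = M.φ (b ^ 4) := by
    simp [wordProd, pow_succ, mul_assoc]
  simp only [φ_add_pow_eq_wordProd a b, φ_wordProd_mul_add_pow_succ, pow_zero, mul_one, List.nil_append,
    List.cons_append, r1, r2, r3, s1, s2]
  simp only [p, q,
    show M.φ (wordProd a b [false, false, false, true]) = _ from h2 3 1,
    show M.φ (wordProd a b [false, false, true, true]) = _ from h2 2 2,
    show M.φ (wordProd a b [false, true, false, true]) = _ from h4 1 1 1 1,
    show M.φ (wordProd a b [false, true, true, true]) = _ from h2 1 3]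
  simp only [Nat.reduceAdd, ha1, hb1]
  ring

theorem φ_add_pow_five (h : M.TFree t A B) (ha : a ∈ A) (hb : b ∈ B) (ha0 : M.φ a = 0)
    (hb0 : M.φ b = 0) :
    M.φ ((a + b) ^ 5) = M.φ (a ^ 5) + M.φ (b ^ 5) +
      (5 + 5 * (expNeg t : ℂ) ^ 2) * (M.φ (a ^ 3) * M.φ (b ^ 2) + M.φ (a ^ 2) * M.φ (b ^ 3)) := by
  have ha1 : M.φ (a ^ 1) = 0 := by rw [pow_one, ha0]
  have hb1 : M.φ (b ^ 1) = 0 := by rw [pow_one, hb0]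
  have hr := φ_wordProd_append_comm a b
  have h2 := h.φ_wordProd_two_blocks ha hb
  have h4 := h.φ_wordProd_four_blocks ha hb
  have r1 : ∀ c0 c1 c2, M.φ (wordProd a b [true, false, c0, c1, c2]) =
      M.φ (wordProd a b [false, c0, c1, c2, true]) := fun c0 c1 c2 => hr [true] [false, c0, c1, c2]
  have r2 : ∀ c0 c1, M.φ (wordProd a b [true, true, false, c0, c1]) =
      M.φ (wordProd a b [false, c0, c1, true, true]) := fun c0 c1 => hr [true, true] [false, c0, c1]
  have r3 : ∀ c0, M.φ (wordProd a b [true, true, true, false, c0]) =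
      M.φ (wordProd a b [false, c0, true, true, true]) := fun c0 => hr [true, true, true] [false, c0]
  have r4 : M.φ (wordProd a b [true, true, true, true, false]) =
      M.φ (wordProd a b [false, true, true, true, true]) := hr [true, true, true, true] [false]
  have s1 : ∀ c0 c1, M.φ (wordProd a b [false, c0, c1, true, false]) =
      M.φ (wordProd a b [false, false, c0, c1, true]) := fun c0 c1 => hr [false, c0, c1, true] [false]
  have s2 : ∀ c0, M.φ (wordProd a b [false, c0, true, false, false]) =
      M.φ (wordProd a b [false, false, false, c0, true]) := fun c0 => hr [false, c0, true] [false, false]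
  have s3 : M.φ (wordProd a b [false, true, false, false, false]) =
      M.φ (wordProd a b [false, false, false, false, true]) := hr [false, true] [false, false, false]
  have p : M.φ (wordProd a b [false, false, false, false, false]) = M.φ (a ^ 5) := by
    simp [wordProd, pow_succ, mul_assoc]
  have q : M.φ (wordProd a b [true, true, true, true, true]) = M.φ (b ^ 5) := by
    simp [wordProd, pow_succ, mul_assoc]
  simp only [φ_add_pow_eq_wordProd a b, φ_wordProd_mul_add_pow_succ, pow_zero, mul_one, List.nil_append,
    List.cons_append, r1, r2, r3, r4, s1, s2, s3]
  simp only [p, q,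
    show M.φ (wordProd a b [false, false, false, false, true]) = _ from h2 4 1,
    show M.φ (wordProd a b [false, false, false, true, true]) = _ from h2 3 2,
    show M.φ (wordProd a b [false, false, true, false, true]) = _ from h4 2 1 1 1,
    show M.φ (wordProd a b [false, false, true, true, true]) = _ from h2 2 3,
    show M.φ (wordProd a b [false, true, false, false, true]) = _ from h4 1 1 2 1,
    show M.φ (wordProd a b [false, true, false, true, true]) = _ from h4 1 1 1 2,
    show M.φ (wordProd a b [false, true, true, false, true]) = _ from h4 1 2 1 1,
    show M.φ (wordProd a b [false, true, true, true, true]) = _ from h2 1 4]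
  simp only [Nat.reduceAdd, ha1, hb1]
  ring

/-- The term $2x^3$ comes from $ababab$ and $bababa$. The terms with $1-x^2$ come from the rotations
of $aabaab$ and $abbabb$, whose two $a$-blocks, respectively $b$-blocks, of length two are not
centered. -/
theorem φ_add_pow_six (h : M.TFree t A B) (ha : a ∈ A) (hb : b ∈ B) (ha0 : M.φ a = 0)
    (hb0 : M.φ b = 0) :
    M.φ ((a + b) ^ 6) = M.φ (a ^ 6) + M.φ (b ^ 6) +
      (6 + 9 * (expNeg t : ℂ) ^ 2) * (M.φ (a ^ 4) * M.φ (b ^ 2) + M.φ (a ^ 2) * M.φ (b ^ 4)) +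
      3 * (1 - (expNeg t : ℂ) ^ 2) *
        (M.φ (a ^ 2) ^ 2 * M.φ (b ^ 2) + M.φ (a ^ 2) * M.φ (b ^ 2) ^ 2) +
      (6 + 12 * (expNeg t : ℂ) ^ 2 + 2 * (expNeg t : ℂ) ^ 3) * (M.φ (a ^ 3) * M.φ (b ^ 3)) := by
  have ha1 : M.φ (a ^ 1) = 0 := by rw [pow_one, ha0]
  have hb1 : M.φ (b ^ 1) = 0 := by rw [pow_one, hb0]
  have hr := φ_wordProd_append_comm a b
  have h2 := h.φ_wordProd_two_blocks ha hb
  have h4 := h.φ_wordProd_four_blocks ha hb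
  have r1 : ∀ c0 c1 c2 c3, M.φ (wordProd a b [true, false, c0, c1, c2, c3]) =
      M.φ (wordProd a b [false, c0, c1, c2, c3, true]) := fun c0 c1 c2 c3 => hr [true] [false, c0, c1, c2, c3]
  have r2 : ∀ c0 c1 c2, M.φ (wordProd a b [true, true, false, c0, c1, c2]) =
      M.φ (wordProd a b [false, c0, c1, c2, true, true]) := fun c0 c1 c2 => hr [true, true] [false, c0, c1, c2]
  have r3 : ∀ c0 c1, M.φ (wordProd a b [true, true, true, false, c0, c1]) =
      M.φ (wordProd a b [false, c0, c1, true, true, true]) := fun c0 c1 => hr [true, true, true] [false, c0, c1]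
  have r4 : ∀ c0, M.φ (wordProd a b [true, true, true, true, false, c0]) =
      M.φ (wordProd a b [false, c0, true, true, true, true]) := fun c0 => hr [true, true, true, true] [false, c0]
  have r5 : M.φ (wordProd a b [true, true, true, true, true, false]) =
      M.φ (wordProd a b [false, true, true, true, true, true]) := hr [true, true, true, true, true] [false]
  have s1 : ∀ c0 c1 c2, M.φ (wordProd a b [false, c0, c1, c2, true, false]) =
      M.φ (wordProd a b [false, false, c0, c1, c2, true]) := fun c0 c1 c2 => hr [false, c0, c1, c2, true] [false]
  have s2 : ∀ c0 c1, M.φ (wordProd a b [false, c0, c1, true, false, false]) =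
      M.φ (wordProd a b [false, false, false, c0, c1, true]) := fun c0 c1 => hr [false, c0, c1, true] [false, false]
  have s3 : ∀ c0, M.φ (wordProd a b [false, c0, true, false, false, false]) =
      M.φ (wordProd a b [false, false, false, false, c0, true]) := fun c0 => hr [false, c0, true] [false, false, false]
  have s4 : M.φ (wordProd a b [false, true, false, false, false, false]) =
      M.φ (wordProd a b [false, false, false, false, false, true]) := hr [false, true] [false, false, false, false]
  have p : M.φ (wordProd a b [false, false, false, false, false, false]) = M.φ (a ^ 6) := by
    simp [wordProd, pow_succ, mul_assoc]
  have q : M.φ (wordProd a b [true, true, true, true, true, true]) = M.φ (b ^ 6) := by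
    simp [wordProd, pow_succ, mul_assoc]
  simp only [φ_add_pow_eq_wordProd a b, φ_wordProd_mul_add_pow_succ, pow_zero, mul_one, List.nil_append,
    List.cons_append, r1, r2, r3, r4, r5, s1, s2, s3, s4]
  simp only [p, q,
    show M.φ (wordProd a b [false, false, false, false, false, true]) = _ from h2 5 1,
    show M.φ (wordProd a b [false, false, false, false, true, true]) = _ from h2 4 2,
    show M.φ (wordProd a b [false, false, false, true, false, true]) = _ from h4 3 1 1 1,
    show M.φ (wordProd a b [false, false, false, true, true, true]) = _ from h2 3 3,
    show M.φ (wordProd a b [false, false, true, false, false, true]) = _ from h4 2 1 2 1,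
    show M.φ (wordProd a b [false, false, true, false, true, true]) = _ from h4 2 1 1 2,
    show M.φ (wordProd a b [false, false, true, true, false, true]) = _ from h4 2 2 1 1,
    show M.φ (wordProd a b [false, false, true, true, true, true]) = _ from h2 2 4,
    show M.φ (wordProd a b [false, true, false, false, false, true]) = _ from h4 1 1 3 1,
    show M.φ (wordProd a b [false, true, false, false, true, true]) = _ from h4 1 1 2 2,
    show M.φ (wordProd a b [false, true, false, true, false, true]) = _ from h.φ_wordProd_six_letters ha hb ha0 hb0,
    show M.φ (wordProd a b [false, true, false, true, true, true]) = _ from h4 1 1 1 3,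
    show M.φ (wordProd a b [false, true, true, false, false, true]) = _ from h4 1 2 2 1,
    show M.φ (wordProd a b [false, true, true, false, true, true]) = _ from h4 1 2 1 2,
    show M.φ (wordProd a b [false, true, true, true, false, true]) = _ from h4 1 3 1 1,
    show M.φ (wordProd a b [false, true, true, true, true, true]) = _ from h2 1 5]
  simp only [Nat.reduceAdd, ha1, hb1]
  ring

end TFree

end NCProbSpace

/-! ### Existence: the polynomial identities satisfied by the coefficients -/

noncomputable section

/-- The moments of `y + s • 1` in terms of the moments `g` of `y`. -/
def shiftMoment (s : ℂ) (g : ℕ → ℂ) (k : ℕ) : ℂ :=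
  ∑ j ∈ Finset.range (k + 1), g j * s ^ (k - j) * (k.choose j : ℂ)

/-- The moments up to order `6` of the sum of two centered elements of `t`-free subalgebras, in
terms of the moments `f` and `g` of these elements and of `x = e^{-t}`. -/
def mixMoment (x : ℂ) (f g : ℕ → ℂ) : ℕ → ℂ
  | 0 => 1
  | 2 => f 2 + g 2
  | 3 => f 3 + g 3
  | 4 => f 4 + g 4 + (4 + 2 * x ^ 2) * (f 2 * g 2)
  | 5 => f 5 + g 5 + (5 + 5 * x ^ 2) * (f 3 * g 2 + f 2 * g 3)
  | 6 => f 6 + g 6 + (6 + 9 * x ^ 2) * (f 4 * g 2 + f 2 * g 4) +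
      3 * (1 - x ^ 2) * (f 2 ^ 2 * g 2 + f 2 * g 2 ^ 2) +
      (6 + 12 * x ^ 2 + 2 * x ^ 3) * (f 3 * g 3)
  | _ => 0

/-- The sum `∑ σ, F(λ(σ)) ∏ g(λᵢ(σ))` where `λ(σ)` is the partition given by the cycles of `σ`. -/
def momentSum (n : ℕ) (F : List ℕ → ℂ) (g : ℕ → ℂ) : ℂ :=
  ∑ σ : Equiv.Perm (Fin n), (fun l => F l * (l.map g).prod) (cycleShape σ)

theorem momentSum_two (F : List ℕ → ℂ) (g : ℕ → ℂ) :
    momentSum 2 F g = F [2] * g 2 + F [1, 1] * g 1 ^ 2 := by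
  rw [momentSum, sum_comp_cycleShape_two fun l => F l * (l.map g).prod]
  simp only [List.map_cons, List.map_nil, List.prod_cons, List.prod_nil]
  ring

theorem momentSum_three (F : List ℕ → ℂ) (g : ℕ → ℂ) :
    momentSum 3 F g = 2 * F [3] * g 3 + 3 * F [2, 1] * g 2 * g 1 + F [1, 1, 1] * g 1 ^ 3 := by
  rw [momentSum, sum_comp_cycleShape_three fun l => F l * (l.map g).prod]
  simp only [List.map_cons, List.map_nil, List.prod_cons, List.prod_nil]
  ring

theorem momentSum_four (F : List ℕ → ℂ) (g : ℕ → ℂ) :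
    momentSum 4 F g = 6 * F [4] * g 4 + 8 * F [3, 1] * g 3 * g 1 + 3 * F [2, 2] * g 2 ^ 2 +
      6 * F [2, 1, 1] * g 2 * g 1 ^ 2 + F [1, 1, 1, 1] * g 1 ^ 4 := by
  rw [momentSum, sum_comp_cycleShape_four fun l => F l * (l.map g).prod]
  simp only [List.map_cons, List.map_nil, List.prod_cons, List.prod_nil]
  ring

theorem momentSum_five (F : List ℕ → ℂ) (g : ℕ → ℂ) :
    momentSum 5 F g = 24 * F [5] * g 5 + 30 * F [4, 1] * g 4 * g 1 + 20 * F [3, 2] * g 3 * g 2 +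
      20 * F [3, 1, 1] * g 3 * g 1 ^ 2 + 15 * F [2, 2, 1] * g 2 ^ 2 * g 1 +
      10 * F [2, 1, 1, 1] * g 2 * g 1 ^ 3 + F [1, 1, 1, 1, 1] * g 1 ^ 5 := by
  rw [momentSum, sum_comp_cycleShape_five fun l => F l * (l.map g).prod]
  simp only [List.map_cons, List.map_nil, List.prod_cons, List.prod_nil]
  ring

theorem momentSum_six (F : List ℕ → ℂ) (g : ℕ → ℂ) :
    momentSum 6 F g = 120 * F [6] * g 6 + 144 * F [5, 1] * g 5 * g 1 + 90 * F [4, 2] * g 4 * g 2 +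
      90 * F [4, 1, 1] * g 4 * g 1 ^ 2 + 40 * F [3, 3] * g 3 ^ 2 +
      120 * F [3, 2, 1] * g 3 * g 2 * g 1 + 40 * F [3, 1, 1, 1] * g 3 * g 1 ^ 3 +
      15 * F [2, 2, 2] * g 2 ^ 3 + 45 * F [2, 2, 1, 1] * g 2 ^ 2 * g 1 ^ 2 +
      15 * F [2, 1, 1, 1, 1] * g 2 * g 1 ^ 4 + F [1, 1, 1, 1, 1, 1] * g 1 ^ 6 := by
  rw [momentSum, sum_comp_cycleShape_six fun l => F l * (l.map g).prod]
  simp only [List.map_cons, List.map_nil, List.prod_cons, List.prod_nil]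
  ring

theorem momentSum_congr {n : ℕ} (F : List ℕ → ℂ) {f g : ℕ → ℂ} (h : ∀ k ≤ n, f k = g k) :
    momentSum n F f = momentSum n F g := by
  refine Finset.sum_congr rfl fun σ _ => ?_
  have : (cycleShape σ).map f = (cycleShape σ).map g := List.map_congr_left fun k hk => h k <| by
    have h1 := List.le_sum_of_mem hk
    rwa [sum_cycleShape_eq] at h1
  simp only [this]

/-- This is the role of the coefficients of the partitions with parts equal to `1`: their
contributions compensate the effect of a translation. -/
theorem momentSum_shiftMoment (x : ℝ) {n : ℕ} (hn : n ∈ Finset.Icc 2 6) (g : ℕ → ℂ) (hg : g 0 = 1)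
    (s : ℂ) : momentSum n (fun l => (tFreeCoeff x l : ℂ)) (shiftMoment s g) =
      momentSum n (fun l => (tFreeCoeff x l : ℂ)) g := by
  rw [Finset.mem_Icc] at hn
  obtain ⟨h2, h6⟩ := hn
  interval_cases n
  all_goals
    simp only [momentSum_two, momentSum_three, momentSum_four, momentSum_five, momentSum_six,
      tFreeCoeff, shiftMoment, Finset.sum_range_succ, Finset.sum_range_zero, hg]
    norm_num [Nat.choose]
    ring

/-- First moments being zero, only the partitions without part `1` contribute; their coefficients
are the ones that cancel the mixed terms. For $n=4$, for instance, the coefficient of $f_2g_2$ is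
$6(4+2x^2)+6c_{22}=0$. -/
theorem momentSum_mixMoment (x : ℝ) {n : ℕ} (hn : n ∈ Finset.Icc 2 6) (f g : ℕ → ℂ) (hf : f 1 = 0)
    (hg : g 1 = 0) : momentSum n (fun l => (tFreeCoeff x l : ℂ)) (mixMoment x f g) =
      momentSum n (fun l => (tFreeCoeff x l : ℂ)) f +
        momentSum n (fun l => (tFreeCoeff x l : ℂ)) g := by
  rw [Finset.mem_Icc] at hn
  obtain ⟨h2, h6⟩ := hn
  interval_cases n
  all_goals
    simp only [momentSum_two, momentSum_three, momentSum_four, momentSum_five, momentSum_six,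
      tFreeCoeff, mixMoment, hf, hg]
    push_cast
    ring

namespace NCProbSpace

variable {M : NCProbSpace.{u}}

theorem φ_add_smul_one_pow (y : M) (s : ℂ) (k : ℕ) :
    M.φ ((y + s • (1 : M)) ^ k) = shiftMoment s (fun j => M.φ (y ^ j)) k := by
  rw [((Commute.one_right y).smul_right s).add_pow, map_sum, shiftMoment]
  refine Finset.sum_congr rfl fun j _ => ?_
  rw [← nsmul_eq_mul', smul_pow, one_pow, mul_smul_comm, mul_one, map_nsmul, map_smul,
    nsmul_eq_mul, smul_eq_mul]
  ring

theorem TFree.φ_add_pow {t : ℝ≥0∞} {A B : StarSubalgebra ℂ M} (h : M.TFree t A B) {a b : M}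
    (ha : a ∈ A) (hb : b ∈ B) (ha0 : M.φ a = 0) (hb0 : M.φ b = 0) {k : ℕ} (hk : k ≤ 6) :
    M.φ ((a + b) ^ k) =
      mixMoment (expNeg t) (fun j => M.φ (a ^ j)) (fun j => M.φ (b ^ j)) k := by
  interval_cases k
  · simp [mixMoment, M.φ_one]
  · simp [mixMoment, ha0, hb0]
  · exact h.φ_add_pow_two ha hb ha0 hb0
  · exact h.φ_add_pow_three ha hb ha0 hb0
  · exact h.φ_add_pow_four ha hb ha0 hb0
  · exact h.φ_add_pow_five ha hb ha0 hb0
  · exact h.φ_add_pow_six ha hb ha0 hb0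

theorem shiftMoment_congr {s : ℂ} {f g : ℕ → ℂ} {k : ℕ} (h : ∀ j ≤ k, f j = g j) :
    shiftMoment s f k = shiftMoment s g k :=
  Finset.sum_congr rfl fun j hj => by rw [h j (Nat.lt_succ_iff.1 (Finset.mem_range.1 hj))]

theorem TFree.φ_add_add_smul_one_pow {t : ℝ≥0∞} {A B : StarSubalgebra ℂ M} (h : M.TFree t A B)
    {a b : M} (ha : a ∈ A) (hb : b ∈ B) (ha0 : M.φ a = 0) (hb0 : M.φ b = 0) (s s' : ℂ) {k : ℕ}
    (hk : k ≤ 6) :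
    M.φ (((a + s • (1 : M)) + (b + s' • (1 : M))) ^ k) =
      shiftMoment (s + s')
        (mixMoment (expNeg t) (fun j => M.φ (a ^ j)) (fun j => M.φ (b ^ j))) k := by
  rw [show (a + s • (1 : M)) + (b + s' • (1 : M)) = (a + b) + (s + s') • (1 : M) by
    rw [add_smul]; abel, φ_add_smul_one_pow]
  exact shiftMoment_congr fun j hj => h.φ_add_pow ha hb ha0 hb0 (hj.trans hk)

theorem TFree.momentSum_add {t : ℝ≥0∞} {A B : StarSubalgebra ℂ M} (h : M.TFree t A B)
    {n : ℕ} (hn : n ∈ Finset.Icc 2 6) {a b : M} (ha : a ∈ A) (hb : b ∈ B) :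
    momentSum n (fun l => (tFreeCoeff (expNeg t) l : ℂ)) (fun k => M.φ ((a + b) ^ k)) =
      momentSum n (fun l => (tFreeCoeff (expNeg t) l : ℂ)) (fun k => M.φ (a ^ k)) +
        momentSum n (fun l => (tFreeCoeff (expNeg t) l : ℂ)) (fun k => M.φ (b ^ k)) := by
  -- Both elements are centered, since `mixMoment` only describes sums of centered elements; the
  -- scalars are absorbed by translation invariance.
  obtain ⟨a, s, rfl, ha, ha0⟩ : ∃ (a' : M) (s : ℂ), a = a' + s • (1 : M) ∧ a' ∈ A ∧ M.φ a' = 0 :=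
    ⟨a - M.φ a • (1 : M), M.φ a, by simp, sub_smul_one_mem ha _, φ_sub_smul_one a⟩
  obtain ⟨b, s', rfl, hb, hb0⟩ : ∃ (b' : M) (s : ℂ), b = b' + s • (1 : M) ∧ b' ∈ B ∧ M.φ b' = 0 :=
    ⟨b - M.φ b • (1 : M), M.φ b, by simp, sub_smul_one_mem hb _, φ_sub_smul_one b⟩
  rw [momentSum_congr _ fun k hk => h.φ_add_add_smul_one_pow ha hb ha0 hb0 s s'
    (hk.trans (Finset.mem_Icc.1 hn).2)]
  simp_rw [φ_add_smul_one_pow]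
  rw [momentSum_shiftMoment _ hn _ rfl, momentSum_shiftMoment _ hn _ (by simp [M.φ_one]),
    momentSum_shiftMoment _ hn _ (by simp [M.φ_one]),
    momentSum_mixMoment _ hn _ _ (by simp [ha0]) (by simp [hb0])]

end NCProbSpace

theorem cumulantForm_const_eq_momentSum (M : NCProbSpace.{u}) {n : ℕ} (F : List ℕ → ℂ) (y : M) :
    M.cumulantForm (fun σ : Equiv.Perm (Fin n) => F (cycleShape σ)) (fun _ => y) =
      momentSum n F fun k => M.φ (y ^ k) :=
  M.cumulantForm_const F y

theorem sum_cycleType_singleton {n : ℕ} (hn : 2 ≤ n) (F : List ℕ → ℂ) :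
    ∑ σ : Equiv.Perm (Fin n) with σ.cycleType = {n}, F (cycleShape σ) =
      ((n - 1).factorial : ℂ) * F [n] := by
  have h : ∀ σ : Equiv.Perm (Fin n), σ.cycleType = {n} → cycleShape σ = [n] := by
    intro σ hσ
    refine (cycleShape_eq_iff (by simp) (by simp; omega) (by simp) σ).2 ?_
    simp [hσ, hn]
  rw [Finset.sum_congr rfl fun σ hσ => by rw [h σ (Finset.mem_filter.1 hσ).2], Finset.sum_const,
    Equiv.Perm.card_of_cycleType_singleton hn (by simp), Fintype.card_fin, Nat.choose_self, mul_one,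
    nsmul_eq_mul]

theorem tFreeCoeff_singleton (x : ℝ) {n : ℕ} (hn : n ∈ Finset.Icc 2 6) : tFreeCoeff x [n] = 1 := by
  rw [Finset.mem_Icc] at hn
  obtain ⟨h2, h6⟩ := hn
  interval_cases n <;> rfl

theorem isTFreeCumulant_tFreeCoeff (t : ℝ≥0∞) {n : ℕ} (hn : n ∈ Finset.Icc 2 6) :
    IsTFreeCumulant.{u} t n fun σ => (tFreeCoeff (expNeg t) (cycleShape σ) : ℂ) := by
  have h2 := (Finset.mem_Icc.1 hn).1
  refine ⟨?_, fun M A B h m hm hA hB => ?_⟩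
  · rw [sum_cycleType_singleton h2 fun l => (tFreeCoeff (expNeg t) l : ℂ),
      tFreeCoeff_singleton _ hn]
    simp [Nat.factorial_ne_zero]
  · rw [← M.cumulantForm_apply]
    refine MultilinearMap.eq_zero_of_map_const_add _
      (fun ρ m => M.cumulantForm_comp_perm (isConjInvariant_comp_cycleShape
        fun l => (tFreeCoeff (expNeg t) l : ℂ)) ρ m)
      (Subalgebra.toSubmodule A.toSubalgebra) (Subalgebra.toSubmodule B.toSubalgebra)
      (fun a ha b hb => ?_) m hm hA hB
    have e := cumulantForm_const_eq_momentSum M (n := n) fun l => (tFreeCoeff (expNeg t) l : ℂ)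
    rw [e, e, e]
    exact h.momentSum_add hn ha hb

end

/-! ### Free states are hermitian, tracial and positive -/

section FreeState

/-- A unital linear form for which a generating family of `*`-subalgebras is free, and whose
restriction to each of them is tracial, hermitian and positive. -/
structure IsFreeState {P ι : Type*} [Ring P] [StarRing P] [Algebra ℂ P] [StarModule ℂ P]
    (φ : P →ₗ[ℂ] ℂ) (A : ι → StarSubalgebra ℂ P) : Prop where
  map_one : φ 1 = 1
  free : ∀ l : List (ι × P), l ≠ [] → (l.IsChain fun p q => p.1 ≠ q.1) →
    (∀ p ∈ l, p.2 ∈ A p.1 ∧ φ p.2 = 0) → φ (l.map Prod.snd).prod = 0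
  generates : Algebra.adjoin ℂ (⋃ i, (A i : Set P)) = ⊤
  mul_comm : ∀ i, ∀ x ∈ A i, ∀ y ∈ A i, φ (x * y) = φ (y * x)
  map_star : ∀ i, ∀ x ∈ A i, φ (star x) = star (φ x)
  nonneg : ∀ i, ∀ x ∈ A i, 0 ≤ φ (star x * x)

namespace IsFreeState

variable {P ι : Type*} [Ring P] [StarRing P] [Algebra ℂ P] [StarModule ℂ P]
  {φ : P →ₗ[ℂ] ℂ} {A : ι → StarSubalgebra ℂ P}

/-- Lists of centered elements, any two consecutive ones being taken from distinct subalgebras. -/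
def IsAlternating (φ : P →ₗ[ℂ] ℂ) (A : ι → StarSubalgebra ℂ P) (l : List (ι × P)) : Prop :=
  (l.IsChain fun p q => p.1 ≠ q.1) ∧ ∀ p ∈ l, p.2 ∈ A p.1 ∧ φ p.2 = 0

theorem IsAlternating.of_cons {p : ι × P} {l : List (ι × P)} (h : IsAlternating φ A (p :: l)) :
    IsAlternating φ A l :=
  ⟨(List.isChain_cons.1 h.1).2, fun q hq => h.2 q (List.mem_cons_of_mem _ hq)⟩

theorem IsAlternating.replace_head {i : ι} {b c : P} {l : List (ι × P)}
    (h : IsAlternating φ A ((i, b) :: l)) (hc : c ∈ A i) (hc0 : φ c = 0) :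
    IsAlternating φ A ((i, c) :: l) := by
  refine ⟨List.isChain_cons.2 ⟨(List.isChain_cons.1 h.1).1, (List.isChain_cons.1 h.1).2⟩,
    fun q hq => ?_⟩
  rcases List.mem_cons.1 hq with rfl | hq
  · exact ⟨hc, hc0⟩
  · exact h.2 q (List.mem_cons_of_mem _ hq)

theorem map_smul_one (hφ : IsFreeState φ A) (c : ℂ) : φ (c • (1 : P)) = c := by
  rw [map_smul, hφ.map_one, smul_eq_mul, mul_one]

theorem map_sub_smul_one (hφ : IsFreeState φ A) (x : P) : φ (x - φ x • (1 : P)) = 0 := by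
  rw [map_sub, hφ.map_smul_one, sub_self]

theorem sub_smul_one_mem {i : ι} {x : P} (hx : x ∈ A i) (c : ℂ) : x - c • (1 : P) ∈ A i :=
  sub_mem hx ((A i).smul_mem (one_mem _) c)

theorem map_prod_eq_zero (hφ : IsFreeState φ A) {l : List (ι × P)} (h : IsAlternating φ A l)
    (hl : l ≠ []) : φ (l.map Prod.snd).prod = 0 :=
  hφ.free l hl h.1 h.2

/-- The span of the alternating centered products. -/
def alternatingSpan (φ : P →ₗ[ℂ] ℂ) (A : ι → StarSubalgebra ℂ P) : Submodule ℂ P :=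
  Submodule.span ℂ {x | ∃ l, IsAlternating φ A l ∧ x = (l.map Prod.snd).prod}

theorem prod_mem_alternatingSpan {l : List (ι × P)} (h : IsAlternating φ A l) :
    (l.map Prod.snd).prod ∈ alternatingSpan φ A :=
  Submodule.subset_span ⟨l, h, rfl⟩

/-- If the word starts in `A i`, its first letter is absorbed into `a`. The resulting element of `A
i` is then its centered part, which prolongs the word, plus a scalar. -/
theorem mul_mem_alternatingSpan (hφ : IsFreeState φ A) {i : ι} {a : P} (ha : a ∈ A i) {x : P}
    (hx : x ∈ alternatingSpan φ A) : a * x ∈ alternatingSpan φ A := by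
  induction hx using Submodule.span_induction with
  | zero => rw [mul_zero]; exact zero_mem _
  | add x y _ _ hx hy => rw [mul_add]; exact add_mem hx hy
  | smul c x _ hx => rw [mul_smul_comm]; exact Submodule.smul_mem _ _ hx
  | mem x hx =>
    obtain ⟨l, hl, rfl⟩ := hx
    have key : ∀ b ∈ A i, ∀ l, IsAlternating φ A l → (∀ q ∈ l.head?, i ≠ q.1) →
        b * (l.map Prod.snd).prod ∈ alternatingSpan φ A := by
      intro b hb l hl hi
      have h1 : IsAlternating φ A ((i, b - φ b • (1 : P)) :: l) := by
        refine ⟨List.isChain_cons.2 ⟨hi, hl.1⟩, fun q hq => ?_⟩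
        rcases List.mem_cons.1 hq with rfl | hq
        · exact ⟨sub_smul_one_mem hb _, hφ.map_sub_smul_one b⟩
        · exact hl.2 q hq
      have h2 := add_mem (prod_mem_alternatingSpan h1)
        (Submodule.smul_mem _ (φ b) (prod_mem_alternatingSpan hl))
      simpa [sub_mul] using h2
    cases l with
    | nil => exact key a ha [] hl (by simp)
    | cons p l =>
      obtain ⟨j, b⟩ := p
      by_cases hij : i = j
      · subst hij
        rw [List.map_cons, List.prod_cons, ← mul_assoc]
        exact key (a * b) (mul_mem ha (hl.2 _ List.mem_cons_self).1) l hl.of_cons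
          (List.isChain_cons.1 hl.1).1
      · exact key a ha _ hl (by simpa using hij)

/-- The span contains `1` and is stable under left multiplication by the generators. -/
theorem alternatingSpan_eq_top (hφ : IsFreeState φ A) : alternatingSpan φ A = ⊤ := by
  rw [eq_top_iff]
  rintro x -
  have hx : x ∈ Algebra.adjoin ℂ (⋃ i, (A i : Set P)) := by rw [hφ.generates]; trivial
  suffices h : ∀ y ∈ alternatingSpan φ A, x * y ∈ alternatingSpan φ A by
    have h1 : (1 : P) ∈ alternatingSpan φ A :=
      prod_mem_alternatingSpan (l := []) ⟨List.isChain_nil, by simp⟩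
    simpa using h 1 h1
  induction hx using Algebra.adjoin_induction with
  | mem x hx =>
    obtain ⟨i, hi⟩ := Set.mem_iUnion.1 hx
    exact fun y hy => hφ.mul_mem_alternatingSpan hi hy
  | algebraMap r =>
    intro y hy
    rw [← Algebra.smul_def]
    exact Submodule.smul_mem _ _ hy
  | add x y _ _ hx hy =>
    intro z hz
    rw [add_mul]
    exact add_mem (hx z hz) (hy z hz)
  | mul x y _ _ hx hy =>
    intro z hz
    rw [mul_assoc]
    exact hx _ (hy z hz)

theorem linear_ext (hφ : IsFreeState φ A) {f g : P →ₗ[ℂ] ℂ}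
    (h : ∀ l, IsAlternating φ A l → f (l.map Prod.snd).prod = g (l.map Prod.snd).prod) :
    f = g := by
  ext x
  have hx : x ∈ alternatingSpan φ A := by rw [hφ.alternatingSpan_eq_top]; trivial
  induction hx using Submodule.span_induction with
  | zero => rw [map_zero, map_zero]
  | add x y _ _ hx hy => rw [map_add, map_add, hx, hy]
  | smul c x _ hx => rw [map_smul, map_smul, hx]
  | mem x hx =>
    obtain ⟨l, hl, rfl⟩ := hx
    exact h l hl

theorem IsAlternating.starReverse (hφ : IsFreeState φ A) {l : List (ι × P)}
    (h : IsAlternating φ A l) :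
    IsAlternating φ A ((l.map fun p => (p.1, star p.2)).reverse) := by
  constructor
  · rw [List.isChain_reverse]
    have := h.1
    rw [List.isChain_map]
    exact this.imp fun p q hpq => hpq.symm
  · intro q hq
    rw [List.mem_reverse, List.mem_map] at hq
    obtain ⟨p, hp, rfl⟩ := hq
    obtain ⟨h1, h2⟩ := h.2 p hp
    exact ⟨star_mem h1, by rw [hφ.map_star _ _ h1, h2, star_zero]⟩

theorem star_prod_map_snd {P ι : Type*} [Ring P] [StarRing P] (l : List (ι × P)) :
    star (l.map Prod.snd).prod = (((l.map fun p => (p.1, star p.2)).reverse).map Prod.snd).prod := by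
  induction l with
  | nil => simp
  | cons p l ih => simp [ih]

/-- A free state is hermitian. -/
theorem apply_star (hφ : IsFreeState φ A) (x : P) : φ (star x) = star (φ x) := by
  have hx : x ∈ alternatingSpan φ A := by rw [hφ.alternatingSpan_eq_top]; trivial
  induction hx using Submodule.span_induction with
  | zero => simp
  | add x y _ _ hx hy => simp [hx, hy]
  | smul c x _ hx => rw [star_smul, map_smul, map_smul, hx]; simp
  | mem x hx =>
    obtain ⟨l, hl, rfl⟩ := hx
    rcases eq_or_ne l [] with rfl | hne
    · simp [hφ.map_one]
    · rw [star_prod_map_snd, hφ.map_prod_eq_zero hl hne,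
        hφ.map_prod_eq_zero (hl.starReverse hφ) (by simpa using hne), star_zero]

/-- If `a` and the first letter belong to the same subalgebra, their product is its centered part
plus a scalar; both give alternating centered products, the second one being non-empty because the
word is not a single letter. -/
theorem map_mul_prod (hφ : IsFreeState φ A) {i : ι} {a : P} (ha : a ∈ A i) (ha0 : φ a = 0)
    {l : List (ι × P)} (hl : IsAlternating φ A l) (hne : ∀ b, l ≠ [(i, b)]) :
    φ (a * (l.map Prod.snd).prod) = 0 := by
  cases l with
  | nil => simpa using ha0
  | cons p l =>
    obtain ⟨j, b⟩ := p
    by_cases hij : i = j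
    · subst hij
      have hb := (hl.2 _ List.mem_cons_self).1
      have hl' : l ≠ [] := fun h => hne b (by rw [h])
      have h1 := hφ.map_prod_eq_zero (hl.replace_head (sub_smul_one_mem (mul_mem ha hb) _)
        (hφ.map_sub_smul_one (a * b))) (by simp)
      rw [List.map_cons, List.prod_cons, sub_mul, smul_mul_assoc, one_mul, map_sub, map_smul,
        hφ.map_prod_eq_zero hl.of_cons hl', smul_zero, sub_zero] at h1
      rw [List.map_cons, List.prod_cons, ← mul_assoc, h1]
    · have h1 : IsAlternating φ A ((i, a) :: (j, b) :: l) := by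
        refine ⟨List.isChain_cons.2 ⟨by simpa using hij, hl.1⟩, fun q hq => ?_⟩
        rcases List.mem_cons.1 hq with rfl | hq
        · exact ⟨ha, ha0⟩
        · exact hl.2 q hq
      exact hφ.map_prod_eq_zero h1 (by simp)

/-- A free state is tracial. -/
theorem apply_mul_comm (hφ : IsFreeState φ A) (x y : P) : φ (x * y) = φ (y * x) := by
  have hy : y ∈ Algebra.adjoin ℂ (⋃ i, (A i : Set P)) := by rw [hφ.generates]; trivial
  induction hy using Algebra.adjoin_induction generalizing x with
  | algebraMap r => rw [Algebra.commutes]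
  | add y z _ _ hy hz => rw [mul_add, add_mul, map_add, map_add, hy, hz]
  | mul y z _ _ hy hz => rw [← mul_assoc, hz, ← mul_assoc, hy, mul_assoc]
  | mem a ha =>
    obtain ⟨i, hi⟩ := Set.mem_iUnion.1 ha
    have hi : a ∈ A i := hi
    have key : ∀ a ∈ A i, φ a = 0 → φ (x * a) = φ (a * x) := by
      intro a hi ha0
      refine LinearMap.congr_fun (hφ.linear_ext (f := φ ∘ₗ LinearMap.mulRight ℂ a)
        (g := φ ∘ₗ LinearMap.mulLeft ℂ a) fun l hl => ?_) x
      simp only [LinearMap.comp_apply, LinearMap.mulRight_apply, LinearMap.mulLeft_apply]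
      -- For a single letter of `A i` traciality on `A i` is used. For any other alternating word
      -- both sides vanish, the left one by applying `map_mul_prod` to the adjoint.
      by_cases h : ∃ b, l = [(i, b)]
      · obtain ⟨b, rfl⟩ := h
        simpa using hφ.mul_comm i b (hl.2 _ List.mem_cons_self).1 a hi
      · push Not at h
        rw [hφ.map_mul_prod hi ha0 hl h]
        have h2 := hφ.map_mul_prod (star_mem hi) (by rw [hφ.map_star i a hi, ha0, star_zero])
          (hl.starReverse hφ) (fun b hb => by
            rw [List.reverse_eq_iff, List.reverse_singleton, List.map_eq_singleton_iff] at hb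
            obtain ⟨⟨j, c⟩, rfl, hb⟩ := hb
            simp only [Prod.mk.injEq] at hb
            exact h c (by rw [hb.1]))
        rw [← star_prod_map_snd, ← star_mul, hφ.apply_star, star_eq_zero] at h2
        exact h2
    have h1 := key _ (sub_smul_one_mem hi (φ a)) (hφ.map_sub_smul_one a)
    rw [mul_sub, sub_mul, map_sub, map_sub, mul_smul_comm, smul_mul_assoc, mul_one, one_mul] at h1
    exact sub_left_injective h1

/-- A Gram matrix is positive semidefinite. -/
theorem posSemidef_of_mem (hφ : IsFreeState φ A) {α : Type*} {i : ι} (f : α → P)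
    (hf : ∀ a, f a ∈ A i) : (Matrix.of fun a b => φ (star (f a) * f b)).PosSemidef := by
  refine ⟨?_, fun c => ?_⟩
  · ext a b
    rw [Matrix.conjTranspose_apply, Matrix.of_apply, Matrix.of_apply,
      ← hφ.map_star i _ (mul_mem (star_mem (hf b)) (hf a)), star_mul, star_star]
  · have h := hφ.nonneg i (c.sum fun a r => r • f a)
      (sum_mem fun a _ => (A i).smul_mem (hf a) _)
    simp only [Finsupp.sum, star_sum, star_smul, Finset.sum_mul, Finset.mul_sum, map_sum,
      smul_mul_assoc, mul_smul_comm, map_smul, smul_eq_mul] at h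
    rw [Finset.sum_comm] at h
    simp only [Finsupp.sum, Matrix.of_apply]
    refine h.trans_eq (Finset.sum_congr rfl fun a _ => Finset.sum_congr rfl fun b _ => ?_)
    ring

theorem posSemidef_vecMulVec_star {α : Type*} (v : α → ℂ) :
    (Matrix.vecMulVec (star v) v).PosSemidef := by
  refine ⟨?_, fun c => ?_⟩
  · ext a b
    simpa [Matrix.vecMulVec_apply] using _root_.mul_comm (v b) _
  · have h := star_mul_self_nonneg (c.sum fun a r => r * v a)
    simp only [Finsupp.sum, star_sum, star_mul, Finset.sum_mul, Finset.mul_sum] at h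
    rw [Finset.sum_comm] at h
    simp only [Finsupp.sum, Matrix.vecMulVec_apply, Pi.star_apply]
    refine h.trans_eq (Finset.sum_congr rfl fun a _ => Finset.sum_congr rfl fun b _ => ?_)
    ring

open Classical in
/-- The first element of the list if it is taken from the subalgebra of index `i`. -/
noncomputable def headAt (A : ι → StarSubalgebra ℂ P) (i : ι) : List (ι × P) → P
  | [] => 0
  | p :: _ => if p.1 = i ∧ p.2 ∈ A i then p.2 else 0

theorem headAt_mem (i : ι) (l : List (ι × P)) : headAt A i l ∈ A i := by
  cases l with
  | nil => exact zero_mem _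
  | cons p l =>
    rw [headAt]
    split_ifs with h
    · exact h.2
    · exact zero_mem _

theorem headAt_cons_self {i : ι} {a : P} (ha : a ∈ A i) (l : List (ι × P)) :
    headAt A i ((i, a) :: l) = a :=
  if_pos ⟨rfl, ha⟩

theorem headAt_cons_of_ne {i j : ι} (h : i ≠ j) (a : P) (l : List (ι × P)) :
    headAt A j ((i, a) :: l) = 0 :=
  if_neg fun h' => h h'.1

/-- The indicator function of the empty list. -/
def nilIndicator (ι P : Type*) : List (ι × P) → ℂ
  | [] => 1
  | _ :: _ => 0

/-- The scalar products of the alternating products of bounded length. -/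
noncomputable def gram (φ : P →ₗ[ℂ] ℂ) (A : ι → StarSubalgebra ℂ P) [Fintype ι] :
    ℕ → Matrix (List (ι × P)) (List (ι × P)) ℂ
  | 0 => Matrix.vecMulVec (star (nilIndicator ι P)) (nilIndicator ι P)
  | N + 1 => Matrix.vecMulVec (star (nilIndicator ι P)) (nilIndicator ι P) +
      ∑ i, Matrix.hadamard (Matrix.of fun l l' => φ (star (headAt A i l) * headAt A i l'))
        ((gram φ A N).submatrix List.tail List.tail)

/-- Each term of the recursion is the Hadamard product of a Gram matrix of first letters and of a
Gram matrix of tails, hence positive semidefinite by Schur's product theorem. -/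
theorem posSemidef_gram [Fintype ι] (hφ : IsFreeState φ A) (N : ℕ) : (gram φ A N).PosSemidef := by
  induction N with
  | zero => exact posSemidef_vecMulVec_star _
  | succ N ih =>
    exact (posSemidef_vecMulVec_star _).add (Matrix.posSemidef_sum _ fun i _ =>
      (hφ.posSemidef_of_mem _ (headAt_mem i)).hadamard (ih.submatrix _))

theorem IsAlternating.starReverse_append (hφ : IsFreeState φ A) {p q : ι × P} {l l' : List (ι × P)}
    (h : IsAlternating φ A (p :: l)) (h' : IsAlternating φ A (q :: l')) (hpq : p.1 ≠ q.1) :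
    IsAlternating φ A (((p :: l).map fun p => (p.1, star p.2)).reverse ++ q :: l') := by
  have h1 := h.starReverse hφ
  refine ⟨List.isChain_append.2 ⟨h1.1, h'.1, ?_⟩, fun r hr => ?_⟩
  · simpa using hpq
  · rcases List.mem_append.1 hr with hr | hr
    · exact h1.2 r hr
    · exact h'.2 r hr

/-- For words $bm$ and $am'$ starting in the same subalgebra,
$\varphi(m^*b^*am')=\varphi(b^*a)\varphi(m^*m')$, because the centered part of $b^*a$ produces an
alternating centered product. Words starting in different subalgebras are orthogonal. A bound on one
of the two lengths suffices, since both words are shortened together. -/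
theorem map_star_prod_mul_prod [Fintype ι] (hφ : IsFreeState φ A) (N : ℕ) {l l' : List (ι × P)}
    (h : IsAlternating φ A l) (h' : IsAlternating φ A l') (hN : l.length ≤ N) :
    φ (star (l.map Prod.snd).prod * (l'.map Prod.snd).prod) = gram φ A N l l' := by
  classical
  induction N generalizing l l' with
  | zero =>
    obtain rfl := List.length_eq_zero_iff.1 (Nat.le_zero.1 hN)
    cases l' with
    | nil => simp [gram, Matrix.vecMulVec_apply, nilIndicator, hφ.map_one]
    | cons q l' =>
      have := hφ.map_prod_eq_zero h' (by simp)
      simpa [gram, Matrix.vecMulVec_apply, nilIndicator] using this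
  | succ N ih =>
    rw [gram, Matrix.add_apply, Matrix.sum_apply]
    simp only [Matrix.hadamard_apply, Matrix.of_apply, Matrix.submatrix_apply,
      Matrix.vecMulVec_apply]
    rcases l with _ | ⟨⟨i, b⟩, m⟩ <;> rcases l' with _ | ⟨⟨j, a⟩, m'⟩
    · simp [headAt, nilIndicator, hφ.map_one]
    · have := hφ.map_prod_eq_zero h' (by simp)
      simpa [headAt, nilIndicator] using this
    · have := hφ.map_prod_eq_zero h (by simp)
      rw [List.map_nil, List.prod_nil, mul_one, hφ.apply_star, this]
      simp [headAt, nilIndicator]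
    · have hb := (h.2 _ List.mem_cons_self).1
      have ha := (h'.2 _ List.mem_cons_self).1
      simp only [nilIndicator, List.tail_cons, mul_zero, zero_add]
      by_cases hij : i = j
      · subst hij
        rw [Finset.sum_eq_single i (fun k _ hk => by
            rw [headAt_cons_of_ne (Ne.symm hk), star_zero, zero_mul, map_zero, zero_mul])
            (fun hi => absurd (Finset.mem_univ i) hi),
          headAt_cons_self hb, headAt_cons_self ha, ← ih h.of_cons h'.of_cons (by simpa using hN)]
        set c := star b * a with hc
        have hcm : c ∈ A i := mul_mem (star_mem hb) ha
        have h1 : φ (star (m.map Prod.snd).prod * ((c - φ c • (1 : P)) * (m'.map Prod.snd).prod)) =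
            0 := by
          have h2 := h'.replace_head (sub_smul_one_mem hcm _) (hφ.map_sub_smul_one c)
          cases m with
          | nil => simpa using hφ.map_prod_eq_zero h2 (by simp)
          | cons p m =>
            have h3 := hφ.map_prod_eq_zero (h.of_cons.starReverse_append hφ h2
              (by simpa using (List.isChain_cons_cons.1 h.1).1.symm)) (by simp)
            rwa [List.map_append, List.prod_append, ← star_prod_map_snd, List.map_cons (l := m'),
              List.prod_cons (l := m'.map Prod.snd)] at h3
        rw [sub_mul, mul_sub, map_sub, smul_mul_assoc, one_mul, mul_smul_comm, map_smul,
          smul_eq_mul, sub_eq_zero] at h1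
        rw [← h1, hc, List.map_cons, List.map_cons, List.prod_cons, List.prod_cons, star_mul]
        simp only [mul_assoc]
      · rw [Finset.sum_eq_zero]
        · have h3 := hφ.map_prod_eq_zero (h.starReverse_append hφ h' hij) (by simp)
          rwa [List.map_append, List.prod_append, ← star_prod_map_snd] at h3
        · intro k _
          by_cases hk : i = k
          · rw [headAt_cons_of_ne (fun e : j = k => hij (hk.trans e.symm)), mul_zero, map_zero,
              zero_mul]
          · rw [headAt_cons_of_ne hk, star_zero, zero_mul, map_zero, zero_mul]

/-- A free state is positive. -/
theorem apply_star_mul_self_nonneg [Fintype ι] (hφ : IsFreeState φ A) (x : P) :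
    0 ≤ φ (star x * x) := by
  have hx : x ∈ Submodule.span ℂ
      (Set.range fun l : {l // IsAlternating φ A l} => (l.1.map Prod.snd).prod) := by
    have hr : (Set.range fun l : {l // IsAlternating φ A l} => (l.1.map Prod.snd).prod) =
        {x | ∃ l, IsAlternating φ A l ∧ x = (l.map Prod.snd).prod} := by
      ext y
      constructor
      · rintro ⟨l, rfl⟩; exact ⟨l.1, l.2, rfl⟩
      · rintro ⟨l, hl, rfl⟩; exact ⟨⟨l, hl⟩, rfl⟩
    have := hφ.alternatingSpan_eq_top
    rw [alternatingSpan, ← hr] at this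
    rw [this]
    trivial
  obtain ⟨c, rfl⟩ := Finsupp.mem_span_range_iff_exists_finsupp.1 hx
  -- Taking `N` as the largest length in the support makes the matrix `gram φ A N` exact on all the
  -- words involved.
  have h := ((hφ.posSemidef_gram (c.support.sup fun l => l.1.length)).submatrix
    (Subtype.val : {l // IsAlternating φ A l} → _)).2 c
  refine h.trans_eq ?_
  simp only [Finsupp.sum, star_sum, star_smul, Finset.sum_mul, Finset.mul_sum, map_sum,
      smul_mul_assoc, mul_smul_comm, map_smul, smul_eq_mul, Matrix.submatrix_apply]
  rw [Finset.sum_comm]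
  refine Finset.sum_congr rfl fun l' _ => Finset.sum_congr rfl fun l hl => ?_
  rw [hφ.map_star_prod_mul_prod _ l.2 l'.2 (Finset.le_sup (f := fun l => l.1.length) hl)]
  ring

end IsFreeState

end FreeState

/-! ### Group algebras as $*$-algebras, and their tracial states -/

section GroupAlgebra

open MonoidAlgebra

namespace MonoidAlgebra

/-- The linear form on a monoid algebra that extends a function. -/
noncomputable def linearForm {G : Type*} (f : G → ℂ) : MonoidAlgebra ℂ G →ₗ[ℂ] ℂ :=
  Finsupp.linearCombination ℂ f ∘ₗ
    ({ toFun := coeff, map_add' := coeff_add, map_smul' := coeff_smul } :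
      MonoidAlgebra ℂ G →ₗ[ℂ] (G →₀ ℂ))

theorem linearForm_single {G : Type*} (f : G → ℂ) (g : G) (c : ℂ) : linearForm f (single g c) = c * f g := by
  simp [linearForm, Finsupp.linearCombination_single]

theorem smul_single_one {G : Type*} (g : G) (c : ℂ) : c • single g (1 : ℂ) = single g c := by
  rw [smul_single, smul_eq_mul, mul_one]

variable {G H : Type*} [Group G] [Group H]

/-- The involution of a group algebra, which inverts the elements of the group. -/
noncomputable instance : Star (MonoidAlgebra ℂ G) :=
  ⟨fun x => mapDomain (·⁻¹) (MonoidAlgebra.map (starRingEnd ℂ : ℂ →+ ℂ) x)⟩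

theorem star_single (g : G) (c : ℂ) : star (single g c) = single g⁻¹ (star c) := by
  change mapDomain (·⁻¹) (MonoidAlgebra.map (starRingEnd ℂ : ℂ →+ ℂ) (single g c)) = _
  rw [map_single, mapDomain_single]
  rfl

theorem star_add' (x y : MonoidAlgebra ℂ G) : star (x + y) = star x + star y := by
  change mapDomain (·⁻¹) (MonoidAlgebra.map (starRingEnd ℂ : ℂ →+ ℂ) (x + y)) = _
  rw [MonoidAlgebra.map_add, mapDomain_add]
  rfl

theorem star_zero' : star (0 : MonoidAlgebra ℂ G) = 0 := by
  simpa using star_single (1 : G) 0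

noncomputable instance : StarRing (MonoidAlgebra ℂ G) where
  star_involutive x := by
    induction x using MonoidAlgebra.induction_linear with
    | zero => rw [star_zero', star_zero']
    | add x y hx hy => rw [star_add', star_add', hx, hy]
    | single g c => rw [star_single, star_single, inv_inv, star_star]
  star_add := star_add'
  star_mul x y := by
    induction x using MonoidAlgebra.induction_linear with
    | zero => rw [zero_mul, star_zero', mul_zero]
    | add x z hx hz => rw [add_mul, star_add', star_add', mul_add, hx, hz]
    | single g c =>
      induction y using MonoidAlgebra.induction_linear with
      | zero => rw [mul_zero, star_zero', zero_mul]
      | add y z hy hz => rw [mul_add, star_add', star_add', add_mul, hy, hz]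
      | single h d =>
        rw [single_mul_single, star_single, star_single, star_single, single_mul_single,
          mul_inv_rev, star_mul]

instance : StarModule ℂ (MonoidAlgebra ℂ G) where
  star_smul r x := by
    induction x using MonoidAlgebra.induction_linear with
    | zero => rw [smul_zero, star_zero, smul_zero]
    | add x y hx hy => rw [smul_add, star_add, star_add, smul_add, hx, hy]
    | single g c =>
      rw [smul_single, star_single, star_single, smul_single, smul_eq_mul, smul_eq_mul, star_mul,
        mul_comm]

/-- The image of the group algebra of `H` in the group algebra of `G`. -/
noncomputable def groupSubalgebra (f : H →* G) : StarSubalgebra ℂ (MonoidAlgebra ℂ G) where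
  toSubalgebra := (mapDomainAlgHom ℂ ℂ f).range
  star_mem' := by
    rintro _ ⟨y, rfl⟩
    refine ⟨star y, ?_⟩
    induction y using MonoidAlgebra.induction_linear with
    | zero => simp
    | add x y hx hy => simp only [star_add, map_add, hx, hy]
    | single h c => simp [star_single]

theorem mem_groupSubalgebra_iff {f : H →* G} {x : MonoidAlgebra ℂ G} :
    x ∈ groupSubalgebra f ↔ x ∈ Submodule.span ℂ (Set.range fun h => single (f h) (1 : ℂ)) := by
  constructor
  · rintro ⟨y, rfl⟩
    induction y using MonoidAlgebra.induction_linear with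
    | zero => simp
    | add x y hx hy =>
      rw [map_add]
      exact add_mem hx hy
    | single h c =>
      have : (mapDomainAlgHom ℂ ℂ f) (single h c) = c • single (f h) (1 : ℂ) := by
        rw [smul_single_one]; simp
      exact this ▸ Submodule.smul_mem _ _ (Submodule.subset_span ⟨h, rfl⟩)
  · intro hx
    induction hx using Submodule.span_induction with
    | mem x hx =>
      obtain ⟨h, rfl⟩ := hx
      exact ⟨single h 1, by simp⟩
    | zero => exact zero_mem _
    | add x y _ _ hx hy => exact add_mem hx hy
    | smul c x _ hx => exact (groupSubalgebra f).smul_mem hx c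

theorem single_mem_groupSubalgebra (f : H →* G) (h : H) (c : ℂ) :
    single (f h) c ∈ groupSubalgebra f := by
  rw [mem_groupSubalgebra_iff, ← smul_single_one]
  exact Submodule.smul_mem _ _ (Submodule.subset_span ⟨h, rfl⟩)

@[elab_as_elim]
theorem groupSubalgebra_induction {f : H →* G}
    {p : (x : MonoidAlgebra ℂ G) → x ∈ groupSubalgebra f → Prop}
    (single : ∀ h c, p (single (f h) c) (single_mem_groupSubalgebra f h c))
    (zero : p 0 (zero_mem _))
    (add : ∀ x y hx hy, p x hx → p y hy → p (x + y) (add_mem hx hy))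
    {x : MonoidAlgebra ℂ G} (hx : x ∈ groupSubalgebra f) : p x hx := by
  obtain ⟨y, rfl⟩ := id hx
  induction y using MonoidAlgebra.induction_linear with
  | zero => simpa using zero
  | add x y ihx ihy =>
    simpa only [map_add] using add _ _ ⟨x, rfl⟩ ⟨y, rfl⟩ (ihx ⟨x, rfl⟩) (ihy ⟨y, rfl⟩)
  | single h c => simpa using single h c

end MonoidAlgebra

variable {G H : Type*} [Group G] [Group H]

/-- A central positive definite function on a group, with value `1` at the neutral element. -/
structure IsTracialCharacter (χ : G → ℂ) : Prop where
  map_one : χ 1 = 1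
  mul_comm : ∀ g h, χ (g * h) = χ (h * g)
  posSemidef : (Matrix.of fun g h => χ (g⁻¹ * h)).PosSemidef

namespace IsTracialCharacter

variable {χ : H → ℂ} {f : H →* G} {φ : MonoidAlgebra ℂ G →ₗ[ℂ] ℂ}

theorem map_inv (hχ : IsTracialCharacter χ) (h : H) : χ h⁻¹ = star (χ h) := by
  have := congr_fun (congr_fun hχ.posSemidef.1 h) 1
  simpa using this.symm

theorem form_mul_comm (hχ : IsTracialCharacter χ) (hφ : ∀ h, φ (single (f h) 1) = χ h)
    {x y : MonoidAlgebra ℂ G} (hx : x ∈ groupSubalgebra f) (hy : y ∈ groupSubalgebra f) :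
    φ (x * y) = φ (y * x) := by
  induction hx using groupSubalgebra_induction with
  | zero => simp
  | add x z _ _ hx hz => rw [add_mul, mul_add, map_add, map_add, hx, hz]
  | single h c =>
    induction hy using groupSubalgebra_induction with
    | zero => simp
    | add x z _ _ hx hz => rw [add_mul, mul_add, map_add, map_add, hx, hz]
    | single h' c' =>
      rw [single_mul_single, single_mul_single, ← map_mul, ← map_mul, ← smul_single_one,
        ← smul_single_one _ (c' * c), map_smul, map_smul, hφ, hφ, hχ.mul_comm, _root_.mul_comm c]

theorem form_star (hχ : IsTracialCharacter χ) (hφ : ∀ h, φ (single (f h) 1) = χ h)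
    {x : MonoidAlgebra ℂ G} (hx : x ∈ groupSubalgebra f) : φ (star x) = star (φ x) := by
  induction hx using groupSubalgebra_induction with
  | zero => simp
  | add x z _ _ hx hz => simp only [star_add, map_add, hx, hz]
  | single h c =>
    rw [star_single, ← smul_single_one, ← smul_single_one _ c, map_smul, map_smul, ← _root_.map_inv f, hφ,
      hφ, hχ.map_inv]
    simp

theorem form_nonneg (hχ : IsTracialCharacter χ) (hφ : ∀ h, φ (single (f h) 1) = χ h)
    {x : MonoidAlgebra ℂ G} (hx : x ∈ groupSubalgebra f) : 0 ≤ φ (star x * x) := by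
  rw [mem_groupSubalgebra_iff] at hx
  obtain ⟨c, rfl⟩ := Finsupp.mem_span_range_iff_exists_finsupp.1 hx
  refine (hχ.posSemidef.2 c).trans_eq ?_
  simp only [Finsupp.sum, star_sum, star_smul, Finset.sum_mul, Finset.mul_sum, map_sum,
    smul_mul_assoc, mul_smul_comm, map_smul, smul_eq_mul, Matrix.of_apply]
  rw [Finset.sum_comm]
  refine Finset.sum_congr rfl fun l' _ => Finset.sum_congr rfl fun l hl => ?_
  rw [star_single, single_mul_single, star_one, mul_one, ← _root_.map_inv, ← map_mul, hφ]
  ring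

end IsTracialCharacter

end GroupAlgebra

/-! ### The free product of states on the group algebra of a free product of groups -/

section FreeProduct

open MonoidAlgebra hiding of
open Monoid Monoid.CoprodI

namespace Monoid.CoprodI.Word

variable {ι : Type*} {G : ι → Type*} [∀ i, Group (G i)] [∀ i, DecidableEq (G i)]

theorem length_rcons_le {i : ι} (p : Pair G i) :
    (rcons p).toList.length ≤ p.tail.toList.length + 1 := by
  rw [rcons]
  split_ifs <;> simp

theorem length_tail_le_rcons {i : ι} (p : Pair G i) :
    p.tail.toList.length ≤ (rcons p).toList.length := by
  rw [rcons]
  split_ifs <;> simp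

theorem length_of_smul_le [DecidableEq ι] {i : ι} (g : G i) (w : Word G) :
    (of g • w).toList.length ≤ w.toList.length + 1 := by
  rw [of_smul_def]
  refine (length_rcons_le _).trans (Nat.succ_le_succ ?_)
  have h := length_tail_le_rcons (equivPair i w)
  rwa [← equivPair_symm, Equiv.symm_apply_apply] at h

end Monoid.CoprodI.Word

namespace FreeProduct

variable {ι : Type*} {G : ι → Type*} [∀ i, Group (G i)] (χ : ∀ i, G i → ℂ)

/-- The product of the centered letters of a word. -/
noncomputable def centeredProd (w : Word G) : MonoidAlgebra ℂ (CoprodI G) :=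
  (w.toList.map fun p => single (of p.2) (1 : ℂ) - χ p.1 p.2 • 1).prod

theorem centeredProd_cons {i : ι} (g : G i) (w : Word G) (h1 : w.fstIdx ≠ some i) (h2 : g ≠ 1) :
    centeredProd χ (Word.cons g w h1 h2) = (single (of g) 1 - χ i g • 1) * centeredProd χ w := by
  simp [centeredProd]

variable (G) in
/-- The span of the words of length less than `n`. -/
noncomputable def lengthLT (n : ℕ) : Submodule ℂ (MonoidAlgebra ℂ (CoprodI G)) :=
  Submodule.span ℂ {x | ∃ w : Word G, w.toList.length < n ∧ x = single w.prod 1}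

theorem single_mem_lengthLT {n : ℕ} {w : Word G} (h : w.toList.length < n) :
    single w.prod 1 ∈ lengthLT G n :=
  Submodule.subset_span ⟨w, h, rfl⟩

theorem lengthLT_mono {m n : ℕ} (h : m ≤ n) : lengthLT G m ≤ lengthLT G n :=
  Submodule.span_mono fun _ ⟨w, hw, e⟩ => ⟨w, hw.trans_le h, e⟩

theorem adjoin_groupSubalgebra_of :
    Algebra.adjoin ℂ (⋃ i, (groupSubalgebra (of : G i →* CoprodI G) :
      Set (MonoidAlgebra ℂ (CoprodI G)))) = ⊤ := by
  rw [eq_top_iff]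
  rintro x -
  induction x using MonoidAlgebra.induction_linear with
  | zero => exact zero_mem _
  | add x y hx hy => exact add_mem hx hy
  | single γ c =>
    rw [← smul_single_one]
    refine Subalgebra.smul_mem _ ?_ c
    induction γ using CoprodI.induction_on with
    | one => exact one_mem _
    | of i g =>
      exact Algebra.subset_adjoin (Set.mem_iUnion.2 ⟨i, single_mem_groupSubalgebra _ g 1⟩)
    | mul x y hx hy =>
      rw [← one_mul (1 : ℂ), ← single_mul_single]
      exact mul_mem hx hy

variable [DecidableEq ι] [∀ i, DecidableEq (G i)]

theorem single_of_mul_mem_lengthLT {n : ℕ} {i : ι} (g : G i) {x : MonoidAlgebra ℂ (CoprodI G)}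
    (hx : x ∈ lengthLT G n) : single (of g) 1 * x ∈ lengthLT G (n + 1) := by
  induction hx using Submodule.span_induction with
  | zero => rw [mul_zero]; exact zero_mem _
  | add x y _ _ hx hy => rw [mul_add]; exact add_mem hx hy
  | smul c x _ hx => rw [mul_smul_comm]; exact Submodule.smul_mem _ _ hx
  | mem x hx =>
    obtain ⟨w, hw, rfl⟩ := hx
    rw [single_mul_single, one_mul, ← Word.prod_smul]
    exact single_mem_lengthLT ((Word.length_of_smul_le g w).trans_lt (Nat.succ_lt_succ hw))

/-- The passage from reduced words to their centered products is unitriangular for the length. A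
linear form can therefore be prescribed on the centered products, by recursion on the length. -/
theorem centeredProd_sub_mem (w : Word G) :
    centeredProd χ w - single w.prod 1 ∈ lengthLT G w.toList.length := by
  induction w using Word.consRecOn with
  | empty => simp [centeredProd, MonoidAlgebra.one_def]
  | cons i g w h1 h2 ih =>
    rw [centeredProd_cons, Word.prod_cons, ← one_mul (1 : ℂ), ← single_mul_single, one_mul,
      sub_mul, sub_sub, add_comm, ← sub_sub, ← mul_sub]
    have h3 : centeredProd χ w ∈ lengthLT G (w.toList.length + 1) := by
      have := add_mem (lengthLT_mono (Nat.le_succ _) ih)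
        (single_mem_lengthLT (Nat.lt_succ_self w.toList.length))
      rwa [sub_add_cancel] at this
    refine sub_mem (single_of_mul_mem_lengthLT g ih) ?_
    rw [smul_mul_assoc, one_mul]
    exact Submodule.smul_mem _ _ h3

/-- An approximation of the free product of the states, correct on the words of length less
than `n`. -/
noncomputable def truncatedState : ℕ → (MonoidAlgebra ℂ (CoprodI G) →ₗ[ℂ] ℂ)
  | 0 => 0
  -- The value at `γ` is solved from the requirement that the centered product of `γ` have
  -- expectation `1` if `γ = 1` and `0` otherwise. The correction only involves shorter words.
  | n + 1 => linearForm fun γ => (if γ = 1 then 1 else 0) -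
      truncatedState n (centeredProd χ (Word.equiv γ) - single γ 1)

theorem truncatedState_succ (n : ℕ) (w : Word G) :
    truncatedState χ (n + 1) (single w.prod 1) = (if w.prod = 1 then 1 else 0) -
      truncatedState χ n (centeredProd χ w - single w.prod 1) := by
  have : Word.equiv w.prod = w := Word.equiv.apply_symm_apply w
  rw [truncatedState, linearForm_single, this, one_mul]

/-- The approximations stabilize: on words of length less than `k`, all those of rank at least `k`
agree. -/
theorem truncatedState_eq (m n k : ℕ) (hm : k ≤ m) (hn : k ≤ n)
    {x : MonoidAlgebra ℂ (CoprodI G)} (hx : x ∈ lengthLT G k) :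
    truncatedState χ m x = truncatedState χ n x := by
  induction m generalizing n k x with
  | zero =>
    obtain rfl : k = 0 := Nat.le_zero.1 hm
    have : lengthLT G 0 = ⊥ := by simp [lengthLT]
    rw [this, Submodule.mem_bot] at hx
    rw [hx, map_zero, map_zero]
  | succ m ih =>
    induction hx using Submodule.span_induction with
    | zero => rw [map_zero, map_zero]
    | add x y _ _ hx hy => rw [map_add, map_add, hx, hy]
    | smul c x _ hx => rw [map_smul, map_smul, hx]
    | mem x hx =>
      obtain ⟨w, hw, rfl⟩ := hx
      obtain ⟨n, rfl⟩ : ∃ n', n = n' + 1 := ⟨n - 1, by omega⟩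
      rw [truncatedState_succ, truncatedState_succ,
        ih n w.toList.length (by omega) (by omega) (centeredProd_sub_mem χ w)]

/-- The free product of the states defined by the functions `χ i`. -/
noncomputable def freeState : MonoidAlgebra ℂ (CoprodI G) →ₗ[ℂ] ℂ :=
  linearForm fun γ => truncatedState χ ((Word.equiv γ).toList.length + 1) (single γ 1)

theorem freeState_single (w : Word G) : freeState χ (single w.prod 1) =
    truncatedState χ (w.toList.length + 1) (single w.prod 1) := by
  have : Word.equiv w.prod = w := Word.equiv.apply_symm_apply w
  rw [freeState, linearForm_single, this, one_mul]

theorem freeState_eq {n : ℕ} {x : MonoidAlgebra ℂ (CoprodI G)} (hx : x ∈ lengthLT G n) :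
    freeState χ x = truncatedState χ n x := by
  induction hx using Submodule.span_induction with
  | zero => rw [map_zero, map_zero]
  | add x y _ _ hx hy => rw [map_add, map_add, hx, hy]
  | smul c x _ hx => rw [map_smul, map_smul, hx]
  | mem x hx =>
    obtain ⟨w, hw, rfl⟩ := hx
    rw [freeState_single]
    exact truncatedState_eq χ _ _ _ le_rfl hw (single_mem_lengthLT (Nat.lt_succ_self _))

theorem freeState_centeredProd (w : Word G) :
    freeState χ (centeredProd χ w) = if w.prod = 1 then 1 else 0 := by
  have h := freeState_eq χ (centeredProd_sub_mem χ w)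
  rw [map_sub, freeState_single, truncatedState_succ, sub_eq_iff_eq_add] at h
  rw [h]
  ring

theorem freeState_centeredProd_of_ne {w : Word G} (hw : w.toList ≠ []) :
    freeState χ (centeredProd χ w) = 0 := by
  rw [freeState_centeredProd, if_neg]
  intro h
  have h1 : w = Word.empty := Word.equiv.symm.injective (h.trans Word.prod_empty.symm)
  exact hw (by rw [h1]; rfl)

theorem freeState_one : freeState χ 1 = 1 := by
  simpa [centeredProd] using freeState_centeredProd χ Word.empty

theorem freeState_single_of {χ : ∀ i, G i → ℂ} (hχ : ∀ i, χ i 1 = 1) {i : ι} (g : G i) :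
    freeState χ (single (of g) 1) = χ i g := by
  by_cases hg : g = 1
  · rw [hg, map_one, ← MonoidAlgebra.one_def, freeState_one, hχ]
  · have h := freeState_centeredProd_of_ne χ
      (w := Word.cons g Word.empty (by simp [Word.fstIdx]) hg) (by simp)
    rw [centeredProd_cons] at h
    simpa [centeredProd, freeState_one, sub_eq_zero] using h

theorem sub_mem_span_centered {χ : ∀ i, G i → ℂ} (hχ : ∀ i, χ i 1 = 1) {i : ι}
    {x : MonoidAlgebra ℂ (CoprodI G)} (hx : x ∈ groupSubalgebra (of : G i →* CoprodI G)) :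
    x - freeState χ x • 1 ∈ Submodule.span ℂ
      {y | ∃ g : G i, g ≠ 1 ∧ y = single (of g) (1 : ℂ) - χ i g • 1} := by
  induction hx using groupSubalgebra_induction with
  | zero => simp
  | add x y _ _ hx hy =>
    have := add_mem hx hy
    rwa [sub_add_sub_comm, ← add_smul, ← map_add] at this
  | single g c =>
    rw [← smul_single_one, map_smul, freeState_single_of hχ, smul_assoc, ← smul_sub]
    refine Submodule.smul_mem _ _ ?_
    by_cases hg : g = 1
    · rw [hg, hχ, one_smul, map_one, ← MonoidAlgebra.one_def, sub_self]
      exact zero_mem _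
    · exact Submodule.subset_span ⟨g, hg, rfl⟩

/-- Each factor is a combination of centered non-trivial letters of the same index. Keeping track of
the indices ensures that the words remain reduced, and that they are non-empty when `l` is. -/
theorem prod_mem_span_centeredProd {χ : ∀ i, G i → ℂ} (hχ : ∀ i, χ i 1 = 1)
    (l : List (ι × MonoidAlgebra ℂ (CoprodI G))) (hl : l.IsChain fun p q => p.1 ≠ q.1)
    (h : ∀ p ∈ l, p.2 ∈ groupSubalgebra (of : G p.1 →* CoprodI G) ∧ freeState χ p.2 = 0) :
    (l.map Prod.snd).prod ∈ Submodule.span ℂ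
      {x | ∃ w : Word G, w.toList.map Sigma.fst = l.map Prod.fst ∧ x = centeredProd χ w} := by
  induction l with
  | nil => exact Submodule.subset_span ⟨Word.empty, by simp, by simp [centeredProd]⟩
  | cons p l ih =>
    obtain ⟨i, x⟩ := p
    have hx := h _ List.mem_cons_self
    have h1 := sub_mem_span_centered hχ hx.1
    rw [hx.2, zero_smul, sub_zero] at h1
    have h2 := Submodule.mul_mem_mul h1
      (ih (List.isChain_cons.1 hl).2 fun p hp => h p (List.mem_cons_of_mem _ hp))
    rw [Submodule.span_mul_span] at h2
    simp only [List.map_cons, List.prod_cons]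
    refine Submodule.span_mono ?_ h2
    rintro _ ⟨_, ⟨g, hg, rfl⟩, _, ⟨w, hw, rfl⟩, rfl⟩
    have hi : w.fstIdx ≠ some i := by
      have : w.fstIdx = l.head?.map Prod.fst := by
        rw [Word.fstIdx, ← List.head?_map, hw, List.head?_map]
      rw [this]
      intro h'
      obtain ⟨q, hq, hq'⟩ := Option.map_eq_some_iff.1 h'
      exact (List.isChain_cons.1 hl).1 q hq hq'.symm
    exact ⟨Word.cons g w hi hg, by simp [hw], by rw [centeredProd_cons]⟩

theorem freeState_prod_eq_zero {χ : ∀ i, G i → ℂ} (hχ : ∀ i, χ i 1 = 1)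
    (l : List (ι × MonoidAlgebra ℂ (CoprodI G))) (hne : l ≠ [])
    (hl : l.IsChain fun p q => p.1 ≠ q.1)
    (h : ∀ p ∈ l, p.2 ∈ groupSubalgebra (of : G p.1 →* CoprodI G) ∧ freeState χ p.2 = 0) :
    freeState χ (l.map Prod.snd).prod = 0 := by
  have h1 : Submodule.span ℂ
      {x | ∃ w : Word G, w.toList.map Sigma.fst = l.map Prod.fst ∧ x = centeredProd χ w} ≤
      LinearMap.ker (freeState χ) := by
    rw [Submodule.span_le]
    rintro _ ⟨w, hw, rfl⟩
    refine freeState_centeredProd_of_ne χ fun h0 => hne ?_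
    rw [h0] at hw
    simpa using hw.symm
  exact h1 (prod_mem_span_centeredProd hχ l hl h)

theorem isFreeState {χ : ∀ i, G i → ℂ} (hχ : ∀ i, IsTracialCharacter (χ i)) :
    IsFreeState (freeState χ) fun i => groupSubalgebra (of : G i →* CoprodI G) where
  map_one := freeState_one χ
  free := freeState_prod_eq_zero fun i => (hχ i).map_one
  generates := adjoin_groupSubalgebra_of
  mul_comm i _ hx _ hy :=
    (hχ i).form_mul_comm (freeState_single_of fun i => (hχ i).map_one) hx hy
  map_star i _ hx := (hχ i).form_star (freeState_single_of fun i => (hχ i).map_one) hx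
  nonneg i _ hx := (hχ i).form_nonneg (freeState_single_of fun i => (hχ i).map_one) hx

end FreeProduct

end FreeProduct

/-! ### Lagrange inversion and the moment series of $\nu_t$ -/

section LagrangeInversion

open PowerSeries Finset

namespace PowerSeries

/-- Since `g` has no constant term, $g^N$ is divisible by $X^N$, so the composition may be truncated
at order `N`. -/
theorem coeff_subst_mul {g : ℝ⟦X⟧} (hg : constantCoeff g = 0) (h u : ℝ⟦X⟧) {n N : ℕ}
    (hn : n < N) :
    coeff n (h.subst g * u) = ∑ k ∈ range N, coeff k h * coeff n (g ^ k * u) := by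
  have hs : HasSubst g := HasSubst.of_constantCoeff_zero' hg
  have h1 : h.subst g = g ^ N * (mk fun i => coeff (i + N) h).subst g +
      ∑ k ∈ range N, coeff k h • g ^ k := by
    conv_lhs => rw [eq_X_pow_mul_shift_add_trunc N h]
    rw [subst_add hs, subst_mul hs, subst_pow hs, subst_X hs, subst_coe hs, trunc_apply,
      range_eq_Ico, map_sum]
    simp [Polynomial.aeval_monomial, Algebra.smul_def]
  have h2 : X ^ N ∣ g ^ N * (mk fun i => coeff (i + N) h).subst g * u :=
    ((pow_dvd_pow_of_dvd (X_dvd_iff.2 hg) N).mul_right _).mul_right _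
  rw [h1, add_mul, map_add, X_pow_dvd_iff.1 h2 n hn, zero_add, sum_mul, map_sum]
  simp only [smul_mul_assoc, coeff_smul, smul_eq_mul]

theorem coeff_pow_mul_eq_zero {g : ℝ⟦X⟧} (hg : constantCoeff g = 0) (u : ℝ⟦X⟧) {n N : ℕ}
    (hn : n < N) : coeff n (g ^ N * u) = 0 :=
  X_pow_dvd_iff.1 ((pow_dvd_pow_of_dvd (X_dvd_iff.2 hg) N).mul_right u) n hn

/-- Lagrange inversion. -/
theorem exists_eq_X_mul_subst {f : ℝ⟦X⟧} (hf : constantCoeff f ≠ 0) :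
    ∃ ψ : ℝ⟦X⟧, constantCoeff ψ = 0 ∧ ψ = X * f.subst ψ ∧
      ∀ n : ℕ, (n + 1 : ℝ) * coeff (n + 1) ψ = coeff n (f ^ (n + 1)) := by
  have hff : f * f⁻¹ = 1 := PowerSeries.mul_inv_cancel f hf
  -- The solution is the compositional inverse of $g=X/f$.
  set g : ℝ⟦X⟧ := X * f⁻¹ with hg
  have hg0 : constantCoeff g = 0 := by simp [hg]
  have hg1 : IsUnit (coeff 1 g) := by
    have : coeff 1 g = (constantCoeff f)⁻¹ := by
      rw [hg, ← zero_add 1, coeff_succ_X_mul]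
      simp
    rw [this]
    exact (isUnit_iff_ne_zero.2 hf).inv
  set ψ := g.substInvOfIsUnit hg1 with hψ
  have hψ0 : constantCoeff ψ = 0 := constantCoeff_substInvOfIsUnit g hg1
  have hψs : HasSubst ψ := HasSubst.of_constantCoeff_zero' hψ0
  have hgs : HasSubst g := HasSubst.of_constantCoeff_zero' hg0
  have hr : g.subst ψ = X := subst_substInvOfIsUnit_right g hg0 hg1
  have hl : ψ.subst g = X := subst_substInvOfIsUnit_left g hg0 hg1
  refine ⟨ψ, hψ0, ?_, fun n => ?_⟩
  · have hgf : g * f = X := by rw [hg, mul_assoc, mul_comm f⁻¹, hff, mul_one]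
    have := congr_arg (fun a : ℝ⟦X⟧ => a.subst ψ) hgf
    simp only [subst_mul hψs, subst_X hψs, hr] at this
    exact this.symm
  · have hd := derivative_subst (f := ψ) hgs
    rw [hl, derivative_X] at hd
    have hgd : d⁄dX ℝ g = f⁻¹ - X * f⁻¹ ^ 2 * d⁄dX ℝ f := by
      rw [hg, Derivation.leibniz, derivative_X, derivative_inv', smul_eq_mul, smul_eq_mul]
      ring
    -- From $\psi\circ g=X$ one gets $(\psi'\circ g)\,g'=1$. The coefficient of order $n$ of the
    -- right-hand side is then extracted term by term in the expansion of $\psi'\circ g$ in powers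
    -- of $g$: only $g^n$ contributes.
    have h1 : f ^ (n + 1) = (d⁄dX ℝ ψ).subst g * (d⁄dX ℝ g * f ^ (n + 1)) := by
      rw [← mul_assoc, ← hd, one_mul]
    have hpow : ∀ k r : ℕ, f⁻¹ ^ k * f ^ (k + r) = f ^ r := fun k r => by
      rw [pow_add, ← mul_assoc, ← mul_pow, mul_comm f⁻¹, hff, one_pow, one_mul]
    -- With $n=k+r+1$, the series is $X^k(f^{r+1}-Xf^rf')$. Its coefficient of order $n$ vanishes
    -- since $(f^{r+1})'=(r+1)f^rf'$.
    have hterm : ∀ k < n, coeff n (g ^ k * (d⁄dX ℝ g * f ^ (n + 1))) = 0 := by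
      intro k hk
      obtain ⟨r, rfl⟩ : ∃ r, n = k + (r + 1) := ⟨n - k - 1, by omega⟩
      have e : g ^ k * (d⁄dX ℝ g * f ^ (k + (r + 1) + 1)) =
          X ^ k * (f ^ (r + 1) - X * (f ^ r * d⁄dX ℝ f)) := by
        have e1 := hpow (k + 1) (r + 1)
        have e2 := hpow (k + 2) r
        rw [show k + (r + 1) + 1 = k + 1 + (r + 1) by ring, hgd, hg]
        rw [show k + 2 + r = k + 1 + (r + 1) by ring] at e2
        rw [← e1, ← e2]
        ring
      rw [e, add_comm k, coeff_X_pow_mul, map_sub, coeff_succ_X_mul]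
      have h3 := coeff_derivative (f ^ (r + 1)) r
      rw [derivative_pow] at h3
      have h4 : coeff r (((r + 1 : ℕ) : ℝ⟦X⟧) * f ^ (r + 1 - 1) * d⁄dX ℝ f) =
          (r + 1 : ℝ) * coeff r (f ^ r * d⁄dX ℝ f) := by
        rw [Nat.add_sub_cancel, mul_assoc, ← nsmul_eq_mul, map_nsmul, nsmul_eq_mul]
        push_cast
        rfl
      rw [h4, mul_comm] at h3
      have h5 : (r + 1 : ℝ) ≠ 0 := by positivity
      rw [mul_right_cancel₀ h5 h3, sub_self]
    have hlast : coeff n (g ^ n * (d⁄dX ℝ g * f ^ (n + 1))) = 1 := by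
      have e : g ^ n * (d⁄dX ℝ g * f ^ (n + 1)) = X ^ n * (1 - X * (f⁻¹ * d⁄dX ℝ f)) := by
        have e1 := hpow (n + 1) 0
        rw [add_zero, pow_zero] at e1
        rw [hgd, hg]
        linear_combination (X ^ n - X ^ n * X * f⁻¹ * d⁄dX ℝ f) * e1
      have := coeff_X_pow_mul (1 - X * (f⁻¹ * d⁄dX ℝ f)) n 0
      rw [zero_add] at this
      rw [e, this]
      simp
    rw [h1, coeff_subst_mul hg0 _ _ (Nat.lt_succ_self n), sum_range_succ, hlast, mul_one,
      sum_eq_zero (fun k hk => by rw [hterm k (mem_range.1 hk), mul_zero]), zero_add,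
      coeff_derivative, mul_comm]

end PowerSeries

/-- The generating series of the moments of a free unitary Brownian motion. -/
theorem exists_momentSeries (t : ℝ≥0∞) (ht : t ≠ ⊤) :
    ∃ ψ : ℝ⟦X⟧, constantCoeff ψ = 0 ∧
      ψ = X * (C (Real.exp (-(t.toReal / 2))) *
        (rescale (-t.toReal) (exp ℝ)).subst ψ) * (1 + ψ) ∧
      ∀ n : ℕ, coeff (n + 1) ψ = fubmMoment t (n + 1) := by
  set s := t.toReal
  set f : ℝ⟦X⟧ := C (Real.exp (-(s / 2))) * rescale (-s) (exp ℝ) * (1 + X) with hf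
  have hf0 : constantCoeff f ≠ 0 := by
    have : constantCoeff (rescale (-s) (exp ℝ)) = 1 := by
      rw [← coeff_zero_eq_constantCoeff_apply, coeff_rescale]
      simp
    rw [hf, map_mul, map_mul, this]
    simp
  -- Here $f=e^{-s/2}e^{-sX}(1+X)$. The explicit sum defining the moments is the coefficient of
  -- order $n$ of $f^{n+1}$, divided by $n+1$.
  obtain ⟨ψ, h0, h1, h2⟩ := exists_eq_X_mul_subst hf0
  have hs : HasSubst ψ := HasSubst.of_constantCoeff_zero' h0
  refine ⟨ψ, h0, ?_, fun n => ?_⟩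
  · conv_lhs => rw [h1, hf]
    have e1 : subst ψ (1 : ℝ⟦X⟧) = 1 := by rw [← coe_substAlgHom hs, map_one]
    have e2 : subst ψ (C (Real.exp (-(s / 2))) : ℝ⟦X⟧) = C (Real.exp (-(s / 2))) := subst_C _
    rw [subst_mul hs, subst_mul hs, subst_add hs, subst_X hs, e1, e2]
    ring
  · have h3 : (n + 1 : ℝ) ≠ 0 := by positivity
    apply mul_left_cancel₀ h3
    rw [h2, hf, mul_pow, mul_pow, fubmMoment, if_neg (Nat.succ_ne_zero n), if_neg ht]
    have e1 : C (Real.exp (-(s / 2))) ^ (n + 1) =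
        (C (Real.exp (-((n + 1 : ℕ) * s / 2))) : ℝ⟦X⟧) := by
      rw [← map_pow, ← Real.exp_nat_mul]
      congr 2
      ring
    have e2 : (rescale (-s)) (exp ℝ) ^ (n + 1) = rescale (-s * (n + 1 : ℕ)) (exp ℝ) := by
      rw [← map_pow, exp_pow_eq_rescale_exp, rescale_rescale, mul_comm]
    have e3 : (1 + X : ℝ⟦X⟧) ^ (n + 1) =
        (((1 + Polynomial.X) ^ (n + 1) : Polynomial ℝ) : ℝ⟦X⟧) := by
      simp
    rw [e1, e2, mul_assoc, coeff_C_mul, coeff_mul, Nat.sum_antidiagonal_eq_sum_range_succ_mk,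
      ← mul_assoc, mul_comm (n + 1 : ℝ), mul_assoc, mul_sum (range (n + 1)) _ (n + 1 : ℝ)]
    refine congr_arg₂ _ rfl (sum_congr rfl fun j hj => ?_)
    rw [mem_range] at hj
    rw [coeff_rescale, coeff_exp, e3, Polynomial.coeff_coe, Polynomial.coeff_one_add_X_pow,
      zpow_sub_one₀ (by positivity), zpow_natCast,
      Nat.choose_symm_of_eq_add (show n + 1 = (n - j) + (j + 1) by omega), mul_pow]
    push_cast
    field_simp
    exact mul_comm _ _

end LagrangeInversion

/-! ### Positive real part of the moment series -/

section Contraction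

open PowerSeries Finset

/-- The scalar product of the first `N` coefficients. -/
noncomputable def truncInner (N : ℕ) (a b : ℝ⟦X⟧) : ℝ := ∑ n ∈ range N, coeff n a * coeff n b

/-- The curve $Q(s)=e^{-s(1/2+\psi)}\xi$ satisfies $Q'=-(1/2+\psi)Q$, so its truncated squared norm
has derivative $-2\langle(1/2+\psi)Q,Q\rangle\le0$. -/
theorem truncInner_exp_le {N : ℕ} {ψ : ℝ⟦X⟧} (h0 : constantCoeff ψ = 0)
    (h : ∀ ξ, 0 ≤ truncInner N ((C (1 / 2) + ψ) * ξ) ξ) {t : ℝ} (ht : 0 ≤ t) (ξ : ℝ⟦X⟧) :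
    truncInner N (C (Real.exp (-(t / 2))) * (rescale (-t) (exp ℝ)).subst ψ * ξ)
      (C (Real.exp (-(t / 2))) * (rescale (-t) (exp ℝ)).subst ψ * ξ) ≤ truncInner N ξ ξ := by
  set Q : ℝ → ℝ⟦X⟧ := fun s =>
    C (Real.exp (-(s / 2))) * (rescale (-s) (exp ℝ)).subst ψ * ξ with hQ
  -- One term more than necessary is kept: differentiation lowers the powers of $s$ by one, and the
  -- term left over when comparing with $\psi Q$ contains $\psi^{N+1}$, which vanishes at orders
  -- below $N$.
  have hcoeff : ∀ n < N, ∀ s u, coeff n (C (Real.exp (-(s / 2))) *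
      (rescale (-s) (exp ℝ)).subst ψ * u) =
      Real.exp (-(s / 2)) * ∑ k ∈ range (N + 1), (-s) ^ k / (k.factorial : ℝ) *
        coeff n (ψ ^ k * u) := by
    intro n hn s u
    rw [mul_assoc, coeff_C_mul, coeff_subst_mul h0 _ _ (show n < N + 1 by omega)]
    simp [coeff_rescale, coeff_exp, div_eq_mul_inv]
  have hderiv : ∀ n < N, ∀ s, HasDerivAt (fun s => coeff n (Q s))
      (-coeff n ((C (1 / 2) + ψ) * Q s)) s := by
    intro n hn s
    have e1 : (fun s => coeff n (Q s)) = fun s => Real.exp (-(s / 2)) *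
        ((∑ k ∈ range N, (-s) ^ (k + 1) / ((k + 1).factorial : ℝ) * coeff n (ψ ^ (k + 1) * ξ)) +
          coeff n ξ) := by
      ext s
      rw [hQ, hcoeff n hn, sum_range_succ']
      simp
    have e2 : coeff n ((C (1 / 2) + ψ) * Q s) = 1 / 2 * coeff n (Q s) +
        Real.exp (-(s / 2)) * ∑ k ∈ range N, (-s) ^ k / (k.factorial : ℝ) *
          coeff n (ψ ^ (k + 1) * ξ) := by
      have : ψ * Q s = C (Real.exp (-(s / 2))) * (rescale (-s) (exp ℝ)).subst ψ * (ψ * ξ) := by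
        rw [hQ]; ring
      rw [add_mul, map_add, coeff_C_mul, this, hcoeff n hn s (ψ * ξ), sum_range_succ]
      have hk : ∀ k, ψ ^ k * (ψ * ξ) = ψ ^ (k + 1) * ξ := fun k => by ring
      simp only [hk]
      rw [coeff_pow_mul_eq_zero h0 ξ (show n < N + 1 by omega), mul_zero, add_zero]
    have d1 : HasDerivAt (fun s : ℝ => Real.exp (-(s / 2))) (Real.exp (-(s / 2)) * (-(1 / 2))) s :=
      (((hasDerivAt_id s).div_const 2).neg).exp
    have d2 : HasDerivAt (fun s : ℝ => (∑ k ∈ range N, (-s) ^ (k + 1) / ((k + 1).factorial : ℝ) *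
        coeff n (ψ ^ (k + 1) * ξ)) + coeff n ξ)
        (∑ k ∈ range N, -((-s) ^ k / (k.factorial : ℝ) * coeff n (ψ ^ (k + 1) * ξ))) s := by
      refine (HasDerivAt.fun_sum fun k _ => ?_).add_const _
      have d3 := ((((hasDerivAt_id s).neg).pow (k + 1)).div_const
        ((k + 1).factorial : ℝ)).mul_const (coeff n (ψ ^ (k + 1) * ξ))
      refine d3.congr_deriv ?_
      rw [Nat.factorial_succ]
      push_cast
      have : (k + 1 : ℝ) ≠ 0 := by positivity
      field_simp
      simp [mul_comm]
    rw [e1, e2]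
    refine (d1.mul d2).congr_deriv ?_
    rw [congr_fun e1 s, sum_neg_distrib]
    ring
  have hF : ∀ s, HasDerivAt (fun s => truncInner N (Q s) (Q s))
      (-(2 * truncInner N ((C (1 / 2) + ψ) * Q s) (Q s))) s := by
    intro s
    have := HasDerivAt.fun_sum (u := range N) fun n hn =>
      (hderiv n (mem_range.1 hn) s).mul (hderiv n (mem_range.1 hn) s)
    refine this.congr_deriv ?_
    rw [truncInner, mul_sum, ← sum_neg_distrib]
    exact sum_congr rfl fun n _ => by ring
  have hanti : Antitone fun s => truncInner N (Q s) (Q s) :=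
    antitone_of_hasDerivAt_nonpos hF fun s => by
      have := h (Q s)
      simp only [Pi.zero_apply]
      linarith
  have h1 := hanti ht
  have h2 : truncInner N (Q 0) (Q 0) = truncInner N ξ ξ := by
    refine sum_congr rfl fun n hn => ?_
    have : coeff n (Q 0) = coeff n ξ := by
      rw [hQ, hcoeff n (mem_range.1 hn), sum_range_succ']
      simp
    rw [this]
  exact h1.trans_eq h2

theorem truncInner_X_mul (N : ℕ) (a : ℝ⟦X⟧) :
    truncInner (N + 1) (X * a) (X * a) = truncInner N a a := by
  rw [truncInner, sum_range_succ']
  simp [coeff_succ_X_mul, truncInner]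

theorem truncInner_le_succ (N : ℕ) (a : ℝ⟦X⟧) : truncInner N a a ≤ truncInner (N + 1) a a := by
  rw [truncInner, truncInner, sum_range_succ]
  exact le_add_of_nonneg_right (mul_self_nonneg _)

/-- A power series with nonnegative real part. -/
theorem truncInner_nonneg {ψ : ℝ⟦X⟧} (h0 : constantCoeff ψ = 0) {t : ℝ} (ht : 0 ≤ t)
    (h : ψ = X * (C (Real.exp (-(t / 2))) * (rescale (-t) (exp ℝ)).subst ψ) * (1 + ψ)) (N : ℕ)
    (ξ : ℝ⟦X⟧) : 0 ≤ truncInner N ((C (1 / 2) + ψ) * ξ) ξ := by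
  induction N generalizing ξ with
  | zero => simp [truncInner]
  | succ N ih =>
    set E := C (Real.exp (-(t / 2))) * (rescale (-t) (exp ℝ)).subst ψ with hE
    set η := (1 + ψ) * ξ with hη
    -- Multiplication by `X` shifts the coefficients, so truncation at `N + 1` only sees `E * η` up
    -- to order `N`, where the induction hypothesis makes `E` a contraction.
    have h1 : truncInner (N + 1) (X * (E * η)) (X * (E * η)) ≤ truncInner (N + 1) η η := by
      rw [truncInner_X_mul]
      exact (truncInner_exp_le h0 ih ht η).trans (truncInner_le_succ N η)
    have h2 : ψ * ξ = X * (E * η) := by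
      conv_lhs => rw [h]
      rw [hη]; ring
    set κ := X * (E * η)
    have h3 : ξ = η - κ := by rw [← h2, hη]; ring
    -- This is the Cayley transform: $\xi=\eta-\kappa$ and $(1/2+\psi)\xi=(\eta+\kappa)/2$, so the
    -- quadratic form is $(|\eta|^2-|\kappa|^2)/2$.
    have h4 : (C (1 / 2) + ψ) * ξ = C (1 / 2) * (η + κ) := by
      have : (C (1 / 2) + C (1 / 2) : ℝ⟦X⟧) = 1 := by rw [← map_add]; norm_num
      rw [add_mul, h2, h3]
      linear_combination -κ * this
    have h5 : truncInner (N + 1) ((C (1 / 2) + ψ) * ξ) ξ =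
        1 / 2 * (truncInner (N + 1) η η - truncInner (N + 1) κ κ) := by
      rw [h4]
      conv_lhs => rw [h3]
      simp only [truncInner]
      rw [← sum_sub_distrib, mul_sum]
      refine sum_congr rfl fun n _ => ?_
      rw [coeff_C_mul, map_add, map_sub]
      ring
    rw [h5]
    linarith

/-- The quadratic form of the Toeplitz matrix of the moments. -/
theorem sum_toeplitz_eq (m : ℕ → ℝ) (hm : m 0 = 1) {ψ : ℝ⟦X⟧} (h0 : constantCoeff ψ = 0)
    (h : ∀ n, coeff (n + 1) ψ = m (n + 1)) (ξ : ℝ⟦X⟧) (N : ℕ) :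
    ∑ i ∈ range N, ∑ j ∈ range N, m (Nat.dist i j) * coeff i ξ * coeff j ξ =
      2 * truncInner N ((C (1 / 2) + ψ) * ξ) ξ := by
  induction N with
  | zero => simp [truncInner]
  | succ N ih =>
    have h1 : coeff N (ψ * ξ) = ∑ i ∈ range N, m (Nat.dist i N) * coeff i ξ := by
      rw [mul_comm, coeff_mul, Nat.sum_antidiagonal_eq_sum_range_succ_mk, sum_range_succ,
        Nat.sub_self, coeff_zero_eq_constantCoeff_apply, h0, mul_zero, add_zero]
      refine sum_congr rfl fun i hi => ?_
      have hi := mem_range.1 hi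
      obtain ⟨k, hk⟩ : ∃ k, N - i = k + 1 := ⟨N - i - 1, by omega⟩
      rw [Nat.dist_eq_sub_of_le hi.le, hk, h, mul_comm]
    have h2 : ∑ j ∈ range N, m (Nat.dist N j) * coeff N ξ * coeff j ξ =
        coeff N (ψ * ξ) * coeff N ξ := by
      rw [h1, sum_mul]
      exact sum_congr rfl fun j _ => by rw [Nat.dist_comm]; ring
    have h3 : ∑ i ∈ range N, m (Nat.dist i N) * coeff i ξ * coeff N ξ =
        coeff N (ψ * ξ) * coeff N ξ := by
      rw [h1, sum_mul]
    have h4 : truncInner (N + 1) ((C (1 / 2) + ψ) * ξ) ξ =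
        truncInner N ((C (1 / 2) + ψ) * ξ) ξ + coeff N ((C (1 / 2) + ψ) * ξ) * coeff N ξ :=
      sum_range_succ _ _
    simp only [sum_range_succ, sum_add_distrib]
    rw [ih, h2, h3, h4, add_mul, map_add, coeff_C_mul, Nat.dist_self, hm]
    ring

end Contraction

/-! ### Positive definite functions on groups -/

section PositiveDefinite

open Finset

/-- The form at a complex vector is the sum of its values at the real and imaginary parts; the cross
terms cancel by symmetry. -/
theorem Matrix.posSemidef_of_real {m : ℕ → ℕ → ℝ} (hsymm : ∀ i j, m i j = m j i)
    (h : ∀ (N : ℕ) (x : ℕ → ℝ), 0 ≤ ∑ i ∈ range N, ∑ j ∈ range N, m i j * x i * x j) :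
    (Matrix.of fun i j => (m i j : ℂ)).PosSemidef := by
  refine ⟨?_, fun c => ?_⟩
  · ext i j
    simp [hsymm i j]
  · obtain ⟨N, hN⟩ : ∃ N, c.support ⊆ range N := c.support.exists_nat_subset_range
    have e1 : ∀ z : ℂ, ∀ a : ℕ → ℂ, (c.sum fun j xj => z * a j * xj) =
        ∑ j ∈ range N, z * a j * c j := fun z a => by
      rw [Finsupp.sum_of_support_subset _ hN _ (by simp)]
    simp only [Matrix.of_apply, e1]
    rw [Finsupp.sum_of_support_subset _ hN _ (by simp), Complex.nonneg_iff]
    constructor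
    · have := add_nonneg (h N fun i => (c i).re) (h N fun i => (c i).im)
      refine this.trans_eq ?_
      rw [← sum_add_distrib, Complex.re_sum]
      refine sum_congr rfl fun i _ => ?_
      rw [← sum_add_distrib, Complex.re_sum]
      refine sum_congr rfl fun j _ => ?_
      simp
      ring
    · have e2 : ∑ i ∈ range N, ∑ j ∈ range N, m i j * (c i).im * (c j).re =
          ∑ i ∈ range N, ∑ j ∈ range N, m i j * (c i).re * (c j).im := by
        rw [sum_comm]
        refine sum_congr rfl fun i _ => sum_congr rfl fun j _ => ?_
        rw [hsymm]
        ring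
      rw [Complex.im_sum]
      simp only [Complex.im_sum]
      rw [← sub_eq_zero, ← sum_sub_distrib] at e2
      rw [eq_comm, ← neg_eq_zero, ← sum_neg_distrib, ← e2]
      refine sum_congr rfl fun i _ => ?_
      rw [← sum_sub_distrib, ← sum_neg_distrib]
      refine sum_congr rfl fun j _ => ?_
      simp
      ring

theorem posSemidef_delta {G : Type*} [Group G] [DecidableEq G] :
    (Matrix.of fun g h : G => if g⁻¹ * h = 1 then (1 : ℂ) else 0).PosSemidef := by
  refine ⟨?_, fun c => ?_⟩
  · ext g h
    simp [inv_mul_eq_one, eq_comm]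
  · refine Finset.sum_nonneg fun g hg => ?_
    simp only [Matrix.of_apply]
    rw [Finsupp.sum, Finset.sum_eq_single g]
    · simpa using star_mul_self_nonneg (c g)
    · intro h _ hne
      simp [inv_mul_eq_one, hne.symm]
    · intro h
      exact absurd hg h

theorem isTracialCharacter_delta (G : Type*) [Group G] [DecidableEq G] :
    IsTracialCharacter fun g : G => if g = 1 then (1 : ℂ) else 0 where
  map_one := if_pos rfl
  mul_comm g h := by
    simp only [mul_eq_one_iff_eq_inv, mul_eq_one_iff_inv_eq (a := h), eq_comm]
  posSemidef := posSemidef_delta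

theorem posSemidef_fubmMoment_nat (t : ℝ≥0∞) (ht : t ≠ ⊤) :
    (Matrix.of fun i j : ℕ => (fubmMoment t (Nat.dist i j) : ℂ)).PosSemidef := by
  obtain ⟨ψ, h0, h1, h2⟩ := exists_momentSeries t ht
  refine Matrix.posSemidef_of_real (fun i j => by rw [Nat.dist_comm]) fun N x => ?_
  have h3 := sum_toeplitz_eq (fubmMoment t) (by simp [fubmMoment]) h0 h2 (PowerSeries.mk x) N
  simp only [PowerSeries.coeff_mk] at h3
  rw [h3]
  have := truncInner_nonneg h0 ENNReal.toReal_nonneg h1 N (PowerSeries.mk x)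
  positivity

/-- The moments of a free unitary Brownian motion form a positive definite function on `ℤ`. -/
theorem isTracialCharacter_fubmMoment (t : ℝ≥0∞) :
    IsTracialCharacter fun k : Multiplicative ℤ => (fubmMoment t k.toAdd.natAbs : ℂ) where
  map_one := by simp [fubmMoment]
  mul_comm g h := by rw [mul_comm]
  posSemidef := by
    by_cases ht : t = ⊤
    · have h := posSemidef_delta (G := Multiplicative ℤ)
      convert h using 4 with g h
      have h2 : (g⁻¹ * h).toAdd.natAbs = 0 ↔ g⁻¹ * h = 1 := Int.natAbs_eq_zero.trans toAdd_eq_zero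
      by_cases h1 : g⁻¹ * h = 1
      · rw [if_pos h1, h2.2 h1]
        simp [fubmMoment]
      · rw [if_neg h1, fubmMoment, if_neg (h2.not.2 h1), if_pos ht, Complex.ofReal_zero]
    · refine ⟨?_, fun c => ?_⟩
      · ext g h
        have : (Multiplicative.toAdd (h⁻¹ * g)).natAbs =
            (Multiplicative.toAdd (g⁻¹ * h)).natAbs := by
          simp only [toAdd_mul, toAdd_inv]
          omega
        rw [Matrix.conjTranspose_apply, Matrix.of_apply, Matrix.of_apply, this]
        exact Complex.conj_ofReal _
      · obtain ⟨a, ha⟩ : ∃ a : ℕ, ∀ g ∈ c.support, -(a : ℤ) ≤ g.toAdd := by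
          refine ⟨c.support.sup fun g => g.toAdd.natAbs, fun g hg => ?_⟩
          have := Finset.le_sup (f := fun g : Multiplicative ℤ => g.toAdd.natAbs) hg
          omega
        have h := ((posSemidef_fubmMoment_nat t ht).submatrix
          fun g : Multiplicative ℤ => (g.toAdd + a).toNat).2 c
        refine h.trans_eq (Finset.sum_congr rfl fun g hg => Finset.sum_congr rfl fun k hk => ?_)
        have hg := ha g hg
        have hk := ha k hk
        have : Nat.dist (g.toAdd + a).toNat (k.toAdd + a).toNat =
            (Multiplicative.toAdd (g⁻¹ * k)).natAbs := by
          simp only [toAdd_mul, toAdd_inv, Nat.dist]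
          omega
        simp only [Matrix.submatrix_apply, Matrix.of_apply, this]

end PositiveDefinite

/-! ### A $t$-free pair containing unitary elements of prescribed finite order -/

section Model

open MonoidAlgebra hiding of
open Monoid Monoid.CoprodI

namespace TFreeModel

/-- The cyclic group of order `60`. -/
abbrev Cyclic : Type := Multiplicative (ZMod 60)

/-- The factors of a free product of groups, `C × C` and `ℤ`, where `C` is a finite cyclic group. -/
def Factor : ULift.{u} Bool → Type
  | ⟨false⟩ => Cyclic × Cyclic
  | ⟨true⟩ => Multiplicative ℤ

instance : ∀ i, Group (Factor.{u} i)
  | ⟨false⟩ => inferInstanceAs (Group (Cyclic × Cyclic))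
  | ⟨true⟩ => inferInstanceAs (Group (Multiplicative ℤ))

instance : ∀ i, DecidableEq (Factor.{u} i)
  | ⟨false⟩ => inferInstanceAs (DecidableEq (Cyclic × Cyclic))
  | ⟨true⟩ => inferInstanceAs (DecidableEq (Multiplicative ℤ))

/-- The states of the factors: the canonical trace, and the law of a free unitary Brownian
motion. -/
noncomputable def character (t : ℝ≥0∞) : ∀ i, Factor.{u} i → ℂ
  | ⟨false⟩ => fun g : Cyclic × Cyclic => if g = 1 then 1 else 0
  | ⟨true⟩ => fun k : Multiplicative ℤ => (fubmMoment t k.toAdd.natAbs : ℂ)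

theorem isTracialCharacter_character (t : ℝ≥0∞) : ∀ i, IsTracialCharacter (character.{u} t i)
  | ⟨false⟩ => isTracialCharacter_delta (Cyclic × Cyclic)
  | ⟨true⟩ => isTracialCharacter_fubmMoment t

/-- The group of the model. -/
abbrev Grp : Type u := CoprodI Factor.{u}

/-- The expectation of the model. -/
noncomputable abbrev state (t : ℝ≥0∞) : MonoidAlgebra ℂ Grp.{u} →ₗ[ℂ] ℂ :=
  FreeProduct.freeState (character.{u} t)

theorem isFreeState_state (t : ℝ≥0∞) :
    IsFreeState (state.{u} t) fun i => groupSubalgebra (of : Factor.{u} i →* Grp.{u}) :=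
  FreeProduct.isFreeState (isTracialCharacter_character t)

/-- The free product of the group algebra of `C × C` and of the algebra generated by a free
unitary Brownian motion. -/
noncomputable def space (t : ℝ≥0∞) : NCProbSpace.{u} where
  carrier := MonoidAlgebra ℂ Grp.{u}
  φ := state t
  φ_one := (isFreeState_state t).map_one
  φ_mul_comm := (isFreeState_state t).apply_mul_comm
  φ_star := (isFreeState_state t).apply_star
  φ_nonneg x := by
    have := (isFreeState_state t).apply_star_mul_self_nonneg (star x)
    rwa [star_star] at this

/-- The inclusion of `C × C`. -/
def ofPair : Cyclic × Cyclic →* Grp.{u} := (of : Factor.{u} ⟨false⟩ →* Grp.{u})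

/-- The inclusion of `ℤ`. -/
def ofInt : Multiplicative ℤ →* Grp.{u} := (of : Factor.{u} ⟨true⟩ →* Grp.{u})

theorem state_ofPair (t : ℝ≥0∞) (g : Cyclic × Cyclic) :
    state.{u} t (single (ofPair g) 1) = if g = 1 then 1 else 0 :=
  FreeProduct.freeState_single_of (fun i => (isTracialCharacter_character t i).map_one)
    (i := ⟨false⟩) g

theorem state_ofInt (t : ℝ≥0∞) (k : Multiplicative ℤ) :
    state.{u} t (single (ofInt k) 1) = (fubmMoment t k.toAdd.natAbs : ℂ) :=
  FreeProduct.freeState_single_of (fun i => (isTracialCharacter_character t i).map_one)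
    (i := ⟨true⟩) k

theorem single_mem_unitary {G : Type*} [Group G] (g : G) :
    single g (1 : ℂ) ∈ unitary (MonoidAlgebra ℂ G) := by
  rw [Unitary.mem_iff, star_single, single_mul_single, single_mul_single]
  simp [MonoidAlgebra.one_def]

theorem single_pow_one {G : Type*} [Group G] (g : G) (k : ℕ) :
    single g (1 : ℂ) ^ k = single (g ^ k) 1 := by
  rw [single_pow, one_pow]

/-- The free unitary Brownian motion of the model. -/
noncomputable def bm : unitary (MonoidAlgebra ℂ Grp.{u}) :=
  ⟨single (ofInt (Multiplicative.ofAdd 1)) 1, single_mem_unitary _⟩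

theorem isFreeUnitaryBM_bm (t : ℝ≥0∞) :
    (space.{u} t).IsFreeUnitaryBM t (bm.{u} : MonoidAlgebra ℂ Grp.{u}) := by
  refine ⟨bm.2, fun k => ?_⟩
  change state t (single (ofInt (Multiplicative.ofAdd 1)) (1 : ℂ) ^ k) = _
  rw [single_pow_one, ← map_pow, state_ofInt]
  simp

/-- The first subalgebra, in the position of tensor independence with `rightTensor`. -/
noncomputable def left : StarSubalgebra ℂ (MonoidAlgebra ℂ Grp.{u}) :=
  groupSubalgebra (ofPair.comp (MonoidHom.inl Cyclic Cyclic))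

/-- The second subalgebra, before conjugation by the free unitary Brownian motion. -/
noncomputable def rightTensor : StarSubalgebra ℂ (MonoidAlgebra ℂ Grp.{u}) :=
  groupSubalgebra (ofPair.comp (MonoidHom.inr Cyclic Cyclic))

/-- The second subalgebra. -/
noncomputable def right : StarSubalgebra ℂ (MonoidAlgebra ℂ Grp.{u}) :=
  rightTensor.map (Unitary.conjStarAlgAut ℂ _ bm : _ →⋆ₐ[ℂ] _)

theorem left_commute_rightTensor {x y : MonoidAlgebra ℂ Grp.{u}} (hx : x ∈ left)
    (hy : y ∈ rightTensor) : x * y = y * x := by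
  induction hx using groupSubalgebra_induction with
  | zero => simp
  | add x z _ _ hx hz => rw [add_mul, mul_add, hx, hz]
  | single g c =>
    induction hy using groupSubalgebra_induction with
    | zero => simp
    | add x z _ _ hx hz => rw [add_mul, mul_add, hx, hz]
    | single h d =>
      rw [single_mul_single, single_mul_single, mul_comm c]
      simp only [MonoidHom.comp_apply, ← map_mul, MonoidHom.inl_apply, MonoidHom.inr_apply,
        Prod.mk_mul_mk, one_mul, mul_one]

theorem state_left_mul_rightTensor (t : ℝ≥0∞) {x y : MonoidAlgebra ℂ Grp.{u}} (hx : x ∈ left)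
    (hy : y ∈ rightTensor) : state t (x * y) = state t x * state t y := by
  induction hx using groupSubalgebra_induction with
  | zero => simp
  | add x z _ _ hx hz => rw [add_mul, map_add, map_add, hx, hz, add_mul]
  | single g c =>
    induction hy using groupSubalgebra_induction with
    | zero => simp
    | add x z _ _ hx hz => rw [mul_add, map_add, map_add, hx, hz, mul_add]
    | single h d =>
      rw [single_mul_single, ← smul_single_one _ c, ← smul_single_one _ d,
        ← smul_single_one _ (c * d)]
      simp only [MonoidHom.comp_apply, ← map_mul, MonoidHom.inl_apply, MonoidHom.inr_apply,
        Prod.mk_mul_mk, one_mul, mul_one, map_smul, state_ofPair, Prod.mk_eq_one, true_and,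
        and_true, smul_eq_mul]
      split_ifs <;> simp_all

/-- Both tensor factors thus lie in the algebra of $C\times C$, whose freeness with the algebra of
$\mathbb Z$ yields the freeness required of $u_t$. -/
theorem groupSubalgebra_comp_le {G H K : Type*} [Group G] [Group H] [Group K] (f : H →* G)
    (f' : K →* H) : groupSubalgebra (f.comp f') ≤ groupSubalgebra f := by
  intro x hx
  induction hx using groupSubalgebra_induction with
  | zero => exact zero_mem _
  | add x y _ _ hx hy => exact add_mem hx hy
  | single h c => exact single_mem_groupSubalgebra f (f' h) c

/-- The embedding of the first subalgebra. -/
noncomputable def leftHom : left.{u} →⋆ₐ[ℂ] MonoidAlgebra ℂ Grp.{u} := left.subtype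

/-- The embedding of the second subalgebra. -/
noncomputable def rightHom : right.{u} →⋆ₐ[ℂ] MonoidAlgebra ℂ Grp.{u} :=
  ((Unitary.conjStarAlgAut ℂ _ bm).symm : _ →⋆ₐ[ℂ] _).comp right.subtype

theorem range_leftHom_le : leftHom.{u}.range ≤ left := by
  rintro _ ⟨a, rfl⟩
  exact a.2

theorem range_rightHom_le : rightHom.{u}.range ≤ rightTensor := by
  rintro _ ⟨⟨_, b, hb, rfl⟩, rfl⟩
  have : rightHom.{u} ⟨_, b, hb, rfl⟩ = b :=
    (Unitary.conjStarAlgAut ℂ (MonoidAlgebra ℂ Grp.{u}) bm).symm_apply_apply b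
  exact this.symm ▸ hb

theorem bm_mul_rightHom_mul (b : right.{u}) :
    (bm.{u} : MonoidAlgebra ℂ Grp.{u}) * rightHom b * star (bm.{u} : MonoidAlgebra ℂ Grp.{u}) =
      b :=
  (Unitary.conjStarAlgAut ℂ (MonoidAlgebra ℂ Grp.{u}) bm).apply_symm_apply
    (b : MonoidAlgebra ℂ Grp.{u})

theorem state_conj (t : ℝ≥0∞) (x : MonoidAlgebra ℂ Grp.{u}) :
    state t (Unitary.conjStarAlgAut ℂ (MonoidAlgebra ℂ Grp.{u}) bm x) = state t x := by
  rw [Unitary.conjStarAlgAut_apply, (isFreeState_state t).apply_mul_comm, ← mul_assoc,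
    Unitary.coe_star_mul_self, one_mul]

theorem state_rightHom (t : ℝ≥0∞) (b : right.{u}) :
    state t (rightHom b) = state t (b : MonoidAlgebra ℂ Grp.{u}) := by
  rw [← state_conj, Unitary.conjStarAlgAut_apply, bm_mul_rightHom_mul]

theorem independent_range (t : ℝ≥0∞) :
    (space.{u} t).Independent ![leftHom.range, rightHom.range] := by
  constructor
  · intro i j hij x hx y hy
    fin_cases i <;> fin_cases j
    · exact absurd rfl hij
    · exact left_commute_rightTensor (range_leftHom_le hx) (range_rightHom_le hy)
    · exact (left_commute_rightTensor (range_leftHom_le hy) (range_rightHom_le hx)).symm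
    · exact absurd rfl hij
  · intro n hn i hi a ha ha0
    have h2 : n ≤ 2 := by simpa using Fintype.card_le_of_injective i hi
    interval_cases n
    · simpa using ha0 0
    · have h01 : i 0 ≠ i 1 := fun h => by simpa using hi h
      have h0 := ha 0
      have h1 := ha 1
      rw [List.ofFn_succ, List.ofFn_succ, List.ofFn_zero, List.prod_cons, List.prod_cons,
        List.prod_nil, mul_one]
      have key : (space.{u} t).φ (a 0 * a 1) = (space.{u} t).φ (a 0) * (space.{u} t).φ (a 1) := by
        generalize i 0 = k at h0 h01
        generalize i 1 = l at h1 h01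
        fin_cases k <;> fin_cases l
        · exact absurd rfl h01
        · exact state_left_mul_rightTensor t (range_leftHom_le h0) (range_rightHom_le h1)
        · rw [(space t).φ_mul_comm, mul_comm]
          exact state_left_mul_rightTensor t (range_leftHom_le h1) (range_rightHom_le h0)
        · exact absurd rfl h01
      exact key.trans (by rw [ha0 0, zero_mul])

theorem free_range (t : ℝ≥0∞) :
    (space.{u} t).Free ![leftHom.range ⊔ rightHom.range,
      StarAlgebra.adjoin ℂ {(bm.{u} : MonoidAlgebra ℂ Grp.{u})}] := by
  intro n hn i hi a ha ha0
  have hle : ∀ k : Fin 2, ∀ x ∈ (![leftHom.range ⊔ rightHom.range,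
      StarAlgebra.adjoin ℂ {(bm.{u} : MonoidAlgebra ℂ Grp.{u})}] k :
        StarSubalgebra ℂ (MonoidAlgebra ℂ Grp.{u})),
      x ∈ groupSubalgebra (of : Factor.{u} (![⟨false⟩, ⟨true⟩] k) →* Grp.{u}) := by
    intro k
    fin_cases k
    · exact sup_le (range_leftHom_le.trans (groupSubalgebra_comp_le ofPair _))
        (range_rightHom_le.trans (groupSubalgebra_comp_le ofPair _))
    · refine StarAlgebra.adjoin_le (Set.singleton_subset_iff.2 ?_)
      exact single_mem_groupSubalgebra ofInt _ 1
  have h := (isFreeState_state t).free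
    (List.ofFn fun k => ((![⟨false⟩, ⟨true⟩] : Fin 2 → ULift.{u} Bool) (i k), a k))
    (by simpa using (by omega : n ≠ 0)) ?_ ?_
  · rw [List.map_ofFn] at h
    exact h
  · rw [List.isChain_ofFn]
    intro k hk h
    refine hi ⟨k, by omega⟩ ⟨k + 1, hk⟩ rfl ?_
    revert h
    generalize i _ = p
    generalize i _ = q
    fin_cases p <;> fin_cases q <;> simp
  · intro p hp
    obtain ⟨k, rfl⟩ := (List.mem_ofFn' _ _).1 hp
    exact ⟨hle _ _ (ha k), ha0 k⟩

theorem isTFreeRealization (t : ℝ≥0∞) :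
    (space.{u} t).IsTFreeRealization t left right (space t) leftHom rightHom
      (bm.{u} : MonoidAlgebra ℂ Grp.{u}) where
  φ_left _ := rfl
  φ_right := state_rightHom t
  indep := independent_range t
  bm := isFreeUnitaryBM_bm t
  free := free_range t

theorem tFree (t : ℝ≥0∞) : (space.{u} t).TFree t left right := by
  refine ⟨space t, leftHom, rightHom, (bm.{u} : MonoidAlgebra ℂ Grp.{u}), isTFreeRealization t,
    fun n a b => ?_⟩
  refine congr_arg (fun l : List (MonoidAlgebra ℂ Grp.{u}) => state t l.prod)
    (congr_arg List.ofFn (funext fun k => ?_))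
  exact congr_arg (fun y : MonoidAlgebra ℂ Grp.{u} => leftHom (a k) * y)
    (bm_mul_rightHom_mul (b k)).symm

/-- The integer $60$ is a common multiple of $2,3,4,5$, so `Cyclic` has elements of all these
orders. An element of order $60$ has zero moments of orders $1$ to $6$ and plays the role of $0$. -/
theorem cyclic_pow_eq_one_iff {p : ℕ} (hp : p ∣ 60) (k : ℕ) :
    (Multiplicative.ofAdd ((60 / p : ℕ) : ZMod 60)) ^ k = 1 ↔ p ∣ k := by
  obtain ⟨q, hq⟩ := hp
  have hp0 : 0 < p := Nat.pos_of_ne_zero fun h => by simp [h] at hq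
  have hq0 : 0 < q := Nat.pos_of_ne_zero fun h => by simp [h] at hq
  rw [← ofAdd_nsmul, ofAdd_eq_one, nsmul_eq_mul, ← Nat.cast_mul, ZMod.natCast_eq_zero_iff]
  conv_lhs => rw [hq, Nat.mul_div_cancel_left q hp0]
  exact Nat.mul_dvd_mul_iff_right hq0

theorem state_ofPair_pow (t : ℝ≥0∞) (g : Cyclic × Cyclic) (k : ℕ) :
    state.{u} t (single (ofPair g) 1 ^ k) = if g ^ k = 1 then 1 else 0 := by
  rw [single_pow_one, ← map_pow, state_ofPair]

/-- The first subalgebra contains unitary elements of any order dividing `60`. -/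
theorem exists_mem_left (t : ℝ≥0∞) {p : ℕ} (hp : p ∣ 60) :
    ∃ a : space.{u} t, a ∈ (left : StarSubalgebra ℂ (space.{u} t)) ∧
      a ∈ unitary (space.{u} t : Type u) ∧
      ∀ k, (space.{u} t).φ (a ^ k) = if p ∣ k then 1 else 0 := by
  refine ⟨single (ofPair (MonoidHom.inl _ _ (Multiplicative.ofAdd ((60 / p : ℕ) : ZMod 60)))) 1,
    single_mem_groupSubalgebra (ofPair.comp (MonoidHom.inl _ _)) _ 1, single_mem_unitary _,
    fun k => ?_⟩
  refine (state_ofPair_pow t _ k).trans ?_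
  simp only [MonoidHom.inl_apply, Prod.pow_mk, one_pow, Prod.mk_eq_one, and_true, cyclic_pow_eq_one_iff hp]

/-- The second subalgebra contains unitary elements of any order dividing `60`. -/
theorem exists_mem_right (t : ℝ≥0∞) {p : ℕ} (hp : p ∣ 60) :
    ∃ b : space.{u} t, b ∈ (right : StarSubalgebra ℂ (space.{u} t)) ∧
      b ∈ unitary (space.{u} t : Type u) ∧
      ∀ k, (space.{u} t).φ (b ^ k) = if p ∣ k then 1 else 0 := by
  let g := ofPair.{u} (MonoidHom.inr _ _ (Multiplicative.ofAdd ((60 / p : ℕ) : ZMod 60)))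
  refine ⟨Unitary.conjStarAlgAut ℂ (MonoidAlgebra ℂ Grp.{u}) bm (single g 1),
    ⟨single g 1, single_mem_groupSubalgebra (ofPair.comp (MonoidHom.inr _ _)) _ 1, rfl⟩,
    Unitary.map_mem _ (single_mem_unitary g), fun k => ?_⟩
  refine (congr_arg (state t) (map_pow (Unitary.conjStarAlgAut ℂ _ bm) (single g 1) k).symm).trans
    ((state_conj t _).trans ((state_ofPair_pow t _ k).trans ?_))
  simp only [MonoidHom.inr_apply, Prod.pow_mk, one_pow, Prod.mk_eq_one, true_and,
    cyclic_pow_eq_one_iff hp]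

end TFreeModel

/-- There are `t`-free subalgebras that contain unitary elements of any order dividing `60`. -/
theorem exists_tFree_unitary (t : ℝ≥0∞) :
    ∃ (M : NCProbSpace.{u}) (A B : StarSubalgebra ℂ M), M.TFree t A B ∧
      (∀ p, p ∣ 60 → ∃ a ∈ A, a ∈ unitary (M : Type u) ∧
        ∀ k, M.φ (a ^ k) = if p ∣ k then 1 else 0) ∧
      ∀ p, p ∣ 60 → ∃ b ∈ B, b ∈ unitary (M : Type u) ∧
        ∀ k, M.φ (b ^ k) = if p ∣ k then 1 else 0 :=
  ⟨TFreeModel.space t, TFreeModel.left, TFreeModel.right, TFreeModel.tFree t,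
    fun _ hp => TFreeModel.exists_mem_left t hp, fun _ hp => TFreeModel.exists_mem_right t hp⟩

end Model

/-! ### Uniqueness: a triangular linear system -/

section Uniqueness

/-- The moments of a unitary element of order `p`. -/
noncomputable def orderMoment (p k : ℕ) : ℂ := if p ∣ k then 1 else 0

/-- The equations satisfied by the coefficients of a class function whose mixed cumulants vanish,
written for sums of scalars and of unitary elements of finite order. -/
def AdditiveOnRoots (x : ℂ) (n : ℕ) (F : List ℕ → ℂ) : Prop :=
  ∀ p q : ℕ, 2 ≤ p → 2 ≤ q → p ∣ 60 → q ∣ 60 → ∀ s s' : ℂ,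
    momentSum n F (shiftMoment (s + s') (mixMoment x (orderMoment p) (orderMoment q))) =
      momentSum n F (shiftMoment s (orderMoment p)) + momentSum n F (shiftMoment s' (orderMoment q))

theorem shiftMoment_one (s : ℂ) (g : ℕ → ℂ) : shiftMoment s g 1 = g 0 * s + g 1 := by
  simp [shiftMoment, Finset.sum_range_succ]

theorem shiftMoment_two (s : ℂ) (g : ℕ → ℂ) :
    shiftMoment s g 2 = g 0 * s ^ 2 + 2 * g 1 * s + g 2 := by
  simp [shiftMoment, Finset.sum_range_succ]
  ring

theorem shiftMoment_three (s : ℂ) (g : ℕ → ℂ) :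
    shiftMoment s g 3 = g 0 * s ^ 3 + 3 * g 1 * s ^ 2 + 3 * g 2 * s + g 3 := by
  simp [shiftMoment, Finset.sum_range_succ, Nat.choose]
  ring

theorem shiftMoment_four (s : ℂ) (g : ℕ → ℂ) :
    shiftMoment s g 4 = g 0 * s ^ 4 + 4 * g 1 * s ^ 3 + 6 * g 2 * s ^ 2 + 4 * g 3 * s + g 4 := by
  simp [shiftMoment, Finset.sum_range_succ, Nat.choose]
  ring

theorem shiftMoment_five (s : ℂ) (g : ℕ → ℂ) :
    shiftMoment s g 5 = g 0 * s ^ 5 + 5 * g 1 * s ^ 4 + 10 * g 2 * s ^ 3 + 10 * g 3 * s ^ 2 +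
      5 * g 4 * s + g 5 := by
  simp [shiftMoment, Finset.sum_range_succ, Nat.choose]
  ring

/-- With `p = q = 60` only the scalars are visible, and the equation compares the powers of $1+1$
with those of $1$; in each order it yields the coefficient of $1^n$, with factor $2^n-2$, once the
other ones are known to vanish. -/
theorem AdditiveOnRoots.eq_zero_two {x : ℂ} {F : List ℕ → ℂ} (h : AdditiveOnRoots x 2 F)
    (h2 : F [2] = 0) : F [1, 1] = 0 := by
  have h0 := h 60 60 (by norm_num) (by norm_num) (by norm_num) (by norm_num) 1 1
  simp only [momentSum_two, shiftMoment_one, h2, mixMoment, orderMoment, Nat.reduceDvd,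
    reduceIte] at h0
  norm_num only at h0
  linear_combination (1 / 2) * h0

theorem AdditiveOnRoots.eq_zero_three {x : ℂ} {F : List ℕ → ℂ} (h : AdditiveOnRoots x 3 F)
    (h3 : F [3] = 0) : F [2, 1] = 0 ∧ F [1, 1, 1] = 0 := by
  have h0 := h 60 60 (by norm_num) (by norm_num) (by norm_num) (by norm_num) 1 1
  have h1 := h 2 60 (by norm_num) (by norm_num) (by norm_num) (by norm_num) 0 1
  simp only [momentSum_three, shiftMoment_one, shiftMoment_two, h3, mixMoment, orderMoment,
    Nat.reduceDvd, reduceIte] at h0 h1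
  norm_num only at h0 h1
  have e : F [2, 1] = 0 := by linear_combination (1 / 3) * h1
  rw [e] at h0
  exact ⟨e, by linear_combination (1 / 6) * h0⟩

theorem AdditiveOnRoots.eq_zero_four {x : ℂ} {F : List ℕ → ℂ} (h : AdditiveOnRoots x 4 F)
    (h4 : F [4] = 0) :
    F [3, 1] = 0 ∧ F [2, 2] = 0 ∧ F [2, 1, 1] = 0 ∧ F [1, 1, 1, 1] = 0 := by
  have h0 := h 60 60 (by norm_num) (by norm_num) (by norm_num) (by norm_num) 1 1
  have h1 := h 3 60 (by norm_num) (by norm_num) (by norm_num) (by norm_num) 0 1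
  have h2 := h 2 2 (by norm_num) (by norm_num) (by norm_num) (by norm_num) 0 0
  have h3 := h 2 60 (by norm_num) (by norm_num) (by norm_num) (by norm_num) 0 1
  simp only [momentSum_four, shiftMoment_one, shiftMoment_two, shiftMoment_three, h4, mixMoment,
    orderMoment, Nat.reduceDvd, reduceIte] at h0 h1 h2 h3
  norm_num only at h0 h1 h2 h3
  have e31 : F [3, 1] = 0 := by linear_combination (1 / 8) * h1
  have e22 : F [2, 2] = 0 := by linear_combination (1 / 6) * h2
  rw [e31, e22] at h0 h3
  have e211 : F [2, 1, 1] = 0 := by linear_combination (1 / 6) * h3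
  rw [e211] at h0
  exact ⟨e31, e22, e211, by linear_combination (1 / 14) * h0⟩

theorem AdditiveOnRoots.eq_zero_five {x : ℂ} {F : List ℕ → ℂ} (h : AdditiveOnRoots x 5 F)
    (h5 : F [5] = 0) :
    F [4, 1] = 0 ∧ F [3, 2] = 0 ∧ F [3, 1, 1] = 0 ∧ F [2, 2, 1] = 0 ∧ F [2, 1, 1, 1] = 0 ∧
      F [1, 1, 1, 1, 1] = 0 := by
  have h0 := h 60 60 (by norm_num) (by norm_num) (by norm_num) (by norm_num) 1 1
  have h1 := h 4 60 (by norm_num) (by norm_num) (by norm_num) (by norm_num) 0 1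
  have h2 := h 3 2 (by norm_num) (by norm_num) (by norm_num) (by norm_num) 0 0
  have h3 := h 3 60 (by norm_num) (by norm_num) (by norm_num) (by norm_num) 0 1
  have h4 := h 2 60 (by norm_num) (by norm_num) (by norm_num) (by norm_num) 0 1
  have h6 := h 2 60 (by norm_num) (by norm_num) (by norm_num) (by norm_num) 0 2
  simp only [momentSum_five, shiftMoment_one, shiftMoment_two, shiftMoment_three, shiftMoment_four,
    h5, mixMoment, orderMoment, Nat.reduceDvd, reduceIte] at h0 h1 h2 h3 h4 h6
  norm_num only at h0 h1 h2 h3 h4 h6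
  have e41 : F [4, 1] = 0 := by linear_combination (1 / 30) * h1
  have e32 : F [3, 2] = 0 := by linear_combination (1 / 20) * h2
  rw [e41, e32] at h0 h3 h4 h6
  have e311 : F [3, 1, 1] = 0 := by linear_combination (1 / 20) * h3
  rw [e311] at h0 h4 h6
  -- For an element of order two and a scalar $s$, the equation is
  -- $15F_{221}(2s^3+s)+10F_{2111}s^3=0$. The values $s=1$ and $s=2$ separate the two unknowns.
  have e221 : F [2, 2, 1] = 0 := by linear_combination (8 / 90) * h4 - (1 / 90) * h6
  rw [e221] at h0 h4
  have e2111 : F [2, 1, 1, 1] = 0 := by linear_combination (1 / 10) * h4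
  rw [e2111] at h0
  exact ⟨e41, e32, e311, e221, e2111, by linear_combination (1 / 30) * h0⟩

/-- Orders `p`, `q` isolate the partitions with parts `p`, `q`, and scalars supply the parts `1`.
The mixed terms, which depend on `x`, only multiply coefficients already known to vanish, so the
system is triangular for every `x`. -/
theorem AdditiveOnRoots.eq_zero_six {x : ℂ} {F : List ℕ → ℂ} (h : AdditiveOnRoots x 6 F)
    (h6 : F [6] = 0) :
    F [5, 1] = 0 ∧ F [4, 2] = 0 ∧ F [4, 1, 1] = 0 ∧ F [3, 3] = 0 ∧ F [3, 2, 1] = 0 ∧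
      F [3, 1, 1, 1] = 0 ∧ F [2, 2, 2] = 0 ∧ F [2, 2, 1, 1] = 0 ∧ F [2, 1, 1, 1, 1] = 0 ∧
      F [1, 1, 1, 1, 1, 1] = 0 := by
  have h0 := h 60 60 (by norm_num) (by norm_num) (by norm_num) (by norm_num) 1 1
  have h1 := h 5 60 (by norm_num) (by norm_num) (by norm_num) (by norm_num) 0 1
  have h2 := h 4 2 (by norm_num) (by norm_num) (by norm_num) (by norm_num) 0 0
  have h3 := h 4 60 (by norm_num) (by norm_num) (by norm_num) (by norm_num) 0 1
  have h4 := h 3 3 (by norm_num) (by norm_num) (by norm_num) (by norm_num) 0 0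
  have h5 := h 2 2 (by norm_num) (by norm_num) (by norm_num) (by norm_num) 0 0
  have h7 := h 3 2 (by norm_num) (by norm_num) (by norm_num) (by norm_num) 0 1
  have h8 := h 3 60 (by norm_num) (by norm_num) (by norm_num) (by norm_num) 0 1
  have h9 := h 2 60 (by norm_num) (by norm_num) (by norm_num) (by norm_num) 0 1
  have h10 := h 2 60 (by norm_num) (by norm_num) (by norm_num) (by norm_num) 0 2
  simp only [momentSum_six, shiftMoment_one, shiftMoment_two, shiftMoment_three, shiftMoment_four,
    shiftMoment_five, h6, mixMoment, orderMoment, Nat.reduceDvd, reduceIte]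
    at h0 h1 h2 h3 h4 h5 h7 h8 h9 h10
  norm_num only at h0 h1 h2 h3 h4 h5 h7 h8 h9 h10
  have e51 : F [5, 1] = 0 := by linear_combination (1 / 144) * h1
  have e42 : F [4, 2] = 0 := by linear_combination (1 / 90) * h2
  have e33 : F [3, 3] = 0 := by linear_combination (1 / 80) * h4
  rw [e51, e42, e33] at h0 h3 h5 h7 h8 h9 h10
  have e411 : F [4, 1, 1] = 0 := by linear_combination (1 / 90) * h3
  have e222 : F [2, 2, 2] = 0 := by linear_combination (1 / 90) * h5
  rw [e411, e222] at h0 h7 h8 h9 h10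
  -- The difference of the two equations removes the contribution of $F_{3111}$, which does not
  -- involve the element of order two.
  have e321 : F [3, 2, 1] = 0 := by linear_combination (1 / 120) * (h7 - h8)
  rw [e321] at h0 h8 h9 h10
  have e3111 : F [3, 1, 1, 1] = 0 := by linear_combination (1 / 40) * h8
  rw [e3111] at h0 h9 h10
  -- The equation for the scalar $s$ is $45F_{2211}(2s^4+s^2)+15F_{21111}s^4=0$, used at $s=1$ and
  -- $s=2$.
  have e2211 : F [2, 2, 1, 1] = 0 := by linear_combination (16 / 540) * h9 - (1 / 540) * h10
  rw [e2211] at h0 h9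
  have e21111 : F [2, 1, 1, 1, 1] = 0 := by linear_combination (1 / 15) * h9
  rw [e21111] at h0
  exact ⟨e51, e42, e411, e33, e321, e3111, e222, e2211, e21111,
    by linear_combination (1 / 62) * h0⟩

theorem AdditiveOnRoots.comp_cycleShape_eq_zero {x : ℂ} {n : ℕ} (hn : n ∈ Finset.Icc 2 6)
    {F : List ℕ → ℂ} (h : AdditiveOnRoots x n F) (hF : F [n] = 0) (σ : Equiv.Perm (Fin n)) :
    F (cycleShape σ) = 0 := by
  -- Summing the squared moduli over all permutations turns the claim into one about the explicit
  -- list of shapes.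
  suffices h0 : ∑ σ : Equiv.Perm (Fin n), star (F (cycleShape σ)) * F (cycleShape σ) = 0 by
    rw [Finset.sum_eq_zero_iff_of_nonneg fun σ _ => star_mul_self_nonneg _] at h0
    have := h0 σ (Finset.mem_univ σ)
    rcases mul_eq_zero.1 this with h1 | h1
    · exact star_eq_zero.1 h1
    · exact h1
  rw [Finset.mem_Icc] at hn
  obtain ⟨h2, h6⟩ := hn
  interval_cases n
  · rw [sum_comp_cycleShape_two fun l => star (F l) * F l, hF, h.eq_zero_two hF]
    simp
  · obtain ⟨e1, e2⟩ := h.eq_zero_three hF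
    rw [sum_comp_cycleShape_three fun l => star (F l) * F l, hF, e1, e2]
    simp
  · obtain ⟨e1, e2, e3, e4⟩ := h.eq_zero_four hF
    rw [sum_comp_cycleShape_four fun l => star (F l) * F l, hF, e1, e2, e3, e4]
    simp
  · obtain ⟨e1, e2, e3, e4, e5, e6⟩ := h.eq_zero_five hF
    rw [sum_comp_cycleShape_five fun l => star (F l) * F l, hF, e1, e2, e3, e4, e5, e6]
    simp
  · obtain ⟨e1, e2, e3, e4, e5, e6, e7, e8, e9, e10⟩ := h.eq_zero_six hF
    rw [sum_comp_cycleShape_six fun l => star (F l) * F l, hF, e1, e2, e3, e4, e5, e6, e7, e8, e9,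
      e10]
    simp

/-- If `y` were in both subalgebras, then $1=\varphi(yy^*)=\varphi(y)\varphi(y^*)=0$. This
guarantees that the test arguments are mixed in the sense of the definition of a cumulant. -/
theorem NCProbSpace.TFree.not_mem_of_mem_unitary {M : NCProbSpace.{u}} {t : ℝ≥0∞}
    {A B : StarSubalgebra ℂ M} (h : M.TFree t A B) {y : M} (hy : y ∈ unitary (M : Type u))
    (h0 : M.φ y = 0) (s : ℂ) : y + s • (1 : M) ∈ A → y + s • (1 : M) ∉ B := by
  intro hA hB
  have key : ∀ C : StarSubalgebra ℂ M, y + s • (1 : M) ∈ C → y ∈ C := fun C hC => by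
    have := sub_mem hC (C.smul_mem (one_mem C) s)
    rwa [add_sub_cancel_right] at this
  have h1 := h.φ_mul (key A hA) (star_mem (key B hB))
  rw [h0, zero_mul, Unitary.mul_star_self_of_mem hy, M.φ_one] at h1
  exact one_ne_zero h1

/-- In the expansion over subsets of indices, all terms but the two extreme ones have mixed
arguments. -/
theorem NCProbSpace.cumulantForm_add {M : NCProbSpace.{u}} {n : ℕ} {c : Equiv.Perm (Fin n) → ℂ}
    (hn : n ≠ 0) {A B : StarSubalgebra ℂ M}
    (h : ∀ m : Fin n → M, (∀ i, m i ∈ A ∨ m i ∈ B) → (¬ ∀ i, m i ∈ A) → (¬ ∀ i, m i ∈ B) →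
      ∑ σ, c σ * M.permForm σ m = 0)
    {a b : M} (haA : a ∈ A) (haB : a ∉ B) (hbB : b ∈ B) (hbA : b ∉ A) :
    M.cumulantForm c (fun _ => a + b) = M.cumulantForm c (fun _ => a) +
      M.cumulantForm c (fun _ => b) := by
  classical
  have e : (fun _ : Fin n => a + b) = (fun _ => a) + (fun _ => b) := rfl
  have : Nonempty (Fin n) := ⟨⟨0, Nat.pos_of_ne_zero hn⟩⟩
  rw [e, MultilinearMap.map_add_univ, ← Finset.sum_subset (Finset.subset_univ {Finset.univ, ∅}),
    Finset.sum_pair Finset.univ_nonempty.ne_empty, Finset.piecewise_univ, Finset.piecewise_empty]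
  intro S _ hS
  simp only [Finset.mem_insert, Finset.mem_singleton, not_or] at hS
  obtain ⟨i, hi⟩ := Finset.nonempty_iff_ne_empty.2 hS.2
  obtain ⟨j, hj⟩ : ∃ j, j ∉ S := by
    by_contra hc
    push Not at hc
    exact hS.1 (Finset.eq_univ_iff_forall.2 hc)
  rw [M.cumulantForm_apply]
  refine h _ (fun k => ?_) (fun hA => ?_) (fun hB => ?_)
  · by_cases hk : k ∈ S
    · rw [Finset.piecewise_eq_of_mem _ _ _ hk]; exact Or.inl haA
    · rw [Finset.piecewise_eq_of_notMem _ _ _ hk]; exact Or.inr hbB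
  · have := hA j
    rw [Finset.piecewise_eq_of_notMem _ _ _ hj] at this
    exact hbA this
  · have := hB i
    rw [Finset.piecewise_eq_of_mem _ _ _ hi] at this
    exact haB this

theorem additiveOnRoots_of_vanishing (t : ℝ≥0∞) {n : ℕ} (hn : n ∈ Finset.Icc 2 6) {F : List ℕ → ℂ}
    (h : ∀ (M : NCProbSpace.{u}) (A B : StarSubalgebra ℂ M), M.TFree t A B →
      ∀ m : Fin n → M, (∀ i, m i ∈ A ∨ m i ∈ B) → (¬ ∀ i, m i ∈ A) → (¬ ∀ i, m i ∈ B) →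
        ∑ σ, F (cycleShape σ) * M.permForm σ m = 0) : AdditiveOnRoots (expNeg t) n F := by
  intro p q hp hq hp60 hq60 s s'
  obtain ⟨M, A, B, hT, hA, hB⟩ := exists_tFree_unitary.{u} t
  obtain ⟨a, haA, hau, ha⟩ := hA p hp60
  obtain ⟨b, hbB, hbu, hb⟩ := hB q hq60
  have ha0 : M.φ a = 0 := by
    have := ha 1
    rwa [pow_one, if_neg (by rw [Nat.dvd_one]; omega)] at this
  have hb0 : M.φ b = 0 := by
    have := hb 1
    rwa [pow_one, if_neg (by rw [Nat.dvd_one]; omega)] at this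
  have haA' := add_mem haA (A.smul_mem (one_mem A) s)
  have hbB' := add_mem hbB (B.smul_mem (one_mem B) s')
  have key := NCProbSpace.cumulantForm_add (by have := (Finset.mem_Icc.1 hn).1; omega)
    (h _ _ _ hT) haA' (fun hB => hT.not_mem_of_mem_unitary hau ha0 s haA' hB) hbB'
    (fun hA => hT.not_mem_of_mem_unitary hbu hb0 s' hA hbB')
  simp only [cumulantForm_const_eq_momentSum] at key
  rw [momentSum_congr _ fun k hk => hT.φ_add_add_smul_one_pow haA hbB ha0 hb0 s s'
    (hk.trans (Finset.mem_Icc.1 hn).2)] at key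
  simp only [NCProbSpace.φ_add_smul_one_pow, ha, hb] at key
  exact key

theorem IsTFreeCumulant.eq_smul {t : ℝ≥0∞} {n : ℕ} (hn : n ∈ Finset.Icc 2 6)
    {c : Equiv.Perm (Fin n) → ℂ} (h : IsTFreeCumulant.{u} t n c) (hc : IsConjInvariant c) :
    ∃ z : ℂ, z ≠ 0 ∧ c = z • fun σ => (tFreeCoeff (expNeg t) (cycleShape σ) : ℂ) := by
  obtain ⟨F, hF⟩ := exists_eq_comp_cycleShape hc
  obtain rfl : c = fun σ => F (cycleShape σ) := funext hF
  refine ⟨F [n], fun h0 => h.1 ?_, ?_⟩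
  · rw [sum_cycleType_singleton (Finset.mem_Icc.1 hn).1, h0, mul_zero]
  -- The vanishing conditions are linear, so they hold for the difference, whose coefficient on
  -- $n$-cycles is zero because the known cumulant is normalized by $c_n=1$.
  · have hD := additiveOnRoots_of_vanishing.{u} t hn
      (F := fun l => F l - F [n] * (tFreeCoeff (expNeg t) l : ℂ)) fun M A B hT m hm hA hB => by
        have h1 := h.2 M A B hT m hm hA hB
        have h2 := (isTFreeCumulant_tFreeCoeff.{u} t hn).2 M A B hT m hm hA hB
        simp only [sub_mul, Finset.sum_sub_distrib, mul_assoc, ← Finset.mul_sum]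
        rw [h1, h2, mul_zero, sub_zero]
    funext σ
    have := hD.comp_cycleShape_eq_zero hn (by simp [tFreeCoeff_singleton _ hn]) σ
    simpa [sub_eq_zero] using this

theorem IsTFreeCumulant.smul {t : ℝ≥0∞} {n : ℕ} {c : Equiv.Perm (Fin n) → ℂ}
    (h : IsTFreeCumulant.{u} t n c) {z : ℂ} (hz : z ≠ 0) : IsTFreeCumulant.{u} t n (z • c) := by
  refine ⟨?_, fun M A B hT m hm hA hB => ?_⟩
  · simp only [Pi.smul_apply, smul_eq_mul, ← Finset.mul_sum]
    exact mul_ne_zero hz h.1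
  · simp only [Pi.smul_apply, smul_eq_mul, mul_assoc, ← Finset.mul_sum]
    rw [h.2 M A B hT m hm hA hB, mul_zero]

end Uniqueness

theorem mainTheorem2 (t : ℝ≥0∞) (n : ℕ) (hn : n ∈ Finset.Icc 2 6) :
    ∃ c : Equiv.Perm (Fin n) → ℂ,
      IsTFreeCumulant.{u} t n c ∧ IsConjInvariant c ∧
      (∀ σ, c σ = (tFreeCoeff (expNeg t) (cycleShape σ) : ℂ)) ∧
      ∀ c' : Equiv.Perm (Fin n) → ℂ,
        (IsTFreeCumulant.{u} t n c' ∧ IsConjInvariant c') ↔ ∃ z : ℂ, z ≠ 0 ∧ c' = z • c := by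
  have h := isTFreeCumulant_tFreeCoeff.{u} t hn
  have hc : IsConjInvariant fun σ : Equiv.Perm (Fin n) =>
      (tFreeCoeff (expNeg t) (cycleShape σ) : ℂ) :=
    isConjInvariant_comp_cycleShape fun l => (tFreeCoeff (expNeg t) l : ℂ)
  refine ⟨_, h, hc, fun _ => rfl, fun c' => ⟨fun h' => h'.1.eq_smul hn h'.2, ?_⟩⟩
  rintro ⟨z, hz, rfl⟩
  exact ⟨h.smul hz, fun σ ρ => congr_arg (z • ·) (hc σ ρ)⟩
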